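/- **Definitions.** For $A\in\mathbb R^{m\times n}$ let $\Pi_A$ be the orthogonal projection onto $\operatorname{im}A$ and $\operatorname{nnz}(A)$ the number of non-zero entries of $A$. An LSA instance is a triple $(A,c,\epsilon)$ with $A\in\mathbb R^{m\times n}$, $A\ne 0$, $\operatorname{nnz}(A)\ge\max(m,n)$, $c\in\mathbb R^m$, $0<\epsilon\le 1$; a solution of it is an $x\in\mathbb R^n$ with $\|Ax-\Pi_Ac\|_2\le\epsilon\|\Pi_Ac\|_2$. Its sparse parameter complexity is $$\mathcal S(A,c,\epsilon)=\Bigl(\operatorname{nnz}(A),\ \max\bigl(\|A\|_{\max},\|c\|_{\max},\tfrac1{\min_+(A)},\tfrac1{\min_+(c)}\bigr),\ \kappa(A),\ \epsilon^{-1}\Bigr),$$ where $\|\cdot\|_{\max}$ is the largest absolute value of an entry, $\min_+$ is the smallest absolute value of a non-zero entry (the term $1/\min_+(c)$ is omitted if $c=0$), and $\kappa(A)=\sigma_{\max}(A)/\sigma_{\min}(A)$ is the ratio of the largest to the smallest non-zero singular value. $\mathcal G_{z,2}$ is the class of all integer matrices with at least one non-zero entry in every row and every column, in which every row sums to zero and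 the positive entries of every row sum to a power of $2$. $\mathcal{MC}_2$ (2-commodity incidence matrices) is the class of all real matrices with $2N$ columns, for some $N$, grouped into consecutive pairs that correspond to variables $(u_1,v_1),\dots,(u_N,v_N)$, in which every row is the coefficient vector of $w(u_i-u_j)$, $w(v_i-v_j)$ or $w\bigl(u_i-v_i-(u_j-v_j)\bigr)$ for some $i\neq j$ and $w\in\mathbb R$, depending on the row. Let $f:\mathbb R_{>0}^4\to\mathbb R_{>0}^4$ be non-decreasing in every variable. Algorithms are programs of a real RAM (unit-cost $+,-,\times,/,\sqrt{\ }$ and comparisons on reals, integer arithmetic, indexed memory access, no rounding); a matrix is given by its dimensions and the list of its non-zero entries sorted by rows. We write $\mathcal G_{z,2}\le_f\mathcal{MC}_2$ (efficient $f$-reducibility) if there are two algorithms $\mathcal A_{1\to2}$, $\mathcal A_{1\leftarrow2}$ such that for every LSA instance $(M^1,c^1,\epsilon_1)$ with $M^1\in\mathcal G_{z,2}$, with $\mathcal S(M^1,c^1,\epsilon_1)=(s,U,K,\epsilon_1^{-1})$: * $\mathcal A_{1\to2}(M^1,c^1,\epsilon_1)$ returns, in time $O(s\log(sU))$, an LSA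 instance $(M^2,c^2,\epsilon_2)$ with $M^2\in\mathcal{MC}_2$ and $\mathcal S(M^2,c^2,\epsilon_2)\le f(\mathcal S(M^1,c^1,\epsilon_1))$ coordinatewise; * for every solution $x^2$ of $(M^2,c^2,\epsilon_2)$, $\mathcal A_{1\leftarrow2}(M^1,M^2,x^2)$ returns, in time $O(s)$, a solution of $(M^1,c^1,\epsilon_1)$. **Lemma.** There is a function $f$ as above with $$f(s,U,K,\epsilon^{-1})=\Bigl(O(s\log(sU)),\ O\bigl(s^{3/2}U\log^{1/2}(sU)\bigr),\ O\bigl(Ks^4U^2\log^2(sU)\bigr),\ O\bigl(sU^2\epsilon^{-1}\bigr)\Bigr)$$ uniformly for $s\ge2$ and $U,K,\epsilon^{-1}\ge1$, such that $\mathcal G_{z,2}\le_f\mathcal{MC}_2$. All implied constants are absolute. -/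

import Mathlib

/-! ### A real RAM

The machine has finitely many (per program) integer arrays and real arrays, all with random
access.  It performs exact arithmetic on reals at unit cost, but it has no rounding operation:
no information flows from reals to integers except through comparisons.  Programs are given in
structured form; a program is a fixed finite object whose constants are rational. -/

namespace RealRAM

/-- Memory: `int a i` and `real a i` are the `i`-th cells of the `a`-th integer and real array. -/
structure State where
  int : ℕ → ℤ → ℤ
  real : ℕ → ℤ → ℝ

/-- Integer expressions. -/
inductive IExpr where
  | const (z : ℤ)
  | get (a : ℕ) (i : IExpr)
  | add (e₁ e₂ : IExpr)
  | sub (e₁ e₂ : IExpr)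
  | mul (e₁ e₂ : IExpr)

/-- Real expressions. -/
inductive RExpr where
  | const (q : ℚ)
  | ofInt (e : IExpr)
  | get (a : ℕ) (i : IExpr)
  | add (e₁ e₂ : RExpr)
  | sub (e₁ e₂ : RExpr)
  | mul (e₁ e₂ : RExpr)
  | div (e₁ e₂ : RExpr)
  | sqrt (e : RExpr)

/-- Tests. -/
inductive BExpr where
  | ilt (e₁ e₂ : IExpr)
  | ieq (e₁ e₂ : IExpr)
  | rlt (e₁ e₂ : RExpr)
  | req (e₁ e₂ : RExpr)
  | not (b : BExpr)
  | and (b₁ b₂ : BExpr)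

/-- Programs. -/
inductive Stmt where
  | skip
  | setInt (a : ℕ) (i : IExpr) (e : IExpr)
  | setReal (a : ℕ) (i : IExpr) (e : RExpr)
  | seq (p q : Stmt)
  | cond (b : BExpr) (p q : Stmt)
  | loop (b : BExpr) (p : Stmt)

def IExpr.eval (σ : State) : IExpr → ℤ
  | .const z => z
  | .get a i => σ.int a (i.eval σ)
  | .add e₁ e₂ => e₁.eval σ + e₂.eval σ
  | .sub e₁ e₂ => e₁.eval σ - e₂.eval σ
  | .mul e₁ e₂ => e₁.eval σ * e₂.eval σ

noncomputable def RExpr.eval (σ : State) : RExpr → ℝ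
  | .const q => (q : ℝ)
  | .ofInt e => (e.eval σ : ℝ)
  | .get a i => σ.real a (i.eval σ)
  | .add e₁ e₂ => e₁.eval σ + e₂.eval σ
  | .sub e₁ e₂ => e₁.eval σ - e₂.eval σ
  | .mul e₁ e₂ => e₁.eval σ * e₂.eval σ
  | .div e₁ e₂ => e₁.eval σ / e₂.eval σ
  | .sqrt e => Real.sqrt (e.eval σ)

def BExpr.eval (σ : State) : BExpr → Prop
  | .ilt e₁ e₂ => e₁.eval σ < e₂.eval σ
  | .ieq e₁ e₂ => e₁.eval σ = e₂.eval σ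
  | .rlt e₁ e₂ => e₁.eval σ < e₂.eval σ
  | .req e₁ e₂ => e₁.eval σ = e₂.eval σ
  | .not b => ¬ b.eval σ
  | .and b₁ b₂ => b₁.eval σ ∧ b₂.eval σ

/-- Number of elementary operations in the evaluation of an integer expression. -/
def IExpr.cost : IExpr → ℕ
  | .const _ => 1
  | .get _ i => i.cost + 1
  | .add e₁ e₂ => e₁.cost + e₂.cost + 1
  | .sub e₁ e₂ => e₁.cost + e₂.cost + 1
  | .mul e₁ e₂ => e₁.cost + e₂.cost + 1

/-- Number of elementary operations in the evaluation of a real expression. -/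
def RExpr.cost : RExpr → ℕ
  | .const _ => 1
  | .ofInt e => e.cost + 1
  | .get _ i => i.cost + 1
  | .add e₁ e₂ => e₁.cost + e₂.cost + 1
  | .sub e₁ e₂ => e₁.cost + e₂.cost + 1
  | .mul e₁ e₂ => e₁.cost + e₂.cost + 1
  | .div e₁ e₂ => e₁.cost + e₂.cost + 1
  | .sqrt e => e.cost + 1

/-- Number of elementary operations in the evaluation of a test. -/
def BExpr.cost : BExpr → ℕ
  | .ilt e₁ e₂ => e₁.cost + e₂.cost + 1
  | .ieq e₁ e₂ => e₁.cost + e₂.cost + 1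
  | .rlt e₁ e₂ => e₁.cost + e₂.cost + 1
  | .req e₁ e₂ => e₁.cost + e₂.cost + 1
  | .not b => b.cost + 1
  | .and b₁ b₂ => b₁.cost + b₂.cost + 1

def State.setInt (σ : State) (a : ℕ) (i : ℤ) (z : ℤ) : State :=
  { σ with int := Function.update σ.int a (Function.update (σ.int a) i z) }

def State.setReal (σ : State) (a : ℕ) (i : ℤ) (r : ℝ) : State :=
  { σ with real := Function.update σ.real a (Function.update (σ.real a) i r) }

/-- `Exec p σ t σ'`: started in memory `σ`, the program `p` halts after `t` steps in
memory `σ'`. -/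
inductive Exec : Stmt → State → ℕ → State → Prop
  | skip (σ : State) : Exec .skip σ 1 σ
  | setInt (σ : State) (a : ℕ) (i e : IExpr) :
      Exec (.setInt a i e) σ (i.cost + e.cost + 1) (σ.setInt a (i.eval σ) (e.eval σ))
  | setReal (σ : State) (a : ℕ) (i : IExpr) (e : RExpr) :
      Exec (.setReal a i e) σ (i.cost + e.cost + 1) (σ.setReal a (i.eval σ) (e.eval σ))
  | seq {p q : Stmt} {σ σ' σ'' : State} {t t' : ℕ} :
      Exec p σ t σ' → Exec q σ' t' σ'' → Exec (.seq p q) σ (t + t') σ''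
  | cond_true {b : BExpr} {p q : Stmt} {σ σ' : State} {t : ℕ} :
      b.eval σ → Exec p σ t σ' → Exec (.cond b p q) σ (b.cost + t) σ'
  | cond_false {b : BExpr} {p q : Stmt} {σ σ' : State} {t : ℕ} :
      ¬ b.eval σ → Exec q σ t σ' → Exec (.cond b p q) σ (b.cost + t) σ'
  | loop_true {b : BExpr} {p : Stmt} {σ σ' σ'' : State} {t t' : ℕ} :
      b.eval σ → Exec p σ t σ' → Exec (.loop b p) σ' t' σ'' →
        Exec (.loop b p) σ (b.cost + t + t') σ''
  | loop_false {b : BExpr} {p : Stmt} {σ : State} :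
      ¬ b.eval σ → Exec (.loop b p) σ b.cost σ

end RealRAM

namespace LinSys

open RealRAM

/-! ### Linear systems, approximate solutions, complexity parameters -/

/-- A class of real matrices (of all sizes). -/
abbrev MatrixClass : Type := ∀ m n : ℕ, Set (Matrix (Fin m) (Fin n) ℝ)

/-- The orthogonal projection of `c` onto the image of `A`. -/
noncomputable def imProj {m n : ℕ} (A : Matrix (Fin m) (Fin n) ℝ)
    (c : EuclideanSpace ℝ (Fin m)) : EuclideanSpace ℝ (Fin m) :=
  (LinearMap.range (Matrix.toEuclideanLin A)).starProjection c

/-- `x` is a solution of the linear system approximation instance `(A, c, ε)`. -/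
def IsLSASolution {m n : ℕ} (A : Matrix (Fin m) (Fin n) ℝ) (c : EuclideanSpace ℝ (Fin m))
    (ε : ℝ) (x : EuclideanSpace ℝ (Fin n)) : Prop :=
  ‖Matrix.toEuclideanLin A x - imProj A c‖ ≤ ε * ‖imProj A c‖

/-- Number of non-zero entries. -/
noncomputable def nnz {m n : ℕ} (A : Matrix (Fin m) (Fin n) ℝ) : ℕ :=
  Nat.card {p : Fin m × Fin n // A p.1 p.2 ≠ 0}

/-- Largest absolute value of a family of reals (`0` if the family is empty). -/
noncomputable def maxAbs {ι : Type} (a : ι → ℝ) : ℝ := ⨆ i, |a i|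

/-- Smallest absolute value of a non-zero member of a family of reals.  If there is no non-zero
member the value is `0`, so that `1 / minNonzero a = 0` does not contribute to a maximum. -/
noncomputable def minNonzero {ι : Type} (a : ι → ℝ) : ℝ := sInf {r | ∃ i, a i ≠ 0 ∧ r = |a i|}

/-- Largest singular value. -/
noncomputable def sigmaMax {m n : ℕ} (A : Matrix (Fin m) (Fin n) ℝ) : ℝ :=
  sSup {r | ∃ x : EuclideanSpace ℝ (Fin n), x ≠ 0 ∧ r = ‖Matrix.toEuclideanLin A x‖ / ‖x‖}

/-- Smallest non-zero singular value of a non-zero matrix. -/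
noncomputable def sigmaMin {m n : ℕ} (A : Matrix (Fin m) (Fin n) ℝ) : ℝ :=
  sInf {r | ∃ x : EuclideanSpace ℝ (Fin n), x ≠ 0 ∧
    x ∈ (LinearMap.ker (Matrix.toEuclideanLin A))ᗮ ∧ r = ‖Matrix.toEuclideanLin A x‖ / ‖x‖}

/-- The non-zero condition number of a non-zero matrix. -/
noncomputable def condNumber {m n : ℕ} (A : Matrix (Fin m) (Fin n) ℝ) : ℝ :=
  sigmaMax A / sigmaMin A

/-- Quadruples of parameters, ordered coordinatewise. -/
abbrev Params : Type := ℝ × ℝ × ℝ × ℝ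

/-- The sparse parameter complexity of an instance. -/
noncomputable def sparseComplexity {m n : ℕ} (A : Matrix (Fin m) (Fin n) ℝ)
    (c : EuclideanSpace ℝ (Fin m)) (ε : ℝ) : Params :=
  ((nnz A : ℝ),
    max (max (maxAbs fun p : Fin m × Fin n => A p.1 p.2) (maxAbs fun i => c i))
      (max (1 / minNonzero fun p : Fin m × Fin n => A p.1 p.2) (1 / minNonzero fun i => c i)),
    condNumber A,
    ε⁻¹)

/-- The conditions under which the sparse parameter complexity of `(A, c, ε)` is defined. -/
def Admissible {m n : ℕ} (A : Matrix (Fin m) (Fin n) ℝ) (ε : ℝ) : Prop :=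
  A ≠ 0 ∧ max m n ≤ nnz A ∧ 0 < ε ∧ ε ≤ 1

/-! ### Instances in the memory of the machine -/

/-- The memory holds `A` in sparse form in integer arrays `b`, `b + 1`, `b + 2` and real
array `b`: both dimensions, the number of non-zero entries, and a list of all non-zero entries
(row, column, value), without repetition, sorted by rows. -/
def EncodesMatrix {m n : ℕ} (σ : State) (b : ℕ) (A : Matrix (Fin m) (Fin n) ℝ) : Prop :=
  σ.int b 0 = m ∧ σ.int b 1 = n ∧ σ.int b 2 = nnz A ∧
    ∃ e : Fin (nnz A) ≃ {p : Fin m × Fin n // A p.1 p.2 ≠ 0},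
      (Monotone fun k => (e k).1.1) ∧
      ∀ k : Fin (nnz A),
        σ.int (b + 1) ((k : ℕ) : ℤ) = (((e k).1.1 : ℕ) : ℤ) ∧
        σ.int (b + 2) ((k : ℕ) : ℤ) = (((e k).1.2 : ℕ) : ℤ) ∧
        σ.real b ((k : ℕ) : ℤ) = A (e k).1.1 (e k).1.2

/-- The real array `b` starts with the entries of `x`. -/
def EncodesVector {n : ℕ} (σ : State) (b : ℕ) (x : EuclideanSpace ℝ (Fin n)) : Prop :=
  ∀ i : Fin n, σ.real b ((i : ℕ) : ℤ) = x i

/-- The memory holds the instance `(A, c, ε)`. -/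
def EncodesInstance {m n : ℕ} (σ : State) (b : ℕ) (A : Matrix (Fin m) (Fin n) ℝ)
    (c : EuclideanSpace ℝ (Fin m)) (ε : ℝ) : Prop :=
  EncodesMatrix σ b A ∧ EncodesVector σ (b + 1) c ∧ σ.real (b + 2) 0 = ε

/-! ### Efficient reducibility -/

/-- Quadruples of positive reals. -/
def posParams : Set Params := {p | 0 < p.1 ∧ 0 < p.2.1 ∧ 0 < p.2.2.1 ∧ 0 < p.2.2.2}

/-- `M₁` is efficiently `f`-reducible to `M₂`: there are two programs, `P` mapping an instance
`(A₁, c₁, ε₁)` with `A₁ ∈ M₁` to an instance `(A₂, c₂, ε₂)` with `A₂ ∈ M₂`, and `Q` mapping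
`(A₁, A₂, x₂)`, where `x₂` is any solution of `(A₂, c₂, ε₂)`, to a solution of `(A₁, c₁, ε₁)`.
The complexity parameters grow at most by `f`, which is positive and increasing in every
coordinate.  `P` takes at most `O(T)` steps, `T` a function of the parameters of the given
instance, and `Q` takes `O(nnz A₁)` steps.  Memory cells that do not hold the input are
arbitrary at the start. -/
def EfficientlyReducible (M₁ M₂ : MatrixClass) (f : Params → Params) (T : Params → ℝ) : Prop :=
  Set.MapsTo f posParams posParams ∧ MonotoneOn f posParams ∧
  ∃ (P Q : Stmt) (C : ℝ),
    ∀ (m₁ n₁ : ℕ) (A₁ : Matrix (Fin m₁) (Fin n₁) ℝ) (c₁ : EuclideanSpace ℝ (Fin m₁)) (ε₁ : ℝ),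
      A₁ ∈ M₁ m₁ n₁ → Admissible A₁ ε₁ →
      ∀ σ : State, EncodesInstance σ 0 A₁ c₁ ε₁ →
        ∃ (σ' : State) (t : ℕ), Exec P σ t σ' ∧
          (t : ℝ) ≤ C * T (sparseComplexity A₁ c₁ ε₁) ∧
          ∃ (m₂ n₂ : ℕ) (A₂ : Matrix (Fin m₂) (Fin n₂) ℝ) (c₂ : EuclideanSpace ℝ (Fin m₂))
            (ε₂ : ℝ),
            EncodesInstance σ' 3 A₂ c₂ ε₂ ∧ A₂ ∈ M₂ m₂ n₂ ∧ Admissible A₂ ε₂ ∧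
            sparseComplexity A₂ c₂ ε₂ ≤ f (sparseComplexity A₁ c₁ ε₁) ∧
            ∀ x₂ : EuclideanSpace ℝ (Fin n₂), IsLSASolution A₂ c₂ ε₂ x₂ →
              ∀ τ : State, EncodesMatrix τ 0 A₁ → EncodesMatrix τ 3 A₂ → EncodesVector τ 6 x₂ →
                ∃ (τ' : State) (u : ℕ) (x₁ : EuclideanSpace ℝ (Fin n₁)), Exec Q τ u τ' ∧
                  (u : ℝ) ≤ C * nnz A₁ ∧ EncodesVector τ' 7 x₁ ∧ IsLSASolution A₁ c₁ ε₁ x₁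

/-! ### The two matrix classes -/

/-- Integer matrices with a non-zero entry in every row and every column, in which every row
sums to zero and the positive entries of every row sum to a power of two. -/
def zeroSumPowerTwo : MatrixClass := fun m n =>
  {A | ∃ Z : Matrix (Fin m) (Fin n) ℤ, A = Z.map (fun z : ℤ => (z : ℝ)) ∧
    (∀ i, ∃ j, Z i j ≠ 0) ∧ (∀ j, ∃ i, Z i j ≠ 0) ∧
    (∀ i, ∑ j, Z i j = 0) ∧
    ∀ i, ∃ k : ℕ, ∑ j with 0 < Z i j, Z i j = 2 ^ k}

/-- 2-commodity incidence matrices.  There are `N` blocks of two variables each; block `i`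
consists of the columns `2 * i` and `2 * i + 1`.  Every row is `S` on block `i` and `-S` on
block `j`, for some `i ≠ j`, where `S` is `w` times `(1, 0)`, `(0, 1)` or `(1, -1)`. -/
def twoCommodity : MatrixClass := fun m n =>
  {B | ∃ N : ℕ, n = 2 * N ∧
    ∀ r : Fin m, ∃ (i j : ℕ) (w : ℝ) (S : Fin 2 → ℝ), i < N ∧ j < N ∧ i ≠ j ∧
      (S = w • ![1, 0] ∨ S = w • ![0, 1] ∨ S = w • ![1, -1]) ∧
      ∀ q : Fin n, B r q =
        (if (q : ℕ) / 2 = i then S (Fin.ofNat 2 q) else 0) -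
          (if (q : ℕ) / 2 = j then S (Fin.ofNat 2 q) else 0)}

end LinSys

namespace LinSys

open RealRAM

/-! ### Singular values and transfer of approximate solutions -/

/-! Rows of `A` sum to zero, so row `i` is the form `∑ a_ij (x_j - x_0)`, and Horner's rule
evaluates it from the signed binary digits of the entries: from the most significant digit down,
double the accumulated value, then add `±(x_j - x_0)` for every entry whose current digit is
non-zero. The accumulated value is always a difference `u_0 - u_acc` of first variables of two
blocks, and both operations ask for a new block `T'` with `u_T - u_{T'} = u_a - u_b`, where `T` is
the old accumulator; `(a, b) = (0, T)` doubles. Seven 2-commodity equations on four fresh blocks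
(`gadget`) force this, the second variables carrying the difference `u_a - u_b` over to another pair
of blocks. Their left-hand sides add up identically to `u_a - u_b - u_T + u_{T'}`
(`tagSum_gadget_self`). With the current power of two as multiplier `mu`, and one last equation `u_0
- u_acc` per row, the `mu`-multiples of all equations with tag `i` add up exactly to row `i` of `A`,
whatever the auxiliary variables are (`Data.Complete.ident`).

If `N` equations carry tag `i`, each is weighted by `√N * mu` and gets the right-hand side `c_i /
√N`. Then `Λ : c ↦ (c_tag / √N)` is an isometry whose adjoint `Λt` satisfies `Λt B = A π`, with `π`
the restriction to the old variables. Moreover `b` lies in the image of `B` as soon as `Λt b` lies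
in that of `A`. Hence the projection of `Λ c` is `Λ` of the projection of `c` (`Lift.imProj_lift`),
and `π` maps solutions to solutions with the same `ε` (`Lift.isLSASolution`).

The smallest singular value of `B` is controlled by solving `B z = b` with small `z`
(`Lift.inv_sigmaMin_le`). Residuals do not pile up along the chain of gadgets: by the summed
identity, each accumulator is determined by the old variables and by one weighted sum of residuals
(`Data.Inv.abs_acc_le`), and inside a gadget sizes grow at most tenfold. The largest singular value
is bounded by the Frobenius norm.

On the machine a digit is found by comparing the unprocessed part of an entry with the current power
of two, so no rounding is needed. About `log U` levels with one gadget per row and per entry give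
the size and the running time (`runs_forward`); the way back only copies variables. -/

theorem bddAbove_sigmaMax {m n : ℕ} (A : Matrix (Fin m) (Fin n) ℝ) :
    BddAbove {r | ∃ x : EuclideanSpace ℝ (Fin n), x ≠ 0 ∧
      r = ‖Matrix.toEuclideanLin A x‖ / ‖x‖} := by
  refine ⟨‖(Matrix.toEuclideanLin A).toContinuousLinearMap‖, ?_⟩
  rintro r ⟨x, hx, rfl⟩
  exact (Matrix.toEuclideanLin A).toContinuousLinearMap.ratio_le_opNorm x

theorem norm_le_sigmaMax_mul {m n : ℕ} (A : Matrix (Fin m) (Fin n) ℝ)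
    (x : EuclideanSpace ℝ (Fin n)) : ‖Matrix.toEuclideanLin A x‖ ≤ sigmaMax A * ‖x‖ := by
  by_cases hx : x = 0
  · simp [hx]
  · rw [← div_le_iff₀ (norm_pos_iff.2 hx)]
    exact le_csSup (bddAbove_sigmaMax A) ⟨x, hx, rfl⟩

theorem sigmaMax_le {m n : ℕ} (A : Matrix (Fin m) (Fin n) ℝ) {M : ℝ} (hM : 0 ≤ M)
    (h : ∀ x, ‖Matrix.toEuclideanLin A x‖ ≤ M * ‖x‖) : sigmaMax A ≤ M := by
  refine Real.sSup_le ?_ hM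
  rintro r ⟨x, hx, rfl⟩
  rw [div_le_iff₀ (norm_pos_iff.2 hx)]
  exact h x

theorem sigmaMin_mul_norm_le {m n : ℕ} (A : Matrix (Fin m) (Fin n) ℝ)
    {x : EuclideanSpace ℝ (Fin n)} (hx : x ∈ (LinearMap.ker (Matrix.toEuclideanLin A))ᗮ) :
    sigmaMin A * ‖x‖ ≤ ‖Matrix.toEuclideanLin A x‖ := by
  by_cases h0 : x = 0
  · simp [h0]
  · rw [← le_div_iff₀ (norm_pos_iff.2 h0)]
    refine csInf_le ⟨0, ?_⟩ ⟨x, h0, hx, rfl⟩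
    rintro r ⟨y, -, -, rfl⟩
    positivity

/-- The component of a vector orthogonal to the kernel has the same image. -/
theorem exists_mem_ker_orthogonal {m n : ℕ} (A : Matrix (Fin m) (Fin n) ℝ)
    (x : EuclideanSpace ℝ (Fin n)) :
    ∃ y ∈ (LinearMap.ker (Matrix.toEuclideanLin A))ᗮ,
      Matrix.toEuclideanLin A y = Matrix.toEuclideanLin A x ∧ ‖y‖ ≤ ‖x‖ := by
  set V := LinearMap.ker (Matrix.toEuclideanLin A) with hV
  refine ⟨Vᗮ.starProjection x, Submodule.starProjection_apply_mem _ _, ?_,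
    Submodule.norm_starProjection_apply_le _ _⟩
  have h : x - Vᗮ.starProjection x ∈ V := by
    have := Submodule.sub_starProjection_mem_orthogonal (K := Vᗮ) x
    rwa [Submodule.orthogonal_orthogonal] at this
  rw [hV, LinearMap.mem_ker, map_sub, sub_eq_zero] at h
  exact h.symm

/-- Nonemptiness of the set whose infimum is `sigmaMin`. An empty real infimum is `0` by default, so
lower bounds for `sigmaMin` depend on this. -/
theorem exists_apply_ne_zero {m n : ℕ} {A : Matrix (Fin m) (Fin n) ℝ} (hA : A ≠ 0) :
    ∃ x ∈ (LinearMap.ker (Matrix.toEuclideanLin A))ᗮ, x ≠ 0 := by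
  have h : Matrix.toEuclideanLin A ≠ 0 := by
    simpa using hA
  obtain ⟨x, hx⟩ : ∃ x, Matrix.toEuclideanLin A x ≠ 0 := by
    by_contra! hc
    exact h (LinearMap.ext hc)
  obtain ⟨y, hy, hyx, -⟩ := exists_mem_ker_orthogonal A x
  refine ⟨y, hy, ?_⟩
  rintro rfl
  exact hx (by rw [← hyx, map_zero])

theorem le_sigmaMin {m n : ℕ} {A : Matrix (Fin m) (Fin n) ℝ} (hA : A ≠ 0) {δ : ℝ}
    (h : ∀ x ∈ (LinearMap.ker (Matrix.toEuclideanLin A))ᗮ,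
      δ * ‖x‖ ≤ ‖Matrix.toEuclideanLin A x‖) : δ ≤ sigmaMin A := by
  obtain ⟨x, hx, hx0⟩ := exists_apply_ne_zero hA
  refine le_csInf ⟨_, x, hx0, hx, rfl⟩ ?_
  rintro r ⟨y, hy0, hy, rfl⟩
  rw [le_div_iff₀ (norm_pos_iff.2 hy0)]
  exact h y hy

/-- The map is injective on the orthogonal complement of its kernel, and an injective linear map on
a finite-dimensional space is antilipschitz; the inverse of that constant is the lower bound. -/
theorem sigmaMin_pos {m n : ℕ} {A : Matrix (Fin m) (Fin n) ℝ} (hA : A ≠ 0) :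
    0 < sigmaMin A := by
  set V := LinearMap.ker (Matrix.toEuclideanLin A) with hV
  have hker : LinearMap.ker ((Matrix.toEuclideanLin A).domRestrict Vᗮ) = ⊥ := by
    rw [LinearMap.ker_eq_bot']
    intro x hx
    have h1 : (x : EuclideanSpace ℝ (Fin n)) ∈ V := by
      exact LinearMap.mem_ker.2 hx
    have h2 := Submodule.inner_right_of_mem_orthogonal h1 x.2
    exact Subtype.ext (inner_self_eq_zero.1 h2)
  obtain ⟨K, hK, hL⟩ := LinearMap.exists_antilipschitzWith _ hker
  have hK' : (0 : ℝ) < K := hK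
  refine lt_of_lt_of_le (inv_pos.2 hK') (le_sigmaMin hA fun x hx => ?_)
  have := hL.le_mul_dist ⟨x, hx⟩ 0
  simp only [dist_eq_norm, map_zero, sub_zero] at this
  rw [inv_mul_le_iff₀ hK']
  simpa using this

theorem sigmaMin_le_sigmaMax {m n : ℕ} {A : Matrix (Fin m) (Fin n) ℝ} (hA : A ≠ 0) :
    sigmaMin A ≤ sigmaMax A := by
  obtain ⟨x, hx, hx0⟩ := exists_apply_ne_zero hA
  have := (sigmaMin_mul_norm_le A hx).trans (norm_le_sigmaMax_mul A x)
  exact le_of_mul_le_mul_right this (norm_pos_iff.2 hx0)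

/-- An entry is a coordinate of the image of a unit vector. For an integer matrix this gives `1 ≤
sigmaMax A`, hence `(sigmaMin A)⁻¹ ≤ condNumber A`. -/
theorem abs_apply_le_sigmaMax {m n : ℕ} (A : Matrix (Fin m) (Fin n) ℝ) (i : Fin m) (j : Fin n) :
    |A i j| ≤ sigmaMax A := by
  have h := norm_le_sigmaMax_mul A (EuclideanSpace.single j 1)
  have h2 := PiLp.norm_apply_le (Matrix.toEuclideanLin A (EuclideanSpace.single j 1)) i
  simp only [PiLp.norm_single, norm_one, mul_one] at h
  have h3 : (Matrix.toEuclideanLin A (EuclideanSpace.single j 1)) i = A i j := by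
    simp [Matrix.toLpLin_apply]
  rw [h3, Real.norm_eq_abs] at h2
  exact h2.trans h

theorem toEuclideanLin_coord {m n : ℕ} (A : Matrix (Fin m) (Fin n) ℝ)
    (x : EuclideanSpace ℝ (Fin n)) (i : Fin m) :
    Matrix.toEuclideanLin A x i = ∑ j, A i j * x j := by
  simp [Matrix.toLpLin_apply, Matrix.mulVec, dotProduct]

/-- The operator norm is at most the Frobenius norm. -/
theorem sigmaMax_le_of_sum_sq_le {m n : ℕ} (A : Matrix (Fin m) (Fin n) ℝ) {M : ℝ} (hM : 0 ≤ M)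
    (h : ∑ i, ∑ j, A i j ^ 2 ≤ M ^ 2) : sigmaMax A ≤ M := by
  refine sigmaMax_le A hM fun x => ?_
  refine abs_le_of_sq_le_sq' ?_ (by positivity) |>.2
  rw [mul_pow, EuclideanSpace.real_norm_sq_eq, EuclideanSpace.real_norm_sq_eq]
  calc ∑ i, (Matrix.toEuclideanLin A x i) ^ 2
      ≤ ∑ i, (∑ j, A i j ^ 2) * ∑ j, x j ^ 2 := by
        refine Finset.sum_le_sum fun i _ => ?_
        rw [toEuclideanLin_coord]
        exact Finset.sum_mul_sq_le_sq_mul_sq _ _ _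
    _ = (∑ i, ∑ j, A i j ^ 2) * ∑ j, x j ^ 2 := by rw [Finset.sum_mul]
    _ ≤ M ^ 2 * ∑ j, x j ^ 2 := by gcongr

/-- `Λ` embeds the equations of `A` isometrically into those of `B`, and `Λt` is its adjoint;
`π` extracts the variables of `A` from those of `B`. -/
structure Lift {m n m' n' : ℕ} (A : Matrix (Fin m) (Fin n) ℝ) (B : Matrix (Fin m') (Fin n') ℝ)
    (Λ : EuclideanSpace ℝ (Fin m) → EuclideanSpace ℝ (Fin m'))
    (Λt : EuclideanSpace ℝ (Fin m') → EuclideanSpace ℝ (Fin m))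
    (π : EuclideanSpace ℝ (Fin n') → EuclideanSpace ℝ (Fin n)) (g₁ g₂ : ℝ) : Prop where
  map_sub : ∀ b c, Λt (b - c) = Λt b - Λt c
  lift_sub : ∀ b c, Λ (b - c) = Λ b - Λ c
  adjoint : ∀ c b, inner ℝ (Λ c) b = inner ℝ c (Λt b)
  left_inv : ∀ c, Λt (Λ c) = c
  apply : ∀ z, Λt (Matrix.toEuclideanLin B z) = Matrix.toEuclideanLin A (π z)
  exists_preimage : ∀ x b, Λt b = Matrix.toEuclideanLin A x →
    ∃ z, Matrix.toEuclideanLin B z = b ∧ ‖z‖ ≤ g₁ * ‖x‖ + g₂ * ‖b‖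

/-! ### Projections, approximate solutions and singular values under a lift -/

namespace Lift

variable {m n m' n' : ℕ} {A : Matrix (Fin m) (Fin n) ℝ} {B : Matrix (Fin m') (Fin n') ℝ}
  {Λ : EuclideanSpace ℝ (Fin m) → EuclideanSpace ℝ (Fin m')}
  {Λt : EuclideanSpace ℝ (Fin m') → EuclideanSpace ℝ (Fin m)}
  {π : EuclideanSpace ℝ (Fin n') → EuclideanSpace ℝ (Fin n)} {g₁ g₂ : ℝ}

theorem norm_lift (h : Lift A B Λ Λt π g₁ g₂) (c : EuclideanSpace ℝ (Fin m)) : ‖Λ c‖ = ‖c‖ := by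
  have : ‖Λ c‖ ^ 2 = ‖c‖ ^ 2 := by
    rw [← real_inner_self_eq_norm_sq, h.adjoint, h.left_inv, real_inner_self_eq_norm_sq]
  exact (sq_eq_sq₀ (norm_nonneg _) (norm_nonneg _)).1 this

/-- `‖Λt b‖² = ⟨Λ (Λt b), b⟩`, and `Λ` is isometric, so Cauchy–Schwarz gives the bound. -/
theorem norm_adjoint_le (h : Lift A B Λ Λt π g₁ g₂) (b : EuclideanSpace ℝ (Fin m')) :
    ‖Λt b‖ ≤ ‖b‖ := by
  have h1 : ‖Λt b‖ * ‖Λt b‖ ≤ ‖Λt b‖ * ‖b‖ := by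
    rw [← sq, ← real_inner_self_eq_norm_sq, ← h.adjoint, ← h.norm_lift (Λt b)]
    exact real_inner_le_norm _ _
  rcases (norm_nonneg (Λt b)).eq_or_lt with h0 | h0
  · rw [← h0]; positivity
  · exact le_of_mul_le_mul_left h1 h0

/-- Two properties characterise the projection. `Λ (imProj A c)` lies in the image of `B` because
`Λt` maps it into the image of `A`; and `Λ c - Λ (imProj A c)` is orthogonal to every `B z` because
its inner product with `B z` is that of `c - imProj A c` with `A (π z)`. -/
theorem imProj_lift (h : Lift A B Λ Λt π g₁ g₂) (c : EuclideanSpace ℝ (Fin m)) :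
    imProj B (Λ c) = Λ (imProj A c) := by
  have hmem : imProj A c ∈ LinearMap.range (Matrix.toEuclideanLin A) :=
    Submodule.starProjection_apply_mem _ _
  refine Submodule.eq_starProjection_of_mem_of_inner_eq_zero
    (K := LinearMap.range (Matrix.toEuclideanLin B)) ?_ ?_
  · obtain ⟨x, hx⟩ := hmem
    obtain ⟨z, hz, -⟩ := h.exists_preimage x (Λ (imProj A c)) (by rw [h.left_inv, hx])
    exact ⟨z, hz⟩
  · rintro _ ⟨z, rfl⟩
    rw [← h.lift_sub, h.adjoint, h.apply]
    exact Submodule.starProjection_inner_eq_zero _ _ ⟨_, rfl⟩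

/-- `Λt` maps the error `B z - Λ (imProj A c)` to `A (π z) - imProj A c` without increasing norms,
and the norms of the two projections agree. No loss in `ε` occurs. -/
theorem isLSASolution (h : Lift A B Λ Λt π g₁ g₂) {c : EuclideanSpace ℝ (Fin m)} {ε : ℝ}
    {z : EuclideanSpace ℝ (Fin n')} (hz : IsLSASolution B (Λ c) ε z) :
    IsLSASolution A c ε (π z) := by
  unfold IsLSASolution at *
  rw [h.imProj_lift, h.norm_lift] at hz
  refine le_trans ?_ hz
  have := h.norm_adjoint_le (Matrix.toEuclideanLin B z - Λ (imProj A c))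
  rwa [h.map_sub, h.left_inv, h.apply] at this

/-- A vector `z` orthogonal to the kernel is the shortest preimage of `b = B z`, so it is no longer
than the preimage provided by `exists_preimage`. The latter is built from the shortest `x` with `A x
= Λt b`, whose norm is at most `‖b‖ / sigmaMin A`. -/
theorem inv_sigmaMin_le (h : Lift A B Λ Λt π g₁ g₂) (hA : A ≠ 0) (hB : B ≠ 0) (h₁ : 0 ≤ g₁) :
    (sigmaMin B)⁻¹ ≤ g₁ * (sigmaMin A)⁻¹ + g₂ := by
  have hApos := sigmaMin_pos hA
  have hBpos := sigmaMin_pos hB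
  have key : ∀ z ∈ (LinearMap.ker (Matrix.toEuclideanLin B))ᗮ,
      ‖z‖ ≤ (g₁ * (sigmaMin A)⁻¹ + g₂) * ‖Matrix.toEuclideanLin B z‖ := by
    intro z hz
    set b := Matrix.toEuclideanLin B z with hb
    obtain ⟨x, hx, hxz, -⟩ := exists_mem_ker_orthogonal A (π z)
    have hx2 := sigmaMin_mul_norm_le A hx
    rw [hxz, ← h.apply z, ← hb] at hx2
    obtain ⟨y, hy, hyn⟩ := h.exists_preimage x b (by rw [hxz, ← h.apply z])
    -- `y - z` lies in the kernel and is therefore orthogonal to `z`, so `⟨y, z⟩ = ‖z‖²`.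
    have hzy : ‖z‖ ≤ ‖y‖ := by
      have hin : inner ℝ (y - z) z = 0 := by
        refine Submodule.inner_right_of_mem_orthogonal ?_ hz
        rw [LinearMap.mem_ker, _root_.map_sub, hy, sub_self]
      have h3 : inner ℝ y z = ‖z‖ * ‖z‖ := by
        rw [inner_sub_left, sub_eq_zero] at hin
        rw [hin, real_inner_self_eq_norm_mul_norm]
      rcases (norm_nonneg z).eq_or_lt with h0 | h0
      · rw [← h0]; positivity
      · exact le_of_mul_le_mul_right (h3 ▸ real_inner_le_norm y z) h0
    have hx3 : ‖x‖ ≤ (sigmaMin A)⁻¹ * ‖b‖ := by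
      rw [inv_mul_eq_div, le_div_iff₀ hApos, mul_comm]
      exact hx2.trans (h.norm_adjoint_le b)
    calc ‖z‖ ≤ g₁ * ‖x‖ + g₂ * ‖b‖ := hzy.trans hyn
      _ ≤ g₁ * ((sigmaMin A)⁻¹ * ‖b‖) + g₂ * ‖b‖ := by gcongr
      _ = _ := by ring
  -- The sign of `g₂` is not prescribed; were the bound nonpositive, `key` would annihilate a
  -- non-zero `z`.
  have hpos : 0 < g₁ * (sigmaMin A)⁻¹ + g₂ := by
    obtain ⟨z, hz, hz0⟩ := exists_apply_ne_zero hB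
    by_contra! hc
    have := key z hz
    have h4 : (g₁ * (sigmaMin A)⁻¹ + g₂) * ‖Matrix.toEuclideanLin B z‖ ≤ 0 :=
      mul_nonpos_of_nonpos_of_nonneg hc (norm_nonneg _)
    exact hz0 (norm_le_zero_iff.1 (this.trans h4))
  rw [inv_le_comm₀ hBpos hpos]
  refine le_sigmaMin hB fun z hz => ?_
  rw [inv_mul_le_iff₀ hpos]
  exact key z hz

end Lift

end LinSys

namespace LinSys

open RealRAM

/-! ### Systems of 2-commodity equations -/

/-- The three kinds of 2-commodity equations. -/
inductive Kind where
  | fst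
  | snd
  | diff

/-- Coefficient of the first variable of a block. -/
def Kind.c₀ : Kind → ℝ
  | .fst => 1
  | .snd => 0
  | .diff => 1

/-- Coefficient of the second variable of a block. -/
def Kind.c₁ : Kind → ℝ
  | .fst => 0
  | .snd => 1
  | .diff => -1

/-- An equation between the blocks `i` and `j`.  It carries a multiplier `mu` and the index
`tag` of the equation of the given system that it helps to represent. -/
structure Eqn where
  kind : Kind
  i : ℕ
  j : ℕ
  mu : ℝ
  tag : ℕ

/-- The left-hand side of an equation (without the multiplier) at `z`; block `b` consists of the
variables `z (2 * b)` and `z (2 * b + 1)`. -/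
def Eqn.resid (z : ℕ → ℝ) (e : Eqn) : ℝ :=
  e.kind.c₀ * (z (2 * e.i) - z (2 * e.j)) + e.kind.c₁ * (z (2 * e.i + 1) - z (2 * e.j + 1))

/-- Sum of `mu * ρ` over the equations with a given tag, where `ρ` depends on the index. -/
noncomputable def tagSum (l : List (Eqn × ℕ)) (t : ℕ) (ρ : Eqn × ℕ → ℝ) : ℝ :=
  (l.map fun p => if p.1.tag = t then p.1.mu * ρ p else 0).sum

theorem tagSum_append (l l' : List (Eqn × ℕ)) (t : ℕ) (ρ : Eqn × ℕ → ℝ) :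
    tagSum (l ++ l') t ρ = tagSum l t ρ + tagSum l' t ρ := by
  simp [tagSum]

theorem tagSum_congr {l : List (Eqn × ℕ)} {t : ℕ} {ρ ρ' : Eqn × ℕ → ℝ}
    (h : ∀ p ∈ l, ρ p = ρ' p) : tagSum l t ρ = tagSum l t ρ' := by
  unfold tagSum
  congr 1
  exact List.map_congr_left fun p hp => by rw [h p hp]

theorem tagSum_nonneg {l : List (Eqn × ℕ)} {t : ℕ} {ρ : Eqn × ℕ → ℝ}
    (h : ∀ p ∈ l, 0 ≤ p.1.mu * ρ p) : 0 ≤ tagSum l t ρ := by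
  refine List.sum_nonneg ?_
  simp only [List.mem_map]
  rintro _ ⟨p, hp, rfl⟩
  split_ifs
  exacts [h p hp, le_rfl]

theorem le_tagSum {l : List (Eqn × ℕ)} {ρ : Eqn × ℕ → ℝ} {p : Eqn × ℕ} (hp : p ∈ l)
    (h : ∀ p ∈ l, 0 ≤ p.1.mu * ρ p) : p.1.mu * ρ p ≤ tagSum l p.1.tag ρ := by
  refine List.single_le_sum ?_ _ ?_
  · simp only [List.mem_map]
    rintro _ ⟨q, hq, rfl⟩
    split_ifs
    exacts [h q hq, le_rfl]
  · exact List.mem_map.2 ⟨p, hp, by simp⟩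

theorem abs_tagSum_le {l : List (Eqn × ℕ)} {t : ℕ} {ρ : Eqn × ℕ → ℝ}
    (h : ∀ p ∈ l, 0 ≤ p.1.mu) : |tagSum l t ρ| ≤ tagSum l t fun p => |ρ p| := by
  induction l with
  | nil => simp [tagSum]
  | cons p l ih =>
    have ih := ih fun q hq => h q (List.mem_cons_of_mem _ hq)
    have hp := h p List.mem_cons_self
    simp only [tagSum, List.map_cons, List.sum_cons] at ih ⊢
    refine (abs_add_le _ _).trans (add_le_add ?_ ih)
    split_ifs
    · rw [abs_mul, abs_of_nonneg hp]
    · simp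

/-- The equations that force `u_T - u_{T'} = u_a - u_b`, where `T'` is the last of the four
fresh blocks `nb, …, nb + 3`. -/
def gadget (T a b nb : ℕ) (mu : ℝ) (tag : ℕ) : List Eqn :=
  [⟨.fst, a, nb, mu, tag⟩, ⟨.fst, nb + 1, b, mu, tag⟩, ⟨.diff, nb, nb + 1, mu, tag⟩,
    ⟨.fst, nb + 2, T, mu, tag⟩, ⟨.snd, nb, nb + 2, mu, tag⟩, ⟨.snd, nb + 3, nb + 1, mu, tag⟩,
    ⟨.diff, nb + 3, nb + 2, mu, tag⟩]

/-- Every fresh variable except the first variable of the last block occurs with total coefficient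
zero. This is an identity in `z`, not a consequence of the equations, which is what makes `Λt B = A
π` hold exactly. -/
theorem tagSum_gadget_self (T a b nb : ℕ) (mu : ℝ) (tag k : ℕ) (z : ℕ → ℝ) :
    tagSum ((gadget T a b nb mu tag).zipIdx k) tag (fun p => p.1.resid z) =
      mu * (z (2 * a) - z (2 * b) - z (2 * T) + z (2 * (nb + 3))) := by
  simp [tagSum, gadget, Eqn.resid, Kind.c₀, Kind.c₁]
  ring

theorem tagSum_gadget_of_ne (T a b nb : ℕ) (mu : ℝ) {tag t : ℕ} (h : t ≠ tag) (k : ℕ)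
    (ρ : Eqn × ℕ → ℝ) : tagSum ((gadget T a b nb mu tag).zipIdx k) t ρ = 0 := by
  simp [tagSum, gadget, h.symm]

/-- A sparse integer matrix: the list of its non-zero entries. -/
structure Data where
  m : ℕ
  n : ℕ
  s : ℕ
  row : ℕ → ℕ
  col : ℕ → ℕ
  ent : ℕ → ℤ
  n_pos : 0 < n
  row_lt : ∀ k < s, row k < m
  col_lt : ∀ k < s, col k < n

/-! ### Horner accumulation of the rows of an integer matrix -/

namespace Data

variable (d : Data)

/-- `∑ w_k (x_{col k} - x_0)` over the entries of row `i`, where `x_j = z (2 * j)`. -/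
noncomputable def rowSum (w : ℕ → ℤ) (i : ℕ) (z : ℕ → ℝ) : ℝ :=
  ∑ k ∈ Finset.range d.s, if d.row k = i then (w k : ℝ) * (z (2 * d.col k) - z 0) else 0

/-- Sum of the absolute values of all entries. -/
noncomputable def total : ℝ := ∑ k ∈ Finset.range d.s, |(d.ent k : ℝ)|

theorem total_nonneg : 0 ≤ d.total := Finset.sum_nonneg fun _ _ => abs_nonneg _

/-- Stated for weights `w` dominated by the entries because it is applied to the processed part `ent
- rem`. -/
theorem abs_rowSum_le {w : ℕ → ℤ} {z : ℕ → ℝ} {ξ : ℝ} (hw : ∀ k < d.s, |w k| ≤ |d.ent k|)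
    (hz : ∀ j < d.n, |z (2 * j)| ≤ ξ) (i : ℕ) : |d.rowSum w i z| ≤ d.total * (2 * ξ) := by
  have h0 : 0 ≤ ξ := (abs_nonneg _).trans (hz 0 d.n_pos)
  unfold rowSum total
  rw [Finset.sum_mul]
  refine (Finset.abs_sum_le_sum_abs _ _).trans (Finset.sum_le_sum fun k hk => ?_)
  rw [Finset.mem_range] at hk
  split_ifs
  · rw [abs_mul]
    have h1 : |(w k : ℝ)| ≤ |(d.ent k : ℝ)| := by exact_mod_cast hw k hk
    have h2 : |z (2 * d.col k) - z 0| ≤ 2 * ξ := by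
      have h3 := hz _ (d.col_lt k hk)
      have h4 := hz 0 d.n_pos
      rw [abs_le] at *
      simp only [mul_zero] at h4
      constructor <;> linarith [h3.1, h3.2, h4.1, h4.2]
    gcongr
  · simp only [abs_zero]
    positivity

theorem rowSum_sub (w w' : ℕ → ℤ) (i : ℕ) (z : ℕ → ℝ) :
    d.rowSum (fun k => w k - w' k) i z = d.rowSum w i z - d.rowSum w' i z := by
  unfold rowSum
  rw [← Finset.sum_sub_distrib]
  refine Finset.sum_congr rfl fun k _ => ?_
  split_ifs
  · push_cast; ring
  · ring

theorem rowSum_update_of_ne (w : ℕ → ℤ) {i k : ℕ} (v : ℤ) (z : ℕ → ℝ) (h : d.row k ≠ i) :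
    d.rowSum (Function.update w k v) i z = d.rowSum w i z := by
  unfold rowSum
  refine Finset.sum_congr rfl fun k' _ => ?_
  by_cases hk : k' = k
  · subst hk; simp [h]
  · rw [Function.update_of_ne hk]

theorem rowSum_update_row (w : ℕ → ℤ) {k : ℕ} (v : ℤ) (z : ℕ → ℝ) (h : k < d.s) :
    d.rowSum (Function.update w k (w k + v)) (d.row k) z =
      d.rowSum w (d.row k) z + v * (z (2 * d.col k) - z 0) := by
  unfold rowSum
  rw [← Finset.add_sum_erase _ _ (Finset.mem_range.2 h),
    ← Finset.add_sum_erase (Finset.range d.s) (fun k' => if d.row k' = d.row k then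
      (w k' : ℝ) * (z (2 * d.col k') - z 0) else 0) (Finset.mem_range.2 h)]
  have : ∀ k' ∈ (Finset.range d.s).erase k, Function.update w k (w k + v) k' = w k' :=
    fun k' hk => Function.update_of_ne (Finset.ne_of_mem_erase hk) _ _
  rw [Finset.sum_congr rfl fun k' hk => by rw [this k' hk]]
  simp only [Function.update_self, if_true]
  push_cast
  ring

/-- Bound for the values of `x` and of the accumulators. -/
noncomputable def bd (ξ β : ℝ) : ℝ := ξ * (1 + 2 * d.total) + β

/-- The invariant of the construction: `l` is the list of equations produced so far, using `nb`
blocks; row `i` has accumulated `u_0 - u_{acc i}`, still to be multiplied by `P i`, and `rem k`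
is the part of the entry `k` that has not been processed. -/
structure Inv (M : ℝ) (l : List Eqn) (nb : ℕ) (acc : ℕ → ℕ) (P : ℕ → ℤ) (rem : ℕ → ℤ) :
    Prop where
  n_le : d.n ≤ nb
  acc_lt : ∀ i < d.m, acc i < nb
  one_le : ∀ i < d.m, 1 ≤ P i
  wf : ∀ e ∈ l, e.i ≠ e.j ∧ e.i < nb ∧ e.j < nb ∧ 1 ≤ e.mu ∧ e.mu ≤ M ∧ e.tag < d.m
  btw : ∀ k < d.s, (0 ≤ rem k ∧ rem k ≤ d.ent k) ∨ (d.ent k ≤ rem k ∧ rem k ≤ 0)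
  ident : ∀ z, ∀ i < d.m, tagSum l.zipIdx i (fun p => p.1.resid z) +
    P i * (z 0 - z (2 * acc i)) + d.rowSum rem i z = d.rowSum d.ent i z
  solv : ∀ (x ρ : ℕ → ℝ) (ξ β : ℝ), (∀ j < d.n, |x j| ≤ ξ) → 0 ≤ β →
    (∀ i < d.m, tagSum l.zipIdx i (fun p => |ρ p.2|) ≤ β) →
    ∃ z : ℕ → ℝ, (∀ j < d.n, z (2 * j) = x j) ∧ (∀ p ∈ l.zipIdx, p.1.resid z = ρ p.2) ∧
      ∀ q < 2 * nb, |z q| ≤ 10 * d.bd ξ β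

theorem zipIdx_wf {l : List Eqn} {Q : Eqn → Prop} (h : ∀ e ∈ l, Q e) {k : ℕ} :
    ∀ p ∈ l.zipIdx k, Q p.1 :=
  fun _ hp => h _ (List.fst_mem_of_mem_zipIdx hp)

variable {d}

/-- The reason why errors do not grow with the number of gadgets. By `ident`, `P i` times the
accumulated difference is the processed part of the row minus the weighted sum of residuals. The
former is at most `total * 2ξ`, the latter at most `β`, and `1 ≤ P i`. -/
theorem Inv.abs_acc_le {M : ℝ} {l : List Eqn} {nb : ℕ} {acc : ℕ → ℕ} {P rem : ℕ → ℤ}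
    (h : d.Inv M l nb acc P rem) {z ρ : ℕ → ℝ} {ξ β : ℝ} (hz : ∀ j < d.n, |z (2 * j)| ≤ ξ)
    (hρ : ∀ p ∈ l.zipIdx, p.1.resid z = ρ p.2) {i : ℕ} (hi : i < d.m)
    (hβ : tagSum l.zipIdx i (fun p => |ρ p.2|) ≤ β) :
    |z (2 * acc i)| ≤ d.bd ξ β := by
  have h0 := hz 0 d.n_pos
  have hP : (1 : ℝ) ≤ P i := by exact_mod_cast h.one_le i hi
  have h1 := h.ident z i hi
  rw [tagSum_congr hρ] at h1
  have h2 : |tagSum l.zipIdx i (fun p => ρ p.2)| ≤ β :=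
    (abs_tagSum_le (zipIdx_wf (Q := fun e => 0 ≤ e.mu) fun e he => by linarith [(h.wf e he).2.2.2.1])).trans hβ
  -- By `btw`, the processed part of an entry has the sign of the entry and at most its size.
  have h3 : |d.rowSum (fun k => d.ent k - rem k) i z| ≤ d.total * (2 * ξ) := by
    refine d.abs_rowSum_le (fun k hk => ?_) hz i
    rcases h.btw k hk with h | h
    · rw [abs_of_nonneg (by linarith), abs_of_nonneg (by linarith)]; linarith
    · rw [abs_of_nonpos (by linarith), abs_of_nonpos (by linarith)]; linarith
  rw [rowSum_sub] at h3
  have h4 : |(P i : ℝ) * (z 0 - z (2 * acc i))| ≤ d.total * (2 * ξ) + β := by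
    rw [abs_le] at *
    constructor <;> linarith [h2.1, h2.2, h3.1, h3.2]
  have h5 : |z 0 - z (2 * acc i)| ≤ d.total * (2 * ξ) + β := by
    refine le_trans ?_ h4
    rw [abs_mul, abs_of_pos (by linarith : (0 : ℝ) < P i)]
    exact le_mul_of_one_le_left (abs_nonneg _) hP
  unfold bd
  rw [abs_le] at *
  simp only [mul_zero] at h0
  constructor <;> linarith [h0.1, h0.2, h5.1, h5.2]

/-- Prescribed residuals of a gadget can be attained by a choice of its fresh variables. -/
theorem exists_gadget_solution (z ρ : ℕ → ℝ) {T a b nb : ℕ} (hT : T < nb) (ha : a < nb)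
    (hb : b < nb) (mu : ℝ) (tag k : ℕ) {H : ℝ} (h₁ : |z (2 * T)| ≤ H) (h₂ : |z (2 * a)| ≤ H)
    (h₃ : |z (2 * b)| ≤ H) (hρ : ∀ p ∈ (gadget T a b nb mu tag).zipIdx k, |ρ p.2| ≤ H)
    (hz : ∀ q < 2 * nb, |z q| ≤ 10 * H) :
    ∃ z' : ℕ → ℝ, (∀ q < 2 * nb, z' q = z q) ∧
      (∀ p ∈ (gadget T a b nb mu tag).zipIdx k, p.1.resid z' = ρ p.2) ∧
      ∀ q < 2 * (nb + 4), |z' q| ≤ 10 * H := by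
  -- The seven equations are solved one after the other for one unknown each. Eight fresh variables
  -- leave one degree of freedom, used to set the second variable of block `nb + 1` to zero.
  set uX := z (2 * a) - ρ k with huX
  set uY := z (2 * b) + ρ (k + 1) with huY
  set vX := uX - uY - ρ (k + 2) with hvX
  set uR := z (2 * T) + ρ (k + 3) with huR
  set vR := vX - ρ (k + 4) with hvR
  set vS := ρ (k + 5) with hvS
  -- The largest of the fresh values. In units of `H`: `uX`, `uY`, `uR` are at most 2, `vX` at most
  -- 5, `vR` at most 6, `vS` at most 1, so `uS` is at most 1 + 1 + 2 + 6 = 10.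
  set uS := ρ (k + 6) + vS + uR - vR with huS
  let z' : ℕ → ℝ := fun q => if q < 2 * nb then z q else
    if q = 2 * nb then uX else if q = 2 * nb + 1 then vX else
    if q = 2 * nb + 2 then uY else if q = 2 * nb + 3 then 0 else
    if q = 2 * nb + 4 then uR else if q = 2 * nb + 5 then vR else
    if q = 2 * nb + 6 then uS else vS
  have e0 : ∀ q < 2 * nb, z' q = z q := fun q hq => by simp [z', hq]
  have e1 : z' (2 * nb) = uX := by simp [z']
  have e2 : z' (2 * nb + 1) = vX := by simp [z']
  have e3 : z' (2 * (nb + 1)) = uY := by simp [z', mul_add]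
  have e4 : z' (2 * (nb + 1) + 1) = 0 := by simp [z', mul_add, add_assoc]
  have e5 : z' (2 * (nb + 2)) = uR := by simp [z', mul_add]
  have e6 : z' (2 * (nb + 2) + 1) = vR := by simp [z', mul_add, add_assoc]
  have e7 : z' (2 * (nb + 3)) = uS := by simp [z', mul_add]
  have e8 : z' (2 * (nb + 3) + 1) = vS := by simp [z', mul_add, add_assoc]
  have ea := e0 (2 * a) (by omega)
  have eb := e0 (2 * b) (by omega)
  have eT := e0 (2 * T) (by omega)
  simp only [gadget, List.zipIdx_cons, List.zipIdx_nil, List.mem_cons, List.not_mem_nil, or_false,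
    forall_eq_or_imp, forall_eq, add_assoc, Nat.reduceAdd] at hρ ⊢
  refine ⟨z', e0, ?_, ?_⟩
  · simp only [Eqn.resid, Kind.c₀, Kind.c₁, e1, e2, e3, e4, e5, e6, e7, e8, ea, eb, eT]
    refine ⟨?_, ?_, ?_, ?_, ?_, ?_, ?_⟩ <;> linarith
  · obtain ⟨r0, r1, r2, r3, r4, r5, r6⟩ := hρ
    have hH : 0 ≤ H := (abs_nonneg _).trans h₁
    intro q hq
    simp only [z']
    rw [abs_le] at *
    split_ifs with c
    · exact abs_le.1 (hz q c)
    all_goals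
      constructor <;> linarith [r0.1, r1.1, r2.1, r3.1, r4.1, r5.1, r6.1, r0.2, r1.2, r2.2, r3.2,
        r4.2, r5.2, r6.2, h₁.1, h₁.2, h₂.1, h₂.2, h₃.1, h₃.2]

theorem Eqn.resid_congr {z z' : ℕ → ℝ} {e : Eqn} {nb : ℕ} (hi : e.i < nb) (hj : e.j < nb)
    (h : ∀ q < 2 * nb, z' q = z q) : e.resid z' = e.resid z := by
  simp only [Eqn.resid]
  rw [h (2 * e.i) (by omega), h (2 * e.j) (by omega), h (2 * e.i + 1) (by omega),
    h (2 * e.j + 1) (by omega)]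

/-- Common step of doubling and adding. Hypothesis `heq` says that replacing the accumulated
difference by itself plus `u_a - u_b`, with new multiplier `p`, preserves the value of row `i`; the
gadget supplies exactly this replacement up to its own residuals. The factor 10 does not compound,
since `a`, `b` and `acc i` are old variables or an accumulator, for which the bound `bd` holds
without it. -/
theorem Inv.gadget_step {M : ℝ} {l : List Eqn} {nb : ℕ} {acc : ℕ → ℕ} {P rem : ℕ → ℤ}
    (h : d.Inv M l nb acc P rem) {i : ℕ} (hi : i < d.m) {a b : ℕ} (ha : a < d.n ∨ a = acc i)
    (hb : b < d.n ∨ b = acc i) {p : ℤ} (hp : 1 ≤ p) (hpM : (p : ℝ) ≤ M) {rem' : ℕ → ℤ}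
    (hbtw : ∀ k < d.s, (0 ≤ rem' k ∧ rem' k ≤ d.ent k) ∨ (d.ent k ≤ rem' k ∧ rem' k ≤ 0))
    (hne : ∀ z, ∀ i' ≠ i, d.rowSum rem' i' z = d.rowSum rem i' z)
    (heq : ∀ z, (p : ℝ) * (z 0 - z (2 * acc i) + (z (2 * a) - z (2 * b))) + d.rowSum rem' i z =
      P i * (z 0 - z (2 * acc i)) + d.rowSum rem i z) :
    d.Inv M (l ++ gadget (acc i) a b nb p i) (nb + 4) (Function.update acc i (nb + 3))
      (Function.update P i p) rem' := by
  have hT := h.acc_lt i hi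
  have hn := h.n_le
  have ha' : a < nb := by rcases ha with h | h <;> omega
  have hb' : b < nb := by rcases hb with h | h <;> omega
  have hpR : (1 : ℝ) ≤ p := by exact_mod_cast hp
  refine ⟨by omega, ?_, ?_, ?_, hbtw, ?_, ?_⟩
  · intro i' hi'
    by_cases hii : i' = i
    · subst hii; simp
    · rw [Function.update_of_ne hii]; have := h.acc_lt i' hi'; omega
  · intro i' hi'
    by_cases hii : i' = i
    · subst hii; simpa
    · rw [Function.update_of_ne hii]; exact h.one_le i' hi'
  · intro e he
    rcases List.mem_append.1 he with he | he
    · obtain ⟨h1, h2, h3, h4⟩ := h.wf e he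
      exact ⟨h1, by omega, by omega, h4⟩
    · simp only [gadget, List.mem_cons, List.not_mem_nil, or_false] at he
      rcases he with rfl | rfl | rfl | rfl | rfl | rfl | rfl <;>
        exact ⟨by simp only; omega, by simp only; omega, by simp only; omega, hpR, hpM, hi⟩
  · intro z i' hi'
    rw [List.zipIdx_append, tagSum_append]
    have := h.ident z i' hi'
    by_cases hii : i' = i
    · subst hii
      have h2 := heq z
      rw [tagSum_gadget_self, Function.update_self, Function.update_self]
      linarith
    · rw [tagSum_gadget_of_ne _ _ _ _ _ hii, Function.update_of_ne hii, Function.update_of_ne hii,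
        hne z i' hii]
      linarith
  · intro x ρ ξ β hx hβ hρ
    rw [List.zipIdx_append] at hρ ⊢
    simp only [tagSum_append] at hρ
    have hg : ∀ q ∈ (gadget (acc i) a b nb p i).zipIdx (0 + l.length),
        q.1.mu = p ∧ q.1.tag = i := by
      refine zipIdx_wf (Q := fun e => e.mu = p ∧ e.tag = i) ?_
      simp [gadget]
    have hgn : ∀ q ∈ (gadget (acc i) a b nb p i).zipIdx (0 + l.length),
        0 ≤ q.1.mu * |ρ q.2| := fun q hq => by
      rw [(hg q hq).1]; positivity
    have hln : ∀ q ∈ l.zipIdx, 0 ≤ q.1.mu * |ρ q.2| :=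
      fun q hq => mul_nonneg (zipIdx_wf (Q := fun e => 0 ≤ e.mu)
        (fun e he => by linarith [(h.wf e he).2.2.2.1]) q hq) (abs_nonneg _)
    obtain ⟨z, hz1, hz2, hz3⟩ := h.solv x ρ ξ β hx hβ fun i' hi' =>
      le_trans (le_add_of_nonneg_right (tagSum_nonneg hgn)) (hρ i' hi')
    have hξ : ∀ j < d.n, |z (2 * j)| ≤ ξ := fun j hj => by rw [hz1 j hj]; exact hx j hj
    have hξ0 : 0 ≤ ξ := (abs_nonneg _).trans (hx 0 d.n_pos)
    have hξb : ξ ≤ d.bd ξ β := by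
      have := mul_nonneg hξ0 d.total_nonneg
      unfold bd; linarith
    have hβb : β ≤ d.bd ξ β := by
      have := mul_nonneg hξ0 d.total_nonneg
      unfold bd; linarith
    have hacc := h.abs_acc_le hξ hz2 hi
      ((le_add_of_nonneg_right (tagSum_nonneg hgn)).trans (hρ i hi))
    obtain ⟨z', hz'1, hz'2, hz'3⟩ := exists_gadget_solution z ρ hT ha' hb' p i (0 + l.length)
      hacc
      (by rcases ha with ha | rfl
          exacts [(hξ a ha).trans hξb, hacc])
      (by rcases hb with hb | rfl
          exacts [(hξ b hb).trans hξb, hacc])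
      -- As `1 ≤ p`, a single residual is at most its multiple by `p`, hence at most the weighted
      -- sum `β`.
      (fun q hq => by
        refine le_trans ?_ hβb
        refine le_trans ?_ (hρ i hi)
        refine le_trans ?_ (le_add_of_nonneg_left (tagSum_nonneg hln))
        have h1 := le_tagSum hq hgn
        rw [(hg q hq).1, (hg q hq).2] at h1
        exact le_trans (le_mul_of_one_le_left (abs_nonneg _) hpR) h1) hz3
    refine ⟨z', fun j hj => by rw [hz'1 _ (by omega), hz1 j hj], ?_, hz'3⟩
    intro q hq
    rcases List.mem_append.1 hq with hq | hq
    · have hw := zipIdx_wf h.wf q hq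
      rw [Eqn.resid_congr hw.2.1 hw.2.2.1 hz'1, hz2 q hq]
    · exact hz'2 q hq

/-- Doubling the accumulator of row `i`. -/
theorem Inv.double {M : ℝ} {l : List Eqn} {nb : ℕ} {acc : ℕ → ℕ} {P rem : ℕ → ℤ}
    (h : d.Inv M l nb acc P rem) {i : ℕ} (hi : i < d.m) {p : ℤ} (hp : 1 ≤ p) (hpM : (p : ℝ) ≤ M)
    (hP : P i = 2 * p) :
    d.Inv M (l ++ gadget (acc i) 0 (acc i) nb p i) (nb + 4) (Function.update acc i (nb + 3))
      (Function.update P i p) rem := by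
  refine h.gadget_step hi (Or.inl d.n_pos) (Or.inr rfl) hp hpM h.btw (fun _ _ _ => rfl) fun z => ?_
  rw [hP]
  push_cast
  ring

/-- Adding `τ` times a difference of variables to the accumulator of a row. -/
theorem Inv.addEntry {M : ℝ} {l : List Eqn} {nb : ℕ} {acc : ℕ → ℕ} {P rem : ℕ → ℤ}
    (h : d.Inv M l nb acc P rem) {k : ℕ} (hk : k < d.s) (hpM : (P (d.row k) : ℝ) ≤ M)
    {a b : ℕ} {τ : ℤ}
    (hτ : (τ = 1 ∧ a = d.col k ∧ b = 0 ∧ P (d.row k) ≤ rem k) ∨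
      (τ = -1 ∧ a = 0 ∧ b = d.col k ∧ P (d.row k) ≤ -rem k) ∨ (τ = 0 ∧ a = 0 ∧ b = 0)) :
    d.Inv M (l ++ gadget (acc (d.row k)) a b nb (P (d.row k) : ℤ) (d.row k)) (nb + 4)
      (Function.update acc (d.row k) (nb + 3)) P
      (Function.update rem k (rem k + -τ * P (d.row k))) := by
  have hr := d.row_lt k hk
  have hc := d.col_lt k hk
  have hP := h.one_le _ hr
  have key := h.gadget_step (a := a) (b := b) (p := P (d.row k))
    (rem' := Function.update rem k (rem k + -τ * P (d.row k))) hr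
    (Or.inl (by rcases hτ with h | h | h <;> have := d.n_pos <;> omega))
    (Or.inl (by rcases hτ with h | h | h <;> have := d.n_pos <;> omega)) hP hpM ?_ ?_ ?_
  · rwa [Function.update_eq_self] at key
  · intro k' hk'
    have hb := h.btw k' hk'
    by_cases hkk : k' = k
    · subst hkk
      rw [Function.update_self]
      rcases hτ with ⟨rfl, -, -, h1⟩ | ⟨rfl, -, -, h1⟩ | ⟨rfl, -⟩
      · omega
      · omega
      · simpa using hb
    · rwa [Function.update_of_ne hkk]
  · intro z i' hi'
    exact d.rowSum_update_of_ne _ _ _ hi'.symm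
  · intro z
    rw [d.rowSum_update_row _ _ _ hk]
    rcases hτ with ⟨rfl, rfl, rfl, -⟩ | ⟨rfl, rfl, rfl, -⟩ | ⟨rfl, rfl, rfl⟩ <;> push_cast <;> ring

/-- Block `j` starts with `x_j` as its first variable and zero as its second. Every accumulator is
block 0, so the accumulated difference vanishes for any choice of `P`. -/
theorem Inv.init (M : ℝ) {nb : ℕ} (hnb : nb = d.n) {P : ℕ → ℤ} (hP : ∀ i < d.m, 1 ≤ P i) :
    d.Inv M [] nb (fun _ => 0) P d.ent := by
  subst hnb
  refine ⟨le_rfl, fun _ _ => d.n_pos, hP, by simp, fun k _ => by omega, ?_, ?_⟩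
  · intro z i _
    simp [tagSum]
  · intro x ρ ξ β hx hβ _
    have hξ0 : 0 ≤ ξ := (abs_nonneg _).trans (hx 0 d.n_pos)
    have hb : ξ ≤ d.bd ξ β := by
      have := mul_nonneg hξ0 d.total_nonneg
      unfold bd; linarith
    refine ⟨fun q => if q % 2 = 0 then x (q / 2) else 0, fun j _ => by simp, by simp, ?_⟩
    intro q hq
    simp only
    split_ifs
    · exact (hx _ (by omega)).trans (by linarith)
    · rw [abs_zero]; linarith

/-- The equations that read off the accumulators of the rows before `i`. -/
def finals (acc : ℕ → ℕ) (i : ℕ) : List Eqn :=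
  (List.range i).map fun t => ⟨.fst, 0, acc t, 1, t⟩

theorem finals_succ (acc : ℕ → ℕ) (i : ℕ) :
    finals acc (i + 1) = finals acc i ++ [⟨.fst, 0, acc i, 1, i⟩] := by
  simp [finals, List.range_succ]

theorem length_finals (acc : ℕ → ℕ) (i : ℕ) : (finals acc i).length = i := by
  simp [finals]

theorem tagSum_finals_of_le (acc : ℕ → ℕ) {m i : ℕ} (hi : m ≤ i) (k : ℕ) (ρ : Eqn × ℕ → ℝ) :
    tagSum ((finals acc m).zipIdx k) i ρ = 0 := by
  induction m with
  | zero => simp [finals, tagSum]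
  | succ m ih =>
    rw [finals_succ, List.zipIdx_append, tagSum_append, ih (by omega)]
    simp only [tagSum, List.zipIdx_singleton, List.map_cons, List.map_nil, List.sum_cons,
      List.sum_nil]
    rw [if_neg (by omega)]
    simp

theorem tagSum_finals (acc : ℕ → ℕ) {m i : ℕ} (hi : i < m) (k : ℕ) (ρ : Eqn × ℕ → ℝ) :
    tagSum ((finals acc m).zipIdx k) i ρ = ρ (⟨.fst, 0, acc i, 1, i⟩, k + i) := by
  induction m with
  | zero => omega
  | succ m ih =>
    rw [finals_succ, List.zipIdx_append, tagSum_append]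
    simp only [tagSum, List.zipIdx_singleton, List.map_cons, List.map_nil, List.sum_cons,
      List.sum_nil, length_finals]
    rcases Nat.lt_succ_iff_lt_or_eq.1 hi with h | rfl
    · have := ih h
      simp only [tagSum] at this
      rw [this, if_neg (by omega)]
      simp
    · have := tagSum_finals_of_le acc (le_refl i) k ρ
      simp only [tagSum] at this
      rw [this]
      simp

theorem mem_zipIdx_finals {acc : ℕ → ℕ} {m k : ℕ} {p : Eqn × ℕ}
    (hp : p ∈ (finals acc m).zipIdx k) :
    ∃ i < m, p = (⟨.fst, 0, acc i, 1, i⟩, k + i) := by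
  obtain ⟨p, q⟩ := p
  rw [List.mem_zipIdx_iff_le_and_getElem?_sub] at hp
  obtain ⟨h1, h2⟩ := hp
  obtain ⟨h3, h4⟩ := List.getElem?_eq_some_iff.1 h2
  rw [length_finals] at h3
  refine ⟨q - k, h3, ?_⟩
  simp [finals] at h4
  rw [← h4]
  simp; omega

/-- The result of the construction. -/
structure Complete (M : ℝ) (l : List Eqn) (nb : ℕ) : Prop where
  wf : ∀ e ∈ l, e.i ≠ e.j ∧ e.i < nb ∧ e.j < nb ∧ 1 ≤ e.mu ∧ e.mu ≤ M ∧ e.tag < d.m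
  exists_tag : ∀ i < d.m, ∃ e ∈ l, e.tag = i
  ident : ∀ z, ∀ i < d.m, tagSum l.zipIdx i (fun p => p.1.resid z) = d.rowSum d.ent i z
  solv : ∀ (x ρ : ℕ → ℝ) (ξ β : ℝ), (∀ j < d.n, |x j| ≤ ξ) → 0 ≤ β →
    (∀ i < d.m, tagSum l.zipIdx i (fun p => |ρ p.2|) ≤ β) →
    (∀ i < d.m, tagSum l.zipIdx i (fun p => ρ p.2) = d.rowSum d.ent i fun q => x (q / 2)) →
    ∃ z : ℕ → ℝ, (∀ j < d.n, z (2 * j) = x j) ∧ (∀ p ∈ l.zipIdx, p.1.resid z = ρ p.2) ∧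
      ∀ q < 2 * nb, |z q| ≤ 10 * d.bd ξ β

/-- Once all entries are used up and the multiplier is 1, only `u_0 - u_acc` is missing from the
row, and the final equation contributes it. Its residual is no longer free: the summed identity
determines it, and the compatibility hypothesis in `solv` says that it has the prescribed value. The
condition `acc i ≠ 0` makes the two blocks of that equation distinct. -/
theorem Inv.complete {M : ℝ} {l : List Eqn} {nb : ℕ} {acc : ℕ → ℕ} {P rem : ℕ → ℤ}
    (h : d.Inv M l nb acc P rem) (hP : ∀ i < d.m, P i = 1) (hrem : ∀ k < d.s, rem k = 0)
    (hacc : ∀ i < d.m, acc i ≠ 0) (hM : 1 ≤ M) :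
    Complete (d := d) M (l ++ finals acc d.m) nb := by
  have hid : ∀ z, ∀ i < d.m, tagSum l.zipIdx i (fun p => p.1.resid z) + (z 0 - z (2 * acc i)) =
      d.rowSum d.ent i z := by
    intro z i hi
    have h1 := h.ident z i hi
    have h2 : d.rowSum rem i z = 0 := by
      refine Finset.sum_eq_zero fun k hk => ?_
      rw [hrem k (Finset.mem_range.1 hk)]
      simp
    rw [h2, hP i hi] at h1
    simpa using h1
  have hres : ∀ (z : ℕ → ℝ) (i : ℕ),
      Eqn.resid z ⟨.fst, 0, acc i, 1, i⟩ = z 0 - z (2 * acc i) := by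
    intro z i
    simp [Eqn.resid, Kind.c₀, Kind.c₁]
  refine ⟨?_, ?_, ?_, ?_⟩
  · intro e he
    rcases List.mem_append.1 he with he | he
    · exact h.wf e he
    · simp only [finals, List.mem_map, List.mem_range] at he
      obtain ⟨i, hi, rfl⟩ := he
      exact ⟨(hacc i hi).symm, by have := d.n_pos; have := h.n_le; simp only; omega,
        h.acc_lt i hi, le_rfl, hM, hi⟩
  · intro i hi
    exact ⟨⟨.fst, 0, acc i, 1, i⟩, List.mem_append_right _
      (List.mem_map.2 ⟨i, List.mem_range.2 hi, rfl⟩), rfl⟩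
  · intro z i hi
    rw [List.zipIdx_append, tagSum_append, tagSum_finals acc hi, hres, hid z i hi]
  · intro x ρ ξ β hx hβ hρ hsum
    simp only [List.zipIdx_append, tagSum_append] at hρ hsum ⊢
    obtain ⟨z, hz1, hz2, hz3⟩ := h.solv x ρ ξ β hx hβ fun i hi => by
      refine le_trans (le_add_of_nonneg_right ?_) (hρ i hi)
      rw [tagSum_finals acc hi]
      positivity
    refine ⟨z, hz1, fun p hp => ?_, hz3⟩
    rcases List.mem_append.1 hp with hp | hp
    · exact hz2 p hp
    · obtain ⟨i, hi, rfl⟩ := mem_zipIdx_finals hp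
      have h1 := hsum i hi
      have h2 := hid z i hi
      rw [tagSum_finals acc hi] at h1
      rw [tagSum_congr hz2] at h2
      have h3 : d.rowSum d.ent i z = d.rowSum d.ent i fun q => x (q / 2) := by
        refine Finset.sum_congr rfl fun k hk => ?_
        have h0 := hz1 0 d.n_pos
        rw [hz1 _ (d.col_lt k (Finset.mem_range.1 hk))]
        simp only [mul_zero] at h0
        simp [h0]
      rw [hres]
      simp only at h1 ⊢
      linarith

end Data

end LinSys

namespace RealRAM

/-! ### Reasoning about programs -/

/-- Started in `σ`, the program halts after at most `T` steps in a memory that satisfies `Post`. -/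
def Runs (p : Stmt) (σ : State) (T : ℕ) (Post : State → Prop) : Prop :=
  ∃ σ' t, Exec p σ t σ' ∧ t ≤ T ∧ Post σ'

theorem Runs.mono {p : Stmt} {σ : State} {T T' : ℕ} {Q Q' : State → Prop} (h : Runs p σ T Q)
    (hT : T ≤ T') (hQ : ∀ σ', Q σ' → Q' σ') : Runs p σ T' Q' := by
  obtain ⟨σ', t, he, ht, hq⟩ := h
  exact ⟨σ', t, he, ht.trans hT, hQ _ hq⟩

theorem Runs.seq {p q : Stmt} {σ : State} {T T' : ℕ} {Q Q' : State → Prop} (h : Runs p σ T Q)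
    (h' : ∀ σ', Q σ' → Runs q σ' T' Q') : Runs (.seq p q) σ (T + T') Q' := by
  obtain ⟨σ', t, he, ht, hq⟩ := h
  obtain ⟨σ'', t', he', ht', hq'⟩ := h' σ' hq
  exact ⟨σ'', t + t', .seq he he', by omega, hq'⟩

/-- A loop with an invariant and a decreasing measure. -/
theorem Runs.loop {b : BExpr} {p : Stmt} (I : State → Prop) (μ : State → ℕ) (c : ℕ)
    (hp : ∀ σ, I σ → b.eval σ → Runs p σ c fun σ' => I σ' ∧ μ σ' < μ σ) {σ : State} (hσ : I σ) :
    Runs (.loop b p) σ (μ σ * (c + b.cost) + b.cost) fun σ' => I σ' ∧ ¬ b.eval σ' := by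
  induction hn : μ σ using Nat.strong_induction_on generalizing σ with
  | _ n ih =>
    by_cases hb : b.eval σ
    · obtain ⟨σ', t, he, ht, hI, hμ⟩ := hp σ hσ hb
      obtain ⟨σ'', t', he', ht', hq'⟩ := ih (μ σ') (hn ▸ hμ) hI rfl
      refine ⟨σ'', b.cost + t + t', .loop_true hb he he', ?_, hq'⟩
      have h1 : (μ σ' + 1) * (c + b.cost) ≤ n * (c + b.cost) :=
        Nat.mul_le_mul_right _ (by omega)
      rw [add_mul, one_mul] at h1
      omega
    · exact ⟨σ, b.cost, .loop_false hb, by omega, hσ, hb⟩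

/-- A loop with a known number of iterations. -/
theorem Runs.for {b : BExpr} {p : Stmt} (I : ℕ → State → Prop) (n c : ℕ)
    (hb : ∀ k σ, I k σ → (b.eval σ ↔ k < n))
    (hp : ∀ k < n, ∀ σ, I k σ → Runs p σ c (I (k + 1))) {σ : State} (hσ : I 0 σ) :
    Runs (.loop b p) σ (n * (c + b.cost) + b.cost) (I n) := by
  have key : ∀ j k, k + j = n → ∀ σ, I k σ →
      Runs (.loop b p) σ (j * (c + b.cost) + b.cost) (I n) := by
    intro j
    induction j with
    | zero =>
      intro k hk σ hσ
      obtain rfl : k = n := by omega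
      exact ⟨σ, b.cost, .loop_false (by rw [hb k σ hσ]; omega), by omega, hσ⟩
    | succ j ih =>
      intro k hk σ hσ
      obtain ⟨σ', t, he, ht, hI⟩ := hp k (by omega) σ hσ
      obtain ⟨σ'', t', he', ht', hq'⟩ := ih (k + 1) (by omega) σ' hI
      refine ⟨σ'', b.cost + t + t', .loop_true ((hb k σ hσ).2 (by omega)) he he', ?_, hq'⟩
      rw [add_mul, one_mul]
      omega
  exact key n 0 (by omega) σ hσ

/-- Programs without loops. -/
def Stmt.LoopFree : Stmt → Prop
  | .skip => True
  | .setInt _ _ _ => True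
  | .setReal _ _ _ => True
  | .seq p q => p.LoopFree ∧ q.LoopFree
  | .cond _ p q => p.LoopFree ∧ q.LoopFree
  | .loop _ _ => False

/-- A bound for the number of steps of a program without loops. -/
def Stmt.maxCost : Stmt → ℕ
  | .skip => 1
  | .setInt _ i e => i.cost + e.cost + 1
  | .setReal _ i e => i.cost + e.cost + 1
  | .seq p q => p.maxCost + q.maxCost
  | .cond b p q => b.cost + (p.maxCost + q.maxCost)
  | .loop _ _ => 0

open Classical in
/-- The effect of a program without loops. -/
noncomputable def Stmt.run : Stmt → State → State
  | .skip, σ => σ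
  | .setInt a i e, σ => σ.setInt a (i.eval σ) (e.eval σ)
  | .setReal a i e, σ => σ.setReal a (i.eval σ) (e.eval σ)
  | .seq p q, σ => q.run (p.run σ)
  | .cond b p q, σ => if b.eval σ then p.run σ else q.run σ
  | .loop _ _, σ => σ

theorem Stmt.LoopFree.exec {p : Stmt} (h : p.LoopFree) (σ : State) :
    ∃ t ≤ p.maxCost, Exec p σ t (p.run σ) := by
  induction p generalizing σ with
  | skip => exact ⟨1, le_rfl, .skip σ⟩
  | setInt a i e => exact ⟨_, le_rfl, .setInt σ a i e⟩
  | setReal a i e => exact ⟨_, le_rfl, .setReal σ a i e⟩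
  | seq p q hp hq =>
    obtain ⟨t, ht, h1⟩ := hp h.1 σ
    obtain ⟨t', ht', h2⟩ := hq h.2 (p.run σ)
    exact ⟨_, add_le_add ht ht', .seq h1 h2⟩
  | cond b p q hp hq =>
    obtain ⟨t, ht, h1⟩ := hp h.1 σ
    obtain ⟨t', ht', h2⟩ := hq h.2 σ
    by_cases hb : b.eval σ
    · refine ⟨b.cost + t, by simp only [Stmt.maxCost]; omega, ?_⟩
      simp only [Stmt.run, if_pos hb]
      exact .cond_true hb h1
    · refine ⟨b.cost + t', by simp only [Stmt.maxCost]; omega, ?_⟩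
      simp only [Stmt.run, if_neg hb]
      exact .cond_false hb h2
  | loop b p => exact h.elim

theorem Stmt.LoopFree.runs {p : Stmt} (h : p.LoopFree) {σ : State} {Q : State → Prop}
    (hQ : Q (p.run σ)) : Runs p σ p.maxCost Q := by
  obtain ⟨t, ht, he⟩ := h.exec σ
  exact ⟨_, t, he, ht, hQ⟩

theorem State.setInt_int (σ : State) (a : ℕ) (i z : ℤ) (a' : ℕ) (i' : ℤ) :
    (σ.setInt a i z).int a' i' = if a' = a ∧ i' = i then z else σ.int a' i' := by
  unfold State.setInt
  by_cases ha : a' = a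
  · subst ha
    by_cases hi : i' = i
    · subst hi; simp
    · simp [hi]
  · simp [ha]

theorem State.setInt_real (σ : State) (a : ℕ) (i z : ℤ) : (σ.setInt a i z).real = σ.real := rfl

theorem State.setReal_int (σ : State) (a : ℕ) (i : ℤ) (r : ℝ) :
    (σ.setReal a i r).int = σ.int := rfl

theorem State.setReal_real (σ : State) (a : ℕ) (i : ℤ) (r : ℝ) (a' : ℕ) (i' : ℤ) :
    (σ.setReal a i r).real a' i' = if a' = a ∧ i' = i then r else σ.real a' i' := by
  unfold State.setReal
  by_cases ha : a' = a
  · subst ha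
    by_cases hi : i' = i
    · subst hi; simp
    · simp [hi]
  · simp [ha]

end RealRAM

namespace LinSys

open RealRAM

/-! ### Writing equations to the output -/

/-- The non-zero coefficients of one block of an equation. -/
def Kind.cols (i : ℕ) (w : ℝ) : Kind → List (ℕ × ℝ)
  | .fst => [(2 * i, w)]
  | .snd => [(2 * i + 1, w)]
  | .diff => [(2 * i, w), (2 * i + 1, -w)]

/-- The non-zero coefficients of an equation, including its multiplier. -/
def Eqn.cols (e : Eqn) : List (ℕ × ℝ) := e.kind.cols e.i e.mu ++ e.kind.cols e.j (-e.mu)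

/-- The non-zero coefficients of a system, as a list of triples (row, column, value). -/
def entries (l : List Eqn) : List (ℕ × ℕ × ℝ) :=
  l.zipIdx.flatMap fun p => p.1.cols.map fun c => (p.2, c.1, c.2)

theorem entries_concat (l : List Eqn) (e : Eqn) :
    entries (l ++ [e]) = entries l ++ e.cols.map fun c => (l.length, c.1, c.2) := by
  simp [entries, List.zipIdx_append]

/-- The memory holds a list of triples in the output arrays. -/
structure HoldsEntries (σ : State) (E : List (ℕ × ℕ × ℝ)) : Prop where
  len : σ.int 3 2 = E.length
  get : ∀ (t : ℕ) (h : t < E.length), σ.int 4 t = E[t].1 ∧ σ.int 5 t = E[t].2.1 ∧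
    σ.real 3 t = E[t].2.2

/-- The memory holds the system `l`, the tags and the number of equations with each tag. -/
structure HoldsSystem (σ : State) (m : ℕ) (l : List Eqn) : Prop where
  len : σ.int 3 0 = l.length
  ents : HoldsEntries σ (entries l)
  tag : ∀ (r : ℕ) (h : r < l.length), σ.int 6 r = l[r].tag
  cnt : ∀ i < m, σ.int 7 (i : ℕ) = l.countP fun e => e.tag = i

/-- Register `c`. -/
def reg (c : ℤ) : IExpr := .get 8 (.const c)

/-- `p; q`. -/
infixr:60 " ;; " => Stmt.seq

/-- Append an entry to the output. -/
def push (col : IExpr) (v : RExpr) : Stmt :=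
  .setInt 4 (.get 3 (.const 2)) (.get 3 (.const 0)) ;;
  .setInt 5 (.get 3 (.const 2)) col ;;
  .setReal 3 (.get 3 (.const 2)) v ;;
  .setInt 3 (.const 2) (.add (.get 3 (.const 2)) (.const 1))

theorem push_loopFree (col : IExpr) (v : RExpr) : (push col v).LoopFree := by
  simp [push, Stmt.LoopFree]

/-- An integer expression whose value is a function of the registers. -/
def IExpr.Stable (e : IExpr) : Prop :=
  ∀ σ σ' : State, (∀ x, σ.int 8 x = σ'.int 8 x) → e.eval σ = e.eval σ'

/-- A real expression whose value is a function of the multiplier. -/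
def RExpr.Stable (e : RExpr) : Prop :=
  ∀ σ σ' : State, σ.real 6 0 = σ'.real 6 0 → e.eval σ = e.eval σ'

theorem run_push_int {col : IExpr} {v : RExpr} (σ : State) {a : ℕ} {x : ℤ} (h4 : a ≠ 4)
    (h5 : a ≠ 5) (h3 : a ≠ 3 ∨ x ≠ 2) : ((push col v).run σ).int a x = σ.int a x := by
  simp only [push, Stmt.run, IExpr.eval, State.setInt_int, State.setReal_int]
  simp [h4, h5]
  intro h h'
  rcases h3 with h3 | h3
  · exact absurd h h3
  · exact absurd h' h3

theorem run_push_real {col : IExpr} {v : RExpr} (σ : State) {a : ℕ} {x : ℤ} (h3 : a ≠ 3) :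
    ((push col v).run σ).real a x = σ.real a x := by
  simp only [push, Stmt.run, State.setReal_real, State.setInt_real]
  simp [h3]

/-- `col` and `v` are evaluated after some output cells have been overwritten; stability guarantees
that their values are still those in `σ`. -/
theorem run_push_entries {col : IExpr} {v : RExpr} {σ : State} {E : List (ℕ × ℕ × ℝ)} {r c : ℕ}
    {w : ℝ} (h : HoldsEntries σ E) (hcol : IExpr.Stable col) (hv : RExpr.Stable v)
    (hr : σ.int 3 0 = r)
    (hc : col.eval σ = c) (hw : v.eval σ = w) :
    HoldsEntries ((push col v).run σ) (E ++ [(r, c, w)]) := by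
  have h1 : ∀ z z', col.eval (σ.setInt 4 z z') = c := fun z z' => by
    rw [← hc]; exact hcol _ _ fun x => by simp [State.setInt_int]
  have h2 : ∀ z z' y y', v.eval ((σ.setInt 4 z z').setInt 5 y y') = w := fun z z' y y' => by
    rw [← hw]; exact hv _ _ (by simp [State.setInt_real])
  have hl := h.len
  constructor
  · simp [push, Stmt.run, IExpr.eval, State.setInt_int, State.setReal_int, hl]
  · intro t ht
    rw [List.length_append, List.length_singleton] at ht
    simp only [push, Stmt.run, IExpr.eval, State.setInt_int, State.setReal_int, State.setReal_real,
      State.setInt_real, h1, h2, hl, hr]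
    rcases Nat.lt_succ_iff_lt_or_eq.1 ht with h' | rfl
    · have hne : (t : ℤ) ≠ E.length := by omega
      rw [List.getElem_append_left h']
      simpa [hne] using h.get t h'
    · simp

/-- Append an equation between the blocks in the registers `c` and `c'` to the output; the tag
is in register 7. -/
def emit (k : Kind) (c c' : ℤ) : Stmt :=
  (match k with
    | .fst => push (.mul (.const 2) (reg c)) (.get 6 (.const 0)) ;;
        push (.mul (.const 2) (reg c')) (.sub (.const 0) (.get 6 (.const 0)))
    | .snd => push (.add (.mul (.const 2) (reg c)) (.const 1)) (.get 6 (.const 0)) ;;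
        push (.add (.mul (.const 2) (reg c')) (.const 1)) (.sub (.const 0) (.get 6 (.const 0)))
    | .diff => push (.mul (.const 2) (reg c)) (.get 6 (.const 0)) ;;
        push (.add (.mul (.const 2) (reg c)) (.const 1)) (.sub (.const 0) (.get 6 (.const 0))) ;;
        push (.mul (.const 2) (reg c')) (.sub (.const 0) (.get 6 (.const 0))) ;;
        push (.add (.mul (.const 2) (reg c')) (.const 1)) (.get 6 (.const 0))) ;;
  .setInt 6 (.get 3 (.const 0)) (reg 7) ;;
  .setInt 7 (reg 7) (.add (.get 7 (reg 7)) (.const 1)) ;;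
  .setInt 3 (.const 0) (.add (.get 3 (.const 0)) (.const 1))

theorem emit_loopFree (k : Kind) (c c' : ℤ) : (emit k c c').LoopFree := by
  cases k <;> simp [emit, Stmt.LoopFree, push_loopFree]

/-- The memory outside of the output is unchanged. -/
def SameRest (σ σ' : State) : Prop :=
  (∀ a, a < 3 ∨ 7 < a → ∀ x, σ'.int a x = σ.int a x) ∧ ∀ a ≠ 3, ∀ x, σ'.real a x = σ.real a x

theorem SameRest.trans {σ σ' σ'' : State} (h : SameRest σ σ') (h' : SameRest σ' σ'') :
    SameRest σ σ'' :=
  ⟨fun a ha x => (h'.1 a ha x).trans (h.1 a ha x), fun a ha x => (h'.2 a ha x).trans (h.2 a ha x)⟩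

theorem stable_reg_fst (c : ℤ) : IExpr.Stable (.mul (.const 2) (reg c)) := by
  intro σ σ' h
  simp [IExpr.eval, reg, h]

theorem stable_reg_snd (c : ℤ) : IExpr.Stable (.add (.mul (.const 2) (reg c)) (.const 1)) := by
  intro σ σ' h
  simp [IExpr.eval, reg, h]

theorem stable_mult : RExpr.Stable (.get 6 (.const 0)) := by
  intro σ σ' h
  simp [RExpr.eval, IExpr.eval, h]

theorem stable_neg_mult : RExpr.Stable (.sub (.const 0) (.get 6 (.const 0))) := by
  intro σ σ' h
  simp [RExpr.eval, IExpr.eval, h]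

/-- Besides the coefficients, the tag and the number of equations per tag are recorded; the weights
`√N` are computed from them once the system is complete. -/
theorem run_emit {σ : State} {m : ℕ} {l : List Eqn} (h : HoldsSystem σ m l) (k : Kind) {c c' : ℤ}
    {i j t : ℕ} {mu : ℝ} (hi : σ.int 8 c = i) (hj : σ.int 8 c' = j) (ht : σ.int 8 7 = t)
    (htm : t < m) (hmu : σ.real 6 0 = mu) :
    HoldsSystem ((emit k c c').run σ) m (l ++ [⟨k, i, j, mu, t⟩]) ∧
      SameRest σ ((emit k c c').run σ) := by
  -- The three kinds differ only in the coefficients they push. The bookkeeping afterwards is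
  -- treated once, for any memory `τ` that the pushes may reach.
  have key : ∀ τ : State, (∀ a x, a ≠ 4 → a ≠ 5 → (a ≠ 3 ∨ x ≠ 2) → τ.int a x = σ.int a x) →
      (∀ a x, a ≠ 3 → τ.real a x = σ.real a x) →
      HoldsEntries τ (entries (l ++ [⟨k, i, j, mu, t⟩])) →
      let τ' := Stmt.run (.setInt 6 (.get 3 (.const 0)) (reg 7) ;;
        .setInt 7 (reg 7) (.add (.get 7 (reg 7)) (.const 1)) ;;
        .setInt 3 (.const 0) (.add (.get 3 (.const 0)) (.const 1))) τ
      HoldsSystem τ' m (l ++ [⟨k, i, j, mu, t⟩]) ∧ SameRest σ τ' := by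
    intro τ hint hreal hE τ'
    have h30 : τ.int 3 0 = l.length := by rw [hint 3 0 (by simp) (by simp) (by simp), h.len]
    have h87 : τ.int 8 7 = t := by rw [hint 8 7 (by simp) (by simp) (by simp), ht]
    refine ⟨⟨?_, ⟨?_, ?_⟩, ?_, ?_⟩, ?_, ?_⟩
    · simp [τ', Stmt.run, IExpr.eval, reg, State.setInt_int, h30]
    · simpa [τ', Stmt.run, IExpr.eval, reg, State.setInt_int] using hE.len
    · simpa [τ', Stmt.run, IExpr.eval, reg, State.setInt_int, State.setInt_real] using hE.get
    · intro r hr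
      simp only [List.length_append, List.length_singleton] at hr
      simp only [τ', Stmt.run, IExpr.eval, reg, State.setInt_int, h30, h87]
      rcases Nat.lt_succ_iff_lt_or_eq.1 hr with h' | rfl
      · have hne : (r : ℤ) ≠ l.length := by omega
        rw [List.getElem_append_left h', ← h.tag r h']
        simp [hne, hint]
      · simp
    · intro i' hi'
      have h7 : ∀ x, τ.int 7 x = σ.int 7 x := fun x => hint 7 x (by simp) (by simp) (by simp)
      simp only [τ', Stmt.run, IExpr.eval, reg, State.setInt_int, h30, h87]
      rw [List.countP_append, List.countP_singleton]
      by_cases hit : i' = t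
      · subst hit
        simp [h7, h.cnt i' hi']
      · have hne : (i' : ℤ) ≠ t := by omega
        simp [hne, h7, h.cnt i' hi', Ne.symm hit]
    · intro a ha x
      have h3 : a ≠ 3 := by omega
      have h6 : a ≠ 6 := by omega
      have h7 : a ≠ 7 := by omega
      simp only [τ', Stmt.run, State.setInt_int]
      simp only [h3, h6, h7, false_and, if_false]
      exact hint a x (by omega) (by omega) (by omega)
    · intro a ha x
      simp only [τ', Stmt.run, State.setInt_real]
      exact hreal a x ha
  rw [entries_concat] at key
  have e1 := fun c => stable_reg_fst c
  have e2 := fun c => stable_reg_snd c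
  cases k with
  | fst =>
    refine key _ ?_ ?_ ?_
    · intro a x h4 h5 h3
      simp only [Stmt.run]
      rw [run_push_int _ h4 h5 h3, run_push_int _ h4 h5 h3]
    · intro a x h3
      simp only [Stmt.run]
      rw [run_push_real _ h3, run_push_real _ h3]
    · simp only [Stmt.run]
      have := run_push_entries (run_push_entries h.ents (e1 c) stable_mult h.len (c := 2 * i)
        (w := mu) ?_ ?_) (e1 c') stable_neg_mult (r := l.length) (c := 2 * j) (w := -mu) ?_ ?_ ?_
      · simpa [Eqn.cols, Kind.cols] using this
      all_goals simp [RExpr.eval, IExpr.eval, reg, run_push_int, run_push_real, h.len, *]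
  | snd =>
    refine key _ ?_ ?_ ?_
    · intro a x h4 h5 h3
      simp only [Stmt.run]
      rw [run_push_int _ h4 h5 h3, run_push_int _ h4 h5 h3]
    · intro a x h3
      simp only [Stmt.run]
      rw [run_push_real _ h3, run_push_real _ h3]
    · simp only [Stmt.run]
      have := run_push_entries (run_push_entries h.ents (e2 c) stable_mult h.len (c := 2 * i + 1)
        (w := mu) ?_ ?_) (e2 c') stable_neg_mult (r := l.length) (c := 2 * j + 1) (w := -mu)
        ?_ ?_ ?_
      · simpa [Eqn.cols, Kind.cols] using this
      all_goals simp [RExpr.eval, IExpr.eval, reg, run_push_int, run_push_real, h.len, *]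
  | diff =>
    refine key _ ?_ ?_ ?_
    · intro a x h4 h5 h3
      simp only [Stmt.run]
      rw [run_push_int _ h4 h5 h3, run_push_int _ h4 h5 h3, run_push_int _ h4 h5 h3,
        run_push_int _ h4 h5 h3]
    · intro a x h3
      simp only [Stmt.run]
      rw [run_push_real _ h3, run_push_real _ h3, run_push_real _ h3, run_push_real _ h3]
    · simp only [Stmt.run]
      have := run_push_entries (run_push_entries (run_push_entries (run_push_entries h.ents
        (e1 c) stable_mult h.len (c := 2 * i) (w := mu) ?_ ?_)
        (e2 c) stable_neg_mult (r := l.length) (c := 2 * i + 1) (w := -mu) ?_ ?_ ?_)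
        (e1 c') stable_neg_mult (r := l.length) (c := 2 * j) (w := -mu) ?_ ?_ ?_)
        (e2 c') stable_mult (r := l.length) (c := 2 * j + 1) (w := mu) ?_ ?_ ?_
      · simpa [Eqn.cols, Kind.cols] using this
      all_goals simp [RExpr.eval, IExpr.eval, reg, run_push_int, run_push_real, h.len, *]

/-! ### Writing gadgets to the output -/

/-- The memory holds the system `l` on `nb` blocks and the accumulators. -/
structure HoldsWork (σ : State) (m : ℕ) (l : List Eqn) (nb : ℕ) (acc : ℕ → ℕ) : Prop where
  sys : HoldsSystem σ m l
  nb : σ.int 8 8 = nb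
  acc : ∀ i < m, σ.int 9 (i : ℕ) = acc i

/-- Load the blocks of a gadget into the registers. -/
def loadBlocks : Stmt :=
  .setInt 8 (.const 0) (reg 8) ;;
  .setInt 8 (.const 1) (.add (reg 8) (.const 1)) ;;
  .setInt 8 (.const 2) (.add (reg 8) (.const 2)) ;;
  .setInt 8 (.const 3) (.add (reg 8) (.const 3)) ;;
  .setInt 8 (.const 6) (.get 9 (reg 7))

/-- Update the accumulator and the number of blocks after a gadget. -/
def storeBlocks : Stmt :=
  .setInt 9 (reg 7) (reg 3) ;;
  .setInt 8 (.const 8) (.add (reg 8) (.const 4))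

/-- Append a gadget to the output, for the blocks in the registers 4, 5 and the row in
register 7. -/
def emitGadget : Stmt :=
  loadBlocks ;;
  emit .fst 4 0 ;; emit .fst 1 5 ;; emit .diff 0 1 ;; emit .fst 2 6 ;; emit .snd 0 2 ;;
  emit .snd 3 1 ;; emit .diff 3 2 ;;
  storeBlocks

theorem emitGadget_loopFree : emitGadget.LoopFree := by
  simp [emitGadget, loadBlocks, storeBlocks, Stmt.LoopFree, emit_loopFree]

/-- The memory outside of the output and of the registers below 9 is unchanged. -/
def SameInput (σ σ' : State) : Prop :=
  (∀ a < 3, ∀ x, σ'.int a x = σ.int a x) ∧ (∀ x, 9 ≤ x → σ'.int 8 x = σ.int 8 x) ∧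
    ∀ a ≠ 3, ∀ x, σ'.real a x = σ.real a x

theorem HoldsSystem.congr {σ σ' : State} {m : ℕ} {l : List Eqn} (h : HoldsSystem σ m l)
    (h1 : ∀ a, 3 ≤ a → a ≤ 7 → ∀ x, σ'.int a x = σ.int a x) (h2 : ∀ x, σ'.real 3 x = σ.real 3 x) :
    HoldsSystem σ' m l := by
  refine ⟨?_, ⟨?_, ?_⟩, ?_, ?_⟩
  · rw [h1 3 (by omega) (by omega), h.len]
  · rw [h1 3 (by omega) (by omega), h.ents.len]
  · intro t ht
    rw [h1 4 (by omega) (by omega), h1 5 (by omega) (by omega), h2]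
    exact h.ents.get t ht
  · intro r hr
    rw [h1 6 (by omega) (by omega), h.tag r hr]
  · intro i hi
    rw [h1 7 (by omega) (by omega), h.cnt i hi]

theorem run_emitGadget {σ : State} {m : ℕ} {l : List Eqn} {nb : ℕ} {acc : ℕ → ℕ}
    (h : HoldsWork σ m l nb acc) {a b i : ℕ} {mu : ℝ} (ha : σ.int 8 4 = a) (hb : σ.int 8 5 = b)
    (hi : σ.int 8 7 = i) (him : i < m) (hmu : σ.real 6 0 = mu) :
    HoldsWork (emitGadget.run σ) m (l ++ gadget (acc i) a b nb mu i) (nb + 4)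
      (Function.update acc i (nb + 3)) ∧ SameInput σ (emitGadget.run σ) := by
  have hnb := h.nb
  have hacc := h.acc i him
  simp only [emitGadget, Stmt.run]
  set σ₀ := loadBlocks.run σ with hσ₀
  have regs : ∀ x, σ₀.int 8 x = if x = 6 then (acc i : ℤ) else if x = 3 then nb + 3 else
      if x = 2 then nb + 2 else if x = 1 then nb + 1 else if x = 0 then nb else σ.int 8 x := by
    intro x
    simp [hσ₀, loadBlocks, Stmt.run, IExpr.eval, reg, State.setInt_int, hnb, hi, hacc]
  have hint : ∀ a' ≠ 8, ∀ x, σ₀.int a' x = σ.int a' x := by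
    intro a' ha' x
    simp [hσ₀, loadBlocks, Stmt.run, State.setInt_int, ha']
  have hreal : ∀ a' x, σ₀.real a' x = σ.real a' x := by
    intro a' x
    simp [hσ₀, loadBlocks, Stmt.run, State.setInt_real]
  have h₀ : HoldsSystem σ₀ m l :=
    h.sys.congr (fun a' _ _ x => hint a' (by omega) x) (hreal 3)
  -- Emitting leaves the registers alone, so the block numbers loaded in `σ₀` serve all seven
  -- equations.
  have step : ∀ {τ : State} {l' : List Eqn}, HoldsSystem τ m l' ∧ SameRest σ₀ τ → ∀ (k : Kind)
      {c c' : ℤ} {b₁ b₂ : ℕ}, σ₀.int 8 c = b₁ → σ₀.int 8 c' = b₂ →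
      HoldsSystem ((emit k c c').run τ) m (l' ++ [⟨k, b₁, b₂, mu, i⟩]) ∧
        SameRest σ₀ ((emit k c c').run τ) := by
    rintro τ l' ⟨h1, h2⟩ k c c' b₁ b₂ hb₁ hb₂
    have := run_emit h1 k (c := c) (c' := c') (i := b₁) (j := b₂) (t := i) (mu := mu)
      (by rw [h2.1 8 (by omega), hb₁]) (by rw [h2.1 8 (by omega), hb₂])
      (by rw [h2.1 8 (by omega), regs]; simpa using hi) him
      (by rw [h2.2 6 (by omega), hreal, hmu])
    exact ⟨this.1, h2.trans this.2⟩
  have e0 : σ₀.int 8 0 = nb := by simp [regs]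
  have e1 : σ₀.int 8 1 = (nb + 1 : ℕ) := by simp [regs]
  have e2 : σ₀.int 8 2 = (nb + 2 : ℕ) := by simp [regs]
  have e3 : σ₀.int 8 3 = (nb + 3 : ℕ) := by simp [regs]
  have e4 : σ₀.int 8 4 = a := by simp [regs, ha]
  have e5 : σ₀.int 8 5 = b := by simp [regs, hb]
  have e6 : σ₀.int 8 6 = acc i := by simp [regs]
  obtain ⟨g1, g2⟩ := step (step (step (step (step (step (step
    ⟨h₀, fun _ _ _ => rfl, fun _ _ _ => rfl⟩ .fst e4 e0) .fst e1 e5) .diff e0 e1) .fst e2 e6)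
    .snd e0 e2) .snd e3 e1) .diff e3 e2
  generalize (emit .diff 3 2).run _ = τ at g1 g2
  have t8 : ∀ x, τ.int 8 x = σ₀.int 8 x := g2.1 8 (by omega)
  have t7 : τ.int 8 7 = i := by rw [t8, regs]; simpa using hi
  have t3 : τ.int 8 3 = (nb + 3 : ℕ) := by rw [t8, e3]
  have tn : τ.int 8 8 = nb := by rw [t8, regs]; simpa using hnb
  refine ⟨⟨?_, ?_, ?_⟩, ?_, ?_, ?_⟩
  · have g3 : HoldsSystem τ m (l ++ gadget (acc i) a b nb mu i) := by
      simpa [gadget] using g1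
    refine g3.congr (fun a' h1 h2 x => ?_) (fun x => ?_)
    · have h8 : a' ≠ 8 := by omega
      have h9 : a' ≠ 9 := by omega
      simp [storeBlocks, Stmt.run, State.setInt_int, h8, h9]
    · simp [storeBlocks, Stmt.run, State.setInt_real]
  · simp [storeBlocks, Stmt.run, IExpr.eval, reg, State.setInt_int, tn]
  · intro i' hi'
    simp only [storeBlocks, Stmt.run, IExpr.eval, reg, State.setInt_int, t7, t3]
    by_cases hii : i' = i
    · subst hii; simp
    · have hne : (i' : ℤ) ≠ i := by omega
      rw [Function.update_of_ne hii]
      simp only [hne, and_false, if_false, Nat.reduceEqDiff, false_and]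
      rw [g2.1 9 (by omega), hint 9 (by omega), h.acc i' hi']
  · intro a' h3 x
    have h8 : a' ≠ 8 := by omega
    have h9 : a' ≠ 9 := by omega
    simp only [storeBlocks, Stmt.run, State.setInt_int, h8, h9, false_and, if_false]
    rw [g2.1 a' (by omega), hint a' h8]
  · intro x hx
    have h1 : x ≠ 8 := by omega
    simp only [storeBlocks, Stmt.run, IExpr.eval, State.setInt_int, h1, and_false, if_false,
      Nat.reduceEqDiff, false_and]
    rw [t8, regs, if_neg (by omega), if_neg (by omega), if_neg (by omega), if_neg (by omega),
      if_neg (by omega)]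
  · intro a' h3 x
    simp only [storeBlocks, Stmt.run, State.setInt_real]
    rw [g2.2 a' h3, hreal]

theorem HoldsWork.congr {σ σ' : State} {m : ℕ} {l : List Eqn} {nb : ℕ} {acc : ℕ → ℕ}
    (h : HoldsWork σ m l nb acc) (h1 : ∀ a, 3 ≤ a → a ≠ 8 → ∀ x, σ'.int a x = σ.int a x)
    (h8 : σ'.int 8 8 = σ.int 8 8) (h2 : ∀ x, σ'.real 3 x = σ.real 3 x) :
    HoldsWork σ' m l nb acc := by
  refine ⟨h.sys.congr (fun a h3 _ => h1 a h3 (by omega)) h2, by rw [h8, h.nb], fun i hi => ?_⟩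
  rw [h1 9 (by omega) (by omega), h.acc i hi]

end LinSys

namespace LinSys

open RealRAM

/-! ### The program -/

/-- The memory holds the given instance. -/
structure HoldsInput (σ : State) (d : Data) (c : ℕ → ℝ) (ε : ℝ) : Prop where
  m : σ.int 0 0 = d.m
  n : σ.int 0 1 = d.n
  s : σ.int 0 2 = d.s
  row : ∀ k < d.s, σ.int 1 (k : ℕ) = d.row k
  col : ∀ k < d.s, σ.int 2 (k : ℕ) = d.col k
  ent : ∀ k < d.s, σ.real 0 (k : ℕ) = d.ent k
  rhs : ∀ i < d.m, σ.real 1 (i : ℕ) = c i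
  eps : σ.real 2 0 = ε

theorem HoldsInput.congr {σ σ' : State} {d : Data} {c : ℕ → ℝ} {ε : ℝ} (h : HoldsInput σ d c ε)
    (h1 : ∀ a < 3, ∀ x, σ'.int a x = σ.int a x) (h2 : ∀ a < 3, ∀ x, σ'.real a x = σ.real a x) :
    HoldsInput σ' d c ε := by
  refine ⟨?_, ?_, ?_, fun k hk => ?_, fun k hk => ?_, fun k hk => ?_, fun k hk => ?_, ?_⟩
  · rw [h1 0 (by omega), h.m]
  · rw [h1 0 (by omega), h.n]
  · rw [h1 0 (by omega), h.s]
  · rw [h1 1 (by omega), h.row k hk]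
  · rw [h1 2 (by omega), h.col k hk]
  · rw [h2 0 (by omega), h.ent k hk]
  · rw [h2 1 (by omega), h.rhs k hk]
  · rw [h2 2 (by omega), h.eps]

/-- Increment the loop counter. -/
def tick : Stmt := .setInt 8 (.const 10) (.add (reg 10) (.const 1))

/-- Reset the loop counter. -/
def reset : Stmt := .setInt 8 (.const 10) (.const 0)

/-- The loop counter is a row of the given matrix. -/
def rowTest : BExpr := .ilt (reg 10) (.get 0 (.const 0))

/-- The loop counter is an entry of the given matrix. -/
def entTest : BExpr := .ilt (reg 10) (.get 0 (.const 2))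

/-- Initialize the output and the registers. -/
def initRegs : Stmt :=
  .setInt 3 (.const 0) (.const 0) ;;
  .setInt 3 (.const 2) (.const 0) ;;
  .setInt 8 (.const 8) (.get 0 (.const 1)) ;;
  .setInt 8 (.const 9) (.const 0) ;;
  .setReal 6 (.const 0) (.const 1) ;;
  reset

/-- Initialize the accumulator and the equation count of a row. -/
def initRow : Stmt :=
  .setInt 9 (reg 10) (.const 0) ;; .setInt 7 (reg 10) (.const 0) ;; tick

/-- Copy an entry. -/
def copyEntry : Stmt := .setReal 7 (reg 10) (.get 0 (reg 10)) ;; tick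

/-- Double the multiplier unless it exceeds the absolute value of the current entry. -/
def scaleStep : Stmt :=
  .cond (.and (.rlt (.get 0 (reg 10)) (.get 6 (.const 0)))
      (.rlt (.sub (.const 0) (.get 0 (reg 10))) (.get 6 (.const 0))))
    tick
    (.setReal 6 (.const 0) (.add (.get 6 (.const 0)) (.get 6 (.const 0))) ;;
      .setInt 8 (.const 9) (.add (reg 9) (.const 1)))

/-- Double the accumulator of a row. -/
def doubleRow : Stmt :=
  (.setInt 8 (.const 4) (.const 0) ;; .setInt 8 (.const 5) (.get 9 (reg 10)) ;;
    .setInt 8 (.const 7) (reg 10)) ;;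
  emitGadget ;; tick

/-- Choose the variables whose difference is added to an accumulator. -/
def chooseBit : Stmt :=
  .setInt 8 (.const 7) (.get 1 (reg 10)) ;;
  .setInt 8 (.const 4) (.const 0) ;;
  .setInt 8 (.const 5) (.const 0) ;;
  .cond (.rlt (.get 7 (reg 10)) (.get 6 (.const 0)))
    (.cond (.rlt (.sub (.const 0) (.get 7 (reg 10))) (.get 6 (.const 0)))
      .skip
      (.setInt 8 (.const 5) (.get 2 (reg 10)) ;;
        .setReal 7 (reg 10) (.add (.get 7 (reg 10)) (.get 6 (.const 0)))))
    (.setInt 8 (.const 4) (.get 2 (reg 10)) ;;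
      .setReal 7 (reg 10) (.sub (.get 7 (reg 10)) (.get 6 (.const 0))))

/-- Process the current binary digit of an entry. -/
def addEntry : Stmt := chooseBit ;; emitGadget ;; tick

/-- Go to the next binary digit. -/
def nextLevel : Stmt :=
  .setInt 8 (.const 9) (.sub (reg 9) (.const 1)) ;;
  .setReal 6 (.const 0) (.div (.get 6 (.const 0)) (.const 2)) ;;
  reset

/-- Process one binary digit of all entries. -/
def level : Stmt :=
  nextLevel ;; .loop rowTest doubleRow ;; reset ;; .loop entTest addEntry

/-- Append the final equation of a row. -/
def finalRow : Stmt :=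
  (.setInt 8 (.const 4) (.const 0) ;; .setInt 8 (.const 6) (.get 9 (reg 10)) ;;
    .setInt 8 (.const 7) (reg 10)) ;;
  emit .fst 4 6 ;; tick

/-- Multiply an output entry by its weight. -/
def weightEntry : Stmt :=
  .setReal 3 (reg 10)
    (.mul (.get 3 (reg 10)) (.sqrt (.ofInt (.get 7 (.get 6 (.get 4 (reg 10))))))) ;; tick

/-- Write an entry of the right-hand side. -/
def writeRhs : Stmt :=
  .setReal 4 (reg 10) (.div (.get 1 (.get 6 (reg 10)))
    (.sqrt (.ofInt (.get 7 (.get 6 (reg 10)))))) ;; tick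

/-- Initialization. -/
def prepare : Stmt :=
  initRegs ;; .loop rowTest initRow ;; reset ;; .loop entTest copyEntry ;; reset ;;
  .loop entTest scaleStep

/-- Output of the weights, the right-hand side and the precision. -/
def finish : Stmt :=
  reset ;; .loop rowTest finalRow ;;
  (.setInt 3 (.const 1) (.mul (.const 2) (reg 8)) ;; reset) ;;
  .loop (.ilt (reg 10) (.get 3 (.const 2))) weightEntry ;;
  reset ;;
  .loop (.ilt (reg 10) (.get 3 (.const 0))) writeRhs ;;
  .setReal 5 (.const 0) (.get 2 (.const 0))

/-- The program that maps an instance to a 2-commodity instance. -/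
def forward : Stmt := prepare ;; .loop (.ilt (.const 0) (reg 9)) level ;; finish

/-! ### Initialization and the number of binary digits -/

section prepare

variable {d : Data} {c : ℕ → ℝ} {ε : ℝ}

/-- The memory after the preparation: the multiplier is `2 ^ L`. -/
structure Prepared (d : Data) (c : ℕ → ℝ) (ε : ℝ) (σ : State) (L : ℕ) : Prop where
  inp : HoldsInput σ d c ε
  work : HoldsWork σ d.m [] d.n fun _ => 0
  level : σ.int 8 9 = L
  mult : σ.real 6 0 = 2 ^ L
  rem : ∀ k < d.s, σ.real 7 (k : ℕ) = d.ent k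

/-- `L` is found by doubling a real multiplier until it exceeds every entry. The multiplier is never
reset between entries, so the loop takes at most `d.s + (log₂ Z + 1)` rounds, a sum rather than a
product. -/
theorem runs_prepare {σ : State} (hσ : HoldsInput σ d c ε) {Z : ℕ}
    (hZ : ∀ k < d.s, (d.ent k).natAbs ≤ Z) :
    Runs prepare σ (initRegs.maxCost + (d.m * (initRow.maxCost + rowTest.cost) + rowTest.cost +
        (reset.maxCost + (d.s * (copyEntry.maxCost + entTest.cost) + entTest.cost +
        (reset.maxCost + ((d.s + (Nat.log 2 Z + 1)) * (scaleStep.maxCost + entTest.cost)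
          + entTest.cost)))))) fun τ => ∃ L ≤ Nat.log 2 Z + 1, Prepared d c ε τ L ∧
      ∀ k < d.s, |d.ent k| < 2 ^ L := by
  -- initialization of the registers
  refine Runs.seq (Q := fun τ => HoldsInput τ d c ε ∧ τ.int 3 0 = 0 ∧ τ.int 3 2 = 0 ∧
    τ.int 8 8 = d.n ∧ τ.int 8 9 = 0 ∧ τ.real 6 0 = 1 ∧ τ.int 8 10 = 0) ?_ ?_
  · refine Stmt.LoopFree.runs (by simp [initRegs, reset, Stmt.LoopFree]) ⟨?_, ?_⟩
    · refine hσ.congr (fun a ha x => ?_) fun a ha x => ?_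
      · have h3 : a ≠ 3 := by omega
        have h8 : a ≠ 8 := by omega
        simp [initRegs, reset, Stmt.run, State.setInt_int, State.setReal_int, h3, h8]
      · have h6 : a ≠ 6 := by omega
        simp [initRegs, reset, Stmt.run, State.setInt_real, State.setReal_real, h6]
    · simp [initRegs, reset, Stmt.run, State.setInt_int, State.setReal_int, State.setInt_real,
        State.setReal_real, IExpr.eval, RExpr.eval, hσ.n]
  rintro σ ⟨hin, h30, h32, h88, h89, h6, hk⟩
  clear hσ
  -- initialization of the rows
  refine Runs.seq (Q := fun τ => HoldsInput τ d c ε ∧ HoldsWork τ d.m [] d.n (fun _ => 0) ∧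
    τ.int 8 9 = 0 ∧ τ.real 6 0 = 1) ?_ ?_
  · refine (Runs.for (fun k τ => HoldsInput τ d c ε ∧ τ.int 3 0 = 0 ∧ τ.int 3 2 = 0 ∧
      τ.int 8 8 = d.n ∧ τ.int 8 9 = 0 ∧ τ.real 6 0 = 1 ∧ τ.int 8 10 = k ∧
      ∀ i < k, τ.int 9 (i : ℕ) = 0 ∧ τ.int 7 (i : ℕ) = 0) d.m initRow.maxCost ?_ ?_
      (σ := σ) ⟨hin, h30, h32, h88, h89, h6, hk, by simp⟩).mono le_rfl ?_
    · rintro k τ ⟨h, -, -, -, -, -, hk, -⟩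
      simp [rowTest, BExpr.eval, IExpr.eval, reg, hk, h.m]
    · rintro k hkm τ ⟨h, h30, h32, h88, h89, h6, hk, hi⟩
      refine Stmt.LoopFree.runs (by simp [initRow, tick, Stmt.LoopFree]) ⟨?_, ?_⟩
      · refine h.congr (fun a ha x => ?_) fun a ha x => ?_
        · have h7 : a ≠ 7 := by omega
          have h8 : a ≠ 8 := by omega
          have h9 : a ≠ 9 := by omega
          simp [initRow, tick, Stmt.run, State.setInt_int, h7, h8, h9]
        · simp [initRow, tick, Stmt.run, State.setInt_real]
      · simp only [initRow, tick, Stmt.run, State.setInt_int, State.setInt_real, IExpr.eval, reg,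
          hk, h30, h32, h88, h89, h6]
        refine ⟨by simp, by simp, by simp, by simp, by simp, by simp, fun i hik => ?_⟩
        by_cases hik' : i = k
        · subst hik'; simp
        · have hne : (i : ℤ) ≠ k := by omega
          simpa [hne] using hi i (by omega)
    · rintro τ ⟨h, h30, h32, h88, h89, h6, hk, hi⟩
      refine ⟨h, ⟨⟨by simpa using h30, ⟨by simpa [entries] using h32, by simp [entries]⟩, by simp,
        fun i hi' => by simpa using (hi i hi').2⟩, h88, fun i hi' => by simpa using (hi i hi').1⟩,
        h89, h6⟩
  rintro σ ⟨hin, hw, h89, h6⟩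
  clear h30 h32 h88 hk
  refine Runs.seq (Q := fun τ => HoldsInput τ d c ε ∧ HoldsWork τ d.m [] d.n (fun _ => 0) ∧
    τ.int 8 9 = 0 ∧ τ.real 6 0 = 1 ∧ τ.int 8 10 = 0) ?_ ?_
  · refine Stmt.LoopFree.runs (by simp [reset, Stmt.LoopFree]) ⟨?_, ?_, ?_⟩
    · refine hin.congr (fun a ha x => ?_) fun a ha x => rfl
      have h8 : a ≠ 8 := by omega
      simp [reset, Stmt.run, State.setInt_int, h8]
    · refine hw.congr (fun a ha h8 x => ?_) ?_ fun x => rfl <;>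
      simp [reset, Stmt.run, State.setInt_int, IExpr.eval, *]
    · simp [reset, Stmt.run, State.setInt_int, State.setInt_real, IExpr.eval, h89, h6]
  rintro σ ⟨hin, hw, h89, h6, hk⟩
  -- copying the entries
  refine Runs.seq (Q := fun τ => Prepared d c ε τ 0) ?_ ?_
  · refine (Runs.for (fun k τ => HoldsInput τ d c ε ∧ HoldsWork τ d.m [] d.n (fun _ => 0) ∧
      τ.int 8 9 = 0 ∧ τ.real 6 0 = 1 ∧ τ.int 8 10 = k ∧
      ∀ k' < k, τ.real 7 (k' : ℕ) = d.ent k') d.s copyEntry.maxCost ?_ ?_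
      (σ := σ) ⟨hin, hw, h89, h6, hk, by simp⟩).mono le_rfl ?_
    · rintro k τ ⟨h, -, -, -, hk, -⟩
      simp [entTest, BExpr.eval, IExpr.eval, reg, hk, h.s]
    · rintro k hkm τ ⟨h, hw, h89, h6, hk, hi⟩
      refine Stmt.LoopFree.runs (by simp [copyEntry, tick, Stmt.LoopFree]) ⟨?_, ?_, ?_⟩
      · refine h.congr (fun a ha x => ?_) fun a ha x => ?_
        · have h8 : a ≠ 8 := by omega
          simp [copyEntry, tick, Stmt.run, State.setInt_int, State.setReal_int, h8]
        · have h7 : a ≠ 7 := by omega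
          simp [copyEntry, tick, Stmt.run, State.setInt_real, State.setReal_real, h7]
      · refine hw.congr (fun a ha h8 x => ?_) ?_ fun x => ?_ <;>
        simp [copyEntry, tick, Stmt.run, State.setInt_int, State.setReal_int, State.setReal_real,
          State.setInt_real, IExpr.eval, *]
      · simp only [copyEntry, tick, Stmt.run, State.setInt_int, State.setInt_real, IExpr.eval, reg,
          State.setReal_int, State.setReal_real, RExpr.eval, hk, h89, h6]
        refine ⟨by simp, by simp, by simp, fun i hik => ?_⟩
        by_cases hik' : i = k
        · subst hik'; simp [h.ent i hkm]
        · have hne : (i : ℤ) ≠ k := by omega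
          simpa [hne] using hi i (by omega)
    · rintro τ ⟨h, hw, h89, h6, hk, hi⟩
      exact ⟨h, hw, by simpa using h89, by simpa using h6, hi⟩
  intro σ hp
  clear hin hw h89 h6 hk
  refine Runs.seq (Q := fun τ => Prepared d c ε τ 0 ∧ τ.int 8 10 = 0) ?_ ?_
  · refine Stmt.LoopFree.runs (by simp [reset, Stmt.LoopFree]) ⟨⟨?_, ?_, ?_, ?_, ?_⟩, ?_⟩
    · refine hp.inp.congr (fun a ha x => ?_) fun a ha x => rfl
      have h8 : a ≠ 8 := by omega
      simp [reset, Stmt.run, State.setInt_int, h8]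
    · refine hp.work.congr (fun a ha h8 x => ?_) ?_ fun x => rfl <;>
      simp [reset, Stmt.run, State.setInt_int, IExpr.eval, *]
    · simpa [reset, Stmt.run, State.setInt_int, IExpr.eval] using hp.level
    · simpa [reset, Stmt.run, State.setInt_real] using hp.mult
    · exact hp.rem
    · simp [reset, Stmt.run, State.setInt_int, IExpr.eval]
  rintro σ ⟨hp, hk⟩
  -- computation of the number of binary digits
  have key := Runs.loop (b := entTest) (p := scaleStep)
    (fun τ => ∃ L k : ℕ, L ≤ Nat.log 2 Z + 1 ∧ k ≤ d.s ∧ Prepared d c ε τ L ∧ τ.int 8 10 = k ∧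
      ∀ k' < k, |d.ent k'| < 2 ^ L)
    (fun τ => (d.s - (τ.int 8 10).toNat) + (Nat.log 2 Z + 1 - (τ.int 8 9).toNat))
    scaleStep.maxCost ?_ (σ := σ) ⟨0, 0, by omega, by omega, hp, hk, by simp⟩
  · refine key.mono ?_ ?_
    · rw [hk, hp.level]
      simp
    · rintro τ ⟨⟨L, k, hL, hks, hP, hk, hi⟩, hb⟩
      have hks' : k = d.s := by
        simp [entTest, BExpr.eval, IExpr.eval, reg, hk, hP.inp.s] at hb
        omega
      subst hks'
      exact ⟨L, hL, hP, hi⟩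
  rintro τ ⟨L, k, hL, hks, hP, hk, hi⟩ hb
  have hks' : k < d.s := by
    simpa [entTest, BExpr.eval, IExpr.eval, reg, hk, hP.inp.s] using hb
  refine Stmt.LoopFree.runs (by simp [scaleStep, tick, Stmt.LoopFree]) ?_
  have hev : (BExpr.and (.rlt (.get 0 (reg 10)) (.get 6 (.const 0)))
      (.rlt (.sub (.const 0) (.get 0 (reg 10))) (.get 6 (.const 0)))).eval τ ↔
      |d.ent k| < 2 ^ L := by
    simp only [BExpr.eval, RExpr.eval, IExpr.eval, reg, hk, hP.mult, hP.inp.ent k hks']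
    rw [abs_lt]
    constructor
    · rintro ⟨h1, h2⟩
      have h1' : d.ent k < 2 ^ L := by exact_mod_cast h1
      have h2' : 0 - d.ent k < 2 ^ L := by exact_mod_cast h2
      constructor <;> linarith
    · rintro ⟨h1, h2⟩
      have h1' : 0 - d.ent k < 2 ^ L := by linarith
      exact ⟨by exact_mod_cast h2, by exact_mod_cast h1'⟩
  by_cases hlt : |d.ent k| < 2 ^ L
  · simp only [scaleStep, Stmt.run, if_pos (hev.2 hlt)]
    refine ⟨⟨L, k + 1, hL, hks', ⟨?_, ?_, ?_, ?_, ?_⟩, ?_, ?_⟩, ?_⟩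
    · refine hP.inp.congr (fun a ha x => ?_) fun a ha x => rfl
      have h8 : a ≠ 8 := by omega
      simp [tick, Stmt.run, State.setInt_int, h8]
    · refine hP.work.congr (fun a ha h8 x => ?_) ?_ fun x => rfl <;>
      simp [tick, Stmt.run, State.setInt_int, IExpr.eval, *]
    · simpa [tick, Stmt.run, State.setInt_int, IExpr.eval] using hP.level
    · exact hP.mult
    · exact hP.rem
    · simp [tick, Stmt.run, State.setInt_int, IExpr.eval, reg, hk]
    · intro k' hk'
      by_cases h : k' = k
      · subst h; exact hlt
      · exact hi k' (by omega)
    · simp [tick, Stmt.run, State.setInt_int, IExpr.eval, reg, hk, hP.level]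
      omega
  · simp only [scaleStep, Stmt.run, if_neg (mt hev.1 hlt)]
    -- A doubling happens only if `2 ^ L ≤ |d.ent k| ≤ Z`, so `L` can reach `log₂ Z + 1` but not
    -- exceed it.
    have hL' : L < Nat.log 2 Z + 1 := by
      have h1 : 2 ^ L ≤ Z := by
        refine le_trans ?_ (hZ k hks')
        push Not at hlt
        zify
        exact hlt
      have := Nat.le_log_of_pow_le (by norm_num) h1
      omega
    refine ⟨⟨L + 1, k, hL', hks, ⟨?_, ?_, ?_, ?_, ?_⟩, ?_, ?_⟩, ?_⟩
    · refine hP.inp.congr (fun a ha x => ?_) fun a ha x => ?_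
      · have h8 : a ≠ 8 := by omega
        simp [State.setInt_int, State.setReal_int, h8]
      · have h6 : a ≠ 6 := by omega
        simp [State.setInt_real, State.setReal_real, h6]
    · refine hP.work.congr (fun a ha h8 x => ?_) ?_ fun x => ?_ <;>
      simp [State.setInt_int, State.setReal_int, State.setInt_real, State.setReal_real,
        IExpr.eval, *]
    · simp [State.setInt_int, State.setReal_int, IExpr.eval, reg, hP.level]
    · simp only [State.setInt_real, State.setReal_real, IExpr.eval, RExpr.eval, hP.mult, and_self,
        if_true]
      ring
    · intro k' hk'
      simp [State.setInt_real, State.setReal_real, hP.rem k' hk']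
    · simp [State.setInt_int, State.setReal_int, IExpr.eval, hk]
    · intro k' hk'
      refine (hi k' hk').trans_le (pow_le_pow_right₀ (by norm_num) (by omega))
    · simp [State.setInt_int, State.setReal_int, IExpr.eval, reg, hk, hP.level]
      omega

end prepare

end LinSys

namespace LinSys

open RealRAM

/-! ### The main loop: one binary digit of all entries per round -/

section level

variable {d : Data} {c : ℕ → ℝ} {ε M : ℝ}

/-- The memory during the main loop, after `q` gadgets; the multiplier is `p`. -/
structure Running (d : Data) (c : ℕ → ℝ) (ε M : ℝ) (σ : State) (l : List Eqn) (q L : ℕ) (p : ℤ)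
    (acc : ℕ → ℕ) (P rem : ℕ → ℤ) : Prop where
  inp : HoldsInput σ d c ε
  work : HoldsWork σ d.m l (d.n + 4 * q) acc
  inv : d.Inv M l (d.n + 4 * q) acc P rem
  len : l.length = 7 * q
  level : σ.int 8 9 = L
  mult : σ.real 6 0 = p
  rem : ∀ k < d.s, σ.real 7 (k : ℕ) = rem k

theorem run_emitGadget_tick {σ : State} {l : List Eqn} {nb L j : ℕ} {acc : ℕ → ℕ}
    {p : ℤ} (hin : HoldsInput σ d c ε) (h : HoldsWork σ d.m l nb acc) {a b i : ℕ}
    (ha : σ.int 8 4 = a) (hb : σ.int 8 5 = b) (hi : σ.int 8 7 = i) (him : i < d.m)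
    (hmu : σ.real 6 0 = p) (hL : σ.int 8 9 = L) (hj : σ.int 8 10 = j) :
    let τ := tick.run (emitGadget.run σ)
    HoldsInput τ d c ε ∧ HoldsWork τ d.m (l ++ gadget (acc i) a b nb p i) (nb + 4)
      (Function.update acc i (nb + 3)) ∧ τ.int 8 9 = L ∧ τ.real 6 0 = p ∧ τ.int 8 10 = (j + 1 : ℕ) ∧
      ∀ x, τ.real 7 x = σ.real 7 x := by
  obtain ⟨h1, h2, h3, h4⟩ := run_emitGadget h ha hb hi him hmu
  generalize emitGadget.run σ = τ at h1 h2 h3 h4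
  refine ⟨hin.congr (fun a ha x => ?_) fun a ha x => ?_, h1.congr (fun a ha h8 x => ?_) ?_ ?_,
    ?_, ?_, ?_, ?_⟩
  · have h8 : a ≠ 8 := by omega
    simp [tick, Stmt.run, State.setInt_int, h8, h2 a ha]
  · simp [tick, Stmt.run, State.setInt_real, h4 a (by omega)]
  · simp [tick, Stmt.run, State.setInt_int, h8]
  · simp [tick, Stmt.run, State.setInt_int, IExpr.eval]
  · simp [tick, Stmt.run, State.setInt_real]
  · simp [tick, Stmt.run, State.setInt_int, IExpr.eval, h3, hL]
  · simp [tick, Stmt.run, State.setInt_real, h4, hmu]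
  · simp [tick, Stmt.run, State.setInt_int, IExpr.eval, reg, h3, hj]
  · simp [tick, Stmt.run, State.setInt_real, h4]

theorem doubleRow_loopFree : doubleRow.LoopFree := by
  simp [doubleRow, tick, Stmt.LoopFree, emitGadget_loopFree]

theorem run_doubleRow {σ : State} {l : List Eqn} {q L i : ℕ} {acc : ℕ → ℕ} {p : ℤ}
    {P rem : ℕ → ℤ} (h : Running d c ε M σ l q L p acc P rem) (hi : σ.int 8 10 = i) (him : i < d.m)
    (hp : 1 ≤ p) (hpM : (p : ℝ) ≤ M) (hP : P i = 2 * p) :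
    (∃ l' acc', Running d c ε M (doubleRow.run σ) l' (q + 1) L p acc' (Function.update P i p) rem ∧
      acc' i ≠ 0 ∧ ∀ i' ≠ i, acc' i' = acc i') ∧ (doubleRow.run σ).int 8 10 = (i + 1 : ℕ) := by
  have hacc := h.work.acc i him
  simp only [doubleRow, Stmt.run]
  set σ₀ : State := ((σ.setInt 8 _ _).setInt 8 _ _).setInt 8 _ _ with hσ₀
  have hint : ∀ a ≠ 8, ∀ x, σ₀.int a x = σ.int a x := by
    intro a ha x
    simp [hσ₀, State.setInt_int, ha]
  obtain ⟨h1, h2, h3, h4, h5, h6⟩ := run_emitGadget_tick (σ := σ₀) (a := 0) (b := acc i) (i := i)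
    (j := i) (p := p) (L := L)
    (h.inp.congr (fun a ha x => hint a (by omega) x) fun a ha x => rfl)
    (h.work.congr (fun a _ h8 x => hint a h8 x)
      (by simp [hσ₀, State.setInt_int, IExpr.eval]) fun x => rfl)
    (by simp [hσ₀, State.setInt_int, IExpr.eval])
    (by simp [hσ₀, State.setInt_int, IExpr.eval, reg, hi, hacc])
    (by simp [hσ₀, State.setInt_int, IExpr.eval, reg, hi]) him h.mult
    (by simp [hσ₀, State.setInt_int, IExpr.eval, h.level])
    (by simp [hσ₀, State.setInt_int, IExpr.eval, hi])
  refine ⟨⟨_, _, ⟨h1, h2, h.inv.double him hp hpM hP, ?_, h3, h4, ?_⟩, ?_, ?_⟩, h5⟩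
  · simp [gadget, h.len]; ring
  · intro k hk
    rw [h6]; exact h.rem k hk
  · simp
  · intro i' hi'
    rw [Function.update_of_ne hi']

/-- The triple consists of the signed digit and the blocks `a`, `b` of the next gadget. Two real
comparisons determine the digit: 1 if `p ≤ r`, -1 if `p ≤ -r`, and 0 otherwise. The digit 0 also
gets a gadget, with `a = b = 0`, so the number of gadgets depends only on `m`, `s` and `L`. -/
theorem chooseBit_spec {σ : State} {k : ℕ} {r p : ℤ} (hk : σ.int 8 10 = k)
    (hr : σ.real 7 (k : ℕ) = r) (hp : σ.real 6 0 = p) :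
    let τ := chooseBit.run σ
    ∃ σz : ℤ × ℤ × ℤ, (∀ a ≠ 8, ∀ x, τ.int a x = σ.int a x) ∧
      (∀ x, 8 ≤ x → τ.int 8 x = σ.int 8 x) ∧ (∀ a ≠ 7, ∀ x, τ.real a x = σ.real a x) ∧
      (∀ x ≠ (k : ℤ), τ.real 7 x = σ.real 7 x) ∧ τ.int 8 7 = σ.int 1 k ∧
      τ.int 8 4 = σz.2.1 ∧ τ.int 8 5 = σz.2.2 ∧ τ.real 7 k = (r + -σz.1 * p : ℤ) ∧
      ((σz.1 = 1 ∧ σz.2.1 = σ.int 2 k ∧ σz.2.2 = 0 ∧ p ≤ r) ∨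
       (σz.1 = -1 ∧ σz.2.1 = 0 ∧ σz.2.2 = σ.int 2 k ∧ p ≤ -r ∧ r < p) ∨
       (σz.1 = 0 ∧ σz.2.1 = 0 ∧ σz.2.2 = 0 ∧ r < p ∧ -r < p)) := by
  intro τ
  by_cases h1 : r < p
  · by_cases h2 : -r < p
    · refine ⟨(0, 0, 0), ?_⟩
      have hτ : τ = ((σ.setInt 8 7 (σ.int 1 k)).setInt 8 4 0).setInt 8 5 0 := by
        simp [τ, chooseBit, Stmt.run, BExpr.eval, RExpr.eval, IExpr.eval, reg, State.setInt_int,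
          State.setInt_real, hk, hr, hp, h1]
        norm_cast
        simp [h2]
      rw [hτ]
      refine ⟨fun a ha x => ?_, fun x hx => ?_, fun a ha x => ?_, fun x hx => ?_, ?_⟩
      · simp [State.setInt_int, ha]
      · have e4 : x ≠ 4 := by omega
        have e5 : x ≠ 5 := by omega
        have e7 : x ≠ 7 := by omega
        simp [State.setInt_int, e4, e5, e7]
      · rfl
      · rfl
      · simp [State.setInt_int, State.setInt_real, hr, h1, h2]
    · refine ⟨(-1, 0, σ.int 2 k), ?_⟩
      have hτ : τ = ((((σ.setInt 8 7 (σ.int 1 k)).setInt 8 4 0).setInt 8 5 0).setInt 8 5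
          (σ.int 2 k)).setReal 7 k (r + p) := by
        simp [τ, chooseBit, Stmt.run, BExpr.eval, RExpr.eval, IExpr.eval, reg, State.setInt_int,
          State.setInt_real, hk, hr, hp, h1]
        norm_cast
        simp [h2]
      rw [hτ]
      refine ⟨fun a ha x => ?_, fun x hx => ?_, fun a ha x => ?_, fun x hx => ?_, ?_⟩
      · simp [State.setInt_int, State.setReal_int, ha]
      · have e4 : x ≠ 4 := by omega
        have e5 : x ≠ 5 := by omega
        have e7 : x ≠ 7 := by omega
        simp [State.setInt_int, State.setReal_int, e4, e5, e7]
      · simp [State.setReal_real, State.setInt_real, ha]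
      · simp [State.setReal_real, State.setInt_real, hx]
      · simp [State.setInt_int, State.setReal_int, State.setReal_real, h1]
        omega
  · refine ⟨(1, σ.int 2 k, 0), ?_⟩
    have hτ : τ = ((((σ.setInt 8 7 (σ.int 1 k)).setInt 8 4 0).setInt 8 5 0).setInt 8 4
        (σ.int 2 k)).setReal 7 k (r - p) := by
      simp [τ, chooseBit, Stmt.run, BExpr.eval, RExpr.eval, IExpr.eval, reg, State.setInt_int,
        State.setInt_real, hk, hr, hp, h1]
    rw [hτ]
    refine ⟨fun a ha x => ?_, fun x hx => ?_, fun a ha x => ?_, fun x hx => ?_, ?_⟩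
    · simp [State.setInt_int, State.setReal_int, ha]
    · have e4 : x ≠ 4 := by omega
      have e5 : x ≠ 5 := by omega
      have e7 : x ≠ 7 := by omega
      simp [State.setInt_int, State.setReal_int, e4, e5, e7]
    · simp [State.setReal_real, State.setInt_real, ha]
    · simp [State.setReal_real, State.setInt_real, hx]
    · simp [State.setInt_int, State.setReal_int, State.setReal_real]
      exact ⟨by ring, by omega⟩

theorem addEntry_loopFree : addEntry.LoopFree := by
  simp [addEntry, chooseBit, tick, Stmt.LoopFree, emitGadget_loopFree]

theorem run_addEntry {σ : State} {l : List Eqn} {q L k : ℕ} {acc : ℕ → ℕ} {p : ℤ}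
    {P rem : ℕ → ℤ} (h : Running d c ε M σ l q L p acc P rem) (hk : σ.int 8 10 = k) (hks : k < d.s)
    (hp : 1 ≤ p) (hpM : (p : ℝ) ≤ M) (hP : ∀ i < d.m, P i = p) (hrem : |rem k| < 2 * p) :
    (∃ l' acc' rem', Running d c ε M (addEntry.run σ) l' (q + 1) L p acc' P rem' ∧
      (∀ i, acc i ≠ 0 → acc' i ≠ 0) ∧ |rem' k| < p ∧ ∀ k' ≠ k, rem' k' = rem k') ∧
      (addEntry.run σ).int 8 10 = (k + 1 : ℕ) := by
  have hrow := d.row_lt k hks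
  simp only [addEntry, Stmt.run]
  obtain ⟨⟨t, u, v⟩, hint, h8, hreal, h7, hi, ha, hb, hr, hcase⟩ :=
    chooseBit_spec hk (h.rem k hks) h.mult
  generalize chooseBit.run σ = σ₀ at hint h8 hreal h7 hi ha hb hr
  simp only [h.inp.col k hks, h.inp.row k hks] at hcase hi ha hb hr
  obtain ⟨a, b, rfl, rfl, hτ, hrem'⟩ : ∃ a b : ℕ, u = a ∧ v = b ∧
      ((t = 1 ∧ a = d.col k ∧ b = 0 ∧ P (d.row k) ≤ rem k) ∨
        (t = -1 ∧ a = 0 ∧ b = d.col k ∧ P (d.row k) ≤ -rem k) ∨ (t = 0 ∧ a = 0 ∧ b = 0)) ∧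
      |rem k + -t * p| < p := by
    rw [abs_lt] at hrem
    -- From `|rem k| < 2p`, removing `±p` whenever `p ≤ |rem k|` leaves less than `p`.
    rcases hcase with ⟨rfl, rfl, rfl, h1⟩ | ⟨rfl, rfl, rfl, h1, h2⟩ | ⟨rfl, rfl, rfl, h1, h2⟩
    · refine ⟨d.col k, 0, rfl, rfl, Or.inl ⟨rfl, rfl, rfl, by rwa [hP _ hrow]⟩, ?_⟩
      rw [abs_lt]; constructor <;> linarith [hrem.1, hrem.2]
    · refine ⟨0, d.col k, rfl, rfl, Or.inr (Or.inl ⟨rfl, rfl, rfl, by rwa [hP _ hrow]⟩), ?_⟩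
      rw [abs_lt]; constructor <;> linarith [hrem.1, hrem.2]
    · refine ⟨0, 0, rfl, rfl, Or.inr (Or.inr ⟨rfl, rfl, rfl⟩), ?_⟩
      rw [abs_lt]; constructor <;> linarith [hrem.1, hrem.2]
  have hPr := hP _ hrow
  have hinv := h.inv.addEntry hks (by rwa [hPr]) hτ
  rw [hPr] at hinv
  obtain ⟨h1, h2, h3, h4, h5, h6⟩ := run_emitGadget_tick (σ := σ₀) (j := k) (p := p) (L := L)
    (h.inp.congr (fun a ha x => hint a (by omega) x) fun a ha x => hreal a (by omega) x)
    (h.work.congr (fun a _ h8 x => hint a h8 x) (h8 8 (by omega)) fun x => hreal 3 (by omega) x)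
    ha hb hi hrow (by rw [hreal 6 (by omega), h.mult]) (by rw [h8 9 (by omega), h.level])
    (by rw [h8 10 (by omega), hk])
  refine ⟨⟨_, _, _, ⟨h1, h2, hinv, ?_, h3, h4, ?_⟩, ?_, ?_, ?_⟩, h5⟩
  · simp [gadget, h.len]; ring
  · intro k' hk'
    rw [h6]
    by_cases hkk : k' = k
    · subst hkk; rw [Function.update_self]; exact hr
    · rw [Function.update_of_ne hkk, h7 _ (by omega), h.rem k' hk']
  · intro i hi
    by_cases hii : i = d.row k
    · subst hii; simp
    · rwa [Function.update_of_ne hii]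
  · rwa [Function.update_self]
  · intro k' hk'
    rw [Function.update_of_ne hk']

/-- A bound for the number of steps of one level. -/
def levelCost (m s : ℕ) : ℕ :=
  nextLevel.maxCost + (m * (doubleRow.maxCost + rowTest.cost) + rowTest.cost +
    (reset.maxCost + (s * (addEntry.maxCost + entTest.cost) + entTest.cost)))

/-- One Horner step: halving the multiplier is compensated by doubling all accumulators, after which
each entry contributes its digit. During the first loop the rows already treated have `P = p` and
the others `2 * p`; during the second the same split holds for the bounds on `rem`. -/
theorem runs_level {σ : State} {l : List Eqn} {q L : ℕ} {acc : ℕ → ℕ} {p : ℤ}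
    {P rem : ℕ → ℤ} (h : Running d c ε M σ l q (L + 1) (2 * p) acc P rem)
    (hp : 1 ≤ p) (hpM : (p : ℝ) ≤ M) (hP : ∀ i < d.m, P i = 2 * p)
    (hrem : ∀ k < d.s, |rem k| < 2 * p) :
    Runs level σ (levelCost d.m d.s) fun τ => ∃ l' acc' P' rem',
      Running d c ε M τ l' (q + d.m + d.s) L p acc' P' rem' ∧ (∀ i < d.m, P' i = p) ∧
      (∀ i < d.m, acc' i ≠ 0) ∧ ∀ k < d.s, |rem' k| < p := by
  refine Runs.seq (Q := fun τ => Running d c ε M τ l q L p acc P rem ∧ τ.int 8 10 = 0) ?_ ?_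
  · refine Stmt.LoopFree.runs (by simp [nextLevel, reset, Stmt.LoopFree])
      ⟨⟨?_, ?_, h.inv, h.len, ?_, ?_, ?_⟩, ?_⟩
    · refine h.inp.congr (fun a ha x => ?_) fun a ha x => ?_
      · have h8 : a ≠ 8 := by omega
        simp [nextLevel, reset, Stmt.run, State.setInt_int, State.setReal_int, h8]
      · have h6 : a ≠ 6 := by omega
        simp [nextLevel, reset, Stmt.run, State.setInt_real, State.setReal_real, h6]
    · refine h.work.congr (fun a ha h8 x => ?_) ?_ fun x => ?_ <;>
      simp [nextLevel, reset, Stmt.run, State.setInt_int, State.setReal_int, State.setInt_real,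
        State.setReal_real, IExpr.eval, *]
    · simp [nextLevel, reset, Stmt.run, State.setInt_int, State.setReal_int, IExpr.eval, reg,
        h.level]
    · simp [nextLevel, reset, Stmt.run, State.setInt_real, State.setReal_real, IExpr.eval,
        RExpr.eval, h.mult]
    · intro k hk
      simp [nextLevel, reset, Stmt.run, State.setInt_real, State.setReal_real, h.rem k hk]
    · simp [nextLevel, reset, Stmt.run, State.setInt_int, IExpr.eval]
  rintro σ ⟨h, hk⟩
  refine Runs.seq (Q := fun τ => ∃ l acc P, Running d c ε M τ l (q + d.m) L p acc P rem ∧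
    (∀ i < d.m, P i = p) ∧ ∀ i < d.m, acc i ≠ 0) ?_ ?_
  · refine (Runs.for (fun i τ => (∃ l acc P, Running d c ε M τ l (q + i) L p acc P rem ∧
      (∀ i' < i, P i' = p) ∧ (∀ i' < d.m, i ≤ i' → P i' = 2 * p) ∧ ∀ i' < i, acc i' ≠ 0) ∧
      τ.int 8 10 = i) d.m doubleRow.maxCost ?_ ?_ (σ := σ)
      ⟨⟨l, acc, P, h, by simp, fun i hi _ => hP i hi, by simp⟩, hk⟩).mono le_rfl ?_
    · rintro i τ ⟨⟨l, acc, P, h, -⟩, hk⟩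
      simp [rowTest, BExpr.eval, IExpr.eval, reg, hk, h.inp.m]
    · rintro i him τ ⟨⟨l, acc, P, h, hP1, hP2, ha⟩, hk⟩
      refine doubleRow_loopFree.runs ?_
      obtain ⟨⟨l', acc', h', h1, h2⟩, h3⟩ := run_doubleRow h hk him hp hpM (hP2 i him le_rfl)
      refine ⟨⟨l', acc', _, h', ?_, ?_, ?_⟩, h3⟩
      · intro i' hi'
        by_cases hii : i' = i
        · subst hii; simp
        · rw [Function.update_of_ne hii]; exact hP1 i' (by omega)
      · intro i' hi' hle
        rw [Function.update_of_ne (by omega)]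
        exact hP2 i' hi' (by omega)
      · intro i' hi'
        by_cases hii : i' = i
        · subst hii; exact h1
        · rw [h2 i' hii]; exact ha i' (by omega)
    · rintro τ ⟨⟨l, acc, P, h, hP1, -, ha⟩, -⟩
      exact ⟨l, acc, P, h, hP1, ha⟩
  rintro σ ⟨l, acc, P, h, hP, ha⟩
  refine Runs.seq (Q := fun τ => Running d c ε M τ l (q + d.m) L p acc P rem ∧ τ.int 8 10 = 0)
    ?_ ?_
  · refine Stmt.LoopFree.runs (by simp [reset, Stmt.LoopFree])
      ⟨⟨?_, ?_, h.inv, h.len, ?_, h.mult, h.rem⟩, ?_⟩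
    · refine h.inp.congr (fun a ha x => ?_) fun a ha x => rfl
      have h8 : a ≠ 8 := by omega
      simp [reset, Stmt.run, State.setInt_int, h8]
    · refine h.work.congr (fun a ha h8 x => ?_) ?_ fun x => rfl <;>
      simp [reset, Stmt.run, State.setInt_int, IExpr.eval, *]
    · simpa [reset, Stmt.run, State.setInt_int, IExpr.eval] using h.level
    · simp [reset, Stmt.run, State.setInt_int, IExpr.eval]
  rintro σ ⟨h, hk⟩
  refine (Runs.for (fun k τ => (∃ l acc rem, Running d c ε M τ l (q + d.m + k) L p acc P rem ∧
      (∀ i < d.m, acc i ≠ 0) ∧ (∀ k' < k, |rem k'| < p) ∧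
      ∀ k' < d.s, k ≤ k' → |rem k'| < 2 * p) ∧
      τ.int 8 10 = k) d.s addEntry.maxCost ?_ ?_ (σ := σ)
      ⟨⟨l, acc, rem, h, ha, by simp, fun k hk _ => hrem k hk⟩, hk⟩).mono le_rfl ?_
  · rintro k τ ⟨⟨l, acc, rem, h, -⟩, hk⟩
    simp [entTest, BExpr.eval, IExpr.eval, reg, hk, h.inp.s]
  · rintro k hks τ ⟨⟨l, acc, rem, h, ha, hr1, hr2⟩, hk⟩
    refine addEntry_loopFree.runs ?_
    obtain ⟨⟨l', acc', rem', h', h1, h2, h3⟩, h4⟩ :=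
      run_addEntry h hk hks hp hpM hP (hr2 k hks le_rfl)
    refine ⟨⟨l', acc', rem', h', fun i hi => h1 i (ha i hi), ?_, ?_⟩, h4⟩
    · intro k' hk'
      by_cases hkk : k' = k
      · subst hkk; exact h2
      · rw [h3 k' hkk]; exact hr1 k' (by omega)
    · intro k' hk' hle
      rw [h3 k' (by omega)]
      exact hr2 k' hk' (by omega)
  · rintro τ ⟨⟨l, acc, rem, h, ha, hr1, -⟩, -⟩
    exact ⟨l, acc, P, rem, h, hP, ha, hr1⟩

/-- The multiplier runs through `2 ^ (L - 1), …, 1`, so the first level determines the bound `M`. At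
least one level is needed to move every accumulator off block 0. -/
theorem runs_levels {σ : State} {L : ℕ} (hL : 0 < L) (h : Prepared d c ε σ L)
    (hM : (2 : ℝ) ^ (L - 1) ≤ M) (hlt : ∀ k < d.s, |d.ent k| < 2 ^ L) :
    Runs (.loop (.ilt (.const 0) (reg 9)) level) σ
      (L * (levelCost d.m d.s + (BExpr.ilt (.const 0) (reg 9)).cost) +
        (BExpr.ilt (.const 0) (reg 9)).cost)
      fun τ => ∃ l acc, HoldsInput τ d c ε ∧
        HoldsWork τ d.m l (d.n + 4 * (L * (d.m + d.s))) acc ∧ τ.real 6 0 = 1 ∧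
        l.length = 7 * (L * (d.m + d.s)) ∧
        Data.Complete (d := d) M (l ++ Data.finals acc d.m) (d.n + 4 * (L * (d.m + d.s))) := by
  refine (Runs.for (fun j τ => j ≤ L ∧ ∃ l acc P rem,
    Running d c ε M τ l (j * (d.m + d.s)) (L - j) (2 ^ (L - j)) acc P rem ∧
    (∀ i < d.m, P i = 2 ^ (L - j)) ∧ (0 < j → ∀ i < d.m, acc i ≠ 0) ∧
    ∀ k < d.s, |rem k| < 2 ^ (L - j)) L (levelCost d.m d.s) ?_ ?_ (σ := σ)
    ⟨by omega, [], fun _ => 0, fun _ => 2 ^ L, d.ent, ⟨h.inp, ?_, ?_, by simp, ?_, ?_, h.rem⟩,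
      by simp, by simp, by simpa using hlt⟩).mono le_rfl ?_
  · rintro j τ ⟨hj, l, acc, P, rem, h, -⟩
    simp only [BExpr.eval, IExpr.eval, reg, h.level]
    omega
  · rintro j hj τ ⟨-, l, acc, P, rem, h, hP, -, hr⟩
    -- `n` is the number of levels left after this one and `2 ^ n` the multiplier during it.
    obtain ⟨n, rfl⟩ : ∃ n, L = j + n + 1 := ⟨L - j - 1, by omega⟩
    have e1 : j + n + 1 - j = n + 1 := by omega
    have e2 : j + n + 1 - (j + 1) = n := by omega
    rw [e1, pow_succ'] at h hP hr
    rw [e2]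
    have hnM : (((2 : ℤ) ^ n : ℤ) : ℝ) ≤ M := by
      refine le_trans ?_ hM
      push_cast
      exact pow_le_pow_right₀ (by norm_num) (by omega)
    refine (runs_level h (one_le_pow₀ (by norm_num)) hnM hP hr).mono le_rfl ?_
    rintro τ ⟨l', acc', P', rem', h', h1, h2, h3⟩
    refine ⟨by omega, l', acc', P', rem', ?_, h1, fun _ => h2, h3⟩
    have : (j + 1) * (d.m + d.s) = j * (d.m + d.s) + d.m + d.s := by ring
    rwa [this]
  · simpa using h.work
  · simpa using Data.Inv.init (d := d) M rfl (fun i _ => one_le_pow₀ (by norm_num : (1 : ℤ) ≤ 2))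
  · simpa using h.level
  · rw [h.mult]; simp
  · rintro τ ⟨-, l, acc, P, rem, h, hP, ha, hr⟩
    simp only [Nat.sub_self, pow_zero] at h hP hr
    -- The unprocessed parts are integers of absolute value below `2 ^ 0`, hence zero.
    refine ⟨l, acc, h.inp, h.work, by simpa using h.mult, h.len,
      h.inv.complete hP (fun k hk => Int.abs_lt_one_iff.1 (hr k hk)) (ha hL) ?_⟩
    exact le_trans (one_le_pow₀ (by norm_num)) hM

end level

end LinSys

namespace LinSys

open RealRAM

/-! ### The end of the program -/

/-- The number of equations with tag `i`. -/
def tagCount (l : List Eqn) (i : ℕ) : ℕ := l.countP fun e => e.tag = i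

theorem fst_lt_of_mem_entries {l : List Eqn} {x : ℕ × ℕ × ℝ} (h : x ∈ entries l) :
    x.1 < l.length := by
  simp only [entries, List.mem_flatMap, List.mem_map] at h
  obtain ⟨p, hp, c, -, rfl⟩ := h
  have := List.snd_lt_add_of_mem_zipIdx hp
  simpa using this

/-- The memory holds the weighted system. -/
structure Finished (c : ℕ → ℝ) (ε : ℝ) (σ : State) (l : List Eqn) (nb : ℕ) : Prop where
  rows : σ.int 3 0 = l.length
  cols : σ.int 3 1 = (2 * nb : ℕ)
  nz : σ.int 3 2 = (entries l).length
  ents : ∀ (t : ℕ) (h : t < (entries l).length) (h' : (entries l)[t].1 < l.length),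
    σ.int 4 t = (entries l)[t].1 ∧ σ.int 5 t = (entries l)[t].2.1 ∧
      σ.real 3 t = (entries l)[t].2.2 * √(tagCount l l[(entries l)[t].1].tag)
  rhs : ∀ (r : ℕ) (h : r < l.length), σ.real 4 r = c l[r].tag / √(tagCount l l[r].tag)
  eps : σ.real 5 0 = ε

/-- A bound for the number of steps of the last part, for a system with `e` non-zero
coefficients and `r` equations. -/
def finishCost (m e r : ℕ) : ℕ :=
  reset.maxCost + (m * (finalRow.maxCost + rowTest.cost) + rowTest.cost +
    ((Stmt.setInt 3 (.const 1) (.mul (.const 2) (reg 8)) ;; reset).maxCost +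
    (e * (weightEntry.maxCost + (BExpr.ilt (reg 10) (.get 3 (.const 2))).cost) +
      (BExpr.ilt (reg 10) (.get 3 (.const 2))).cost +
    (reset.maxCost +
    (r * (writeRhs.maxCost + (BExpr.ilt (reg 10) (.get 3 (.const 0))).cost) +
      (BExpr.ilt (reg 10) (.get 3 (.const 0))).cost +
    (Stmt.setReal 5 (.const 0) (.get 2 (.const 0))).maxCost)))))

theorem run_finalRow {σ : State} {m : ℕ} {l : List Eqn} {nb : ℕ} {acc : ℕ → ℕ} {i : ℕ}
    (h : HoldsWork σ m l nb acc) (hp : σ.real 6 0 = 1) (hi : σ.int 8 10 = i) (him : i < m) :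
    let τ := finalRow.run σ
    HoldsWork τ m (l ++ [⟨.fst, 0, acc i, 1, i⟩]) nb acc ∧ τ.int 8 10 = (i + 1 : ℕ) ∧
      (∀ a < 3, ∀ x, τ.int a x = σ.int a x) ∧ ∀ a ≠ 3, ∀ x, τ.real a x = σ.real a x := by
  have hacc := h.acc i him
  simp only [finalRow, Stmt.run]
  set σ₀ : State := ((σ.setInt 8 _ _).setInt 8 _ _).setInt 8 _ _ with hσ₀
  have hint : ∀ a ≠ 8, ∀ x, σ₀.int a x = σ.int a x := by
    intro a ha x
    simp [hσ₀, State.setInt_int, ha]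
  have h0 : HoldsWork σ₀ m l nb acc := h.congr (fun a _ h8 x => hint a h8 x)
    (by simp [hσ₀, State.setInt_int, IExpr.eval]) fun x => rfl
  obtain ⟨h1, h2, h3⟩ := run_emit h0.sys .fst (c := 4) (c' := 6) (i := 0) (j := acc i) (t := i)
    (mu := 1)
    (by simp [hσ₀, State.setInt_int, IExpr.eval])
    (by simp [hσ₀, State.setInt_int, IExpr.eval, reg, hi, hacc])
    (by simp [hσ₀, State.setInt_int, IExpr.eval, reg, hi]) him hp
  generalize (emit .fst 4 6).run σ₀ = τ at h1 h2 h3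
  have h10 : σ₀.int 8 10 = i := by simp [hσ₀, State.setInt_int, IExpr.eval, hi]
  refine ⟨⟨h1.congr (fun a h3 h7 x => ?_) fun x => rfl, ?_, fun i' hi' => ?_⟩, ?_, ?_, ?_⟩
  · have h8 : a ≠ 8 := by omega
    simp [tick, Stmt.run, State.setInt_int, h8]
  · simp [tick, Stmt.run, State.setInt_int, IExpr.eval, h2, h0.nb]
  · simp [tick, Stmt.run, State.setInt_int, h2, h0.acc i' hi']
  · simp [tick, Stmt.run, State.setInt_int, IExpr.eval, reg, h2, h10]
  · intro a ha x
    have h8 : a ≠ 8 := by omega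
    simp [tick, Stmt.run, State.setInt_int, h8, h2 a (Or.inl ha), hint]
  · intro a ha x
    simp only [tick, Stmt.run, State.setInt_real]
    rw [h3 a ha]
    rfl

/-- The weight of an equation involves the total number of equations with its tag, which is known
only after the final equations are written. The coefficients are therefore multiplied by their
weights in a second pass. -/
theorem runs_finish {d : Data} {c : ℕ → ℝ} {ε : ℝ} {σ : State} {l : List Eqn} {nb : ℕ}
    {acc : ℕ → ℕ} (hin : HoldsInput σ d c ε) (hw : HoldsWork σ d.m l nb acc) (hp : σ.real 6 0 = 1)
    {lf : List Eqn} (hlf : lf = l ++ Data.finals acc d.m) (htag : ∀ e ∈ lf, e.tag < d.m) :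
    Runs finish σ (finishCost d.m (entries lf).length lf.length) fun τ =>
      Finished c ε τ lf nb := by
  refine Runs.seq (Q := fun τ => HoldsInput τ d c ε ∧ HoldsWork τ d.m l nb acc ∧
    τ.real 6 0 = 1 ∧ τ.int 8 10 = 0) ?_ ?_
  · refine Stmt.LoopFree.runs (by simp [reset, Stmt.LoopFree]) ⟨?_, ?_, hp, ?_⟩
    · refine hin.congr (fun a ha x => ?_) fun a ha x => rfl
      have h8 : a ≠ 8 := by omega
      simp [reset, Stmt.run, State.setInt_int, h8]
    · refine hw.congr (fun a ha h8 x => ?_) ?_ fun x => rfl <;>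
      simp [reset, Stmt.run, State.setInt_int, IExpr.eval, *]
    · simp [reset, Stmt.run, State.setInt_int, IExpr.eval]
  rintro σ ⟨hin, hw, hp, hk⟩
  -- final equations
  refine Runs.seq (Q := fun τ => HoldsInput τ d c ε ∧ HoldsWork τ d.m lf nb acc) ?_ ?_
  · refine (Runs.for (fun i τ => HoldsInput τ d c ε ∧ τ.real 6 0 = 1 ∧ τ.int 8 10 = i ∧
      HoldsWork τ d.m (l ++ Data.finals acc i) nb acc) d.m finalRow.maxCost ?_ ?_ (σ := σ)
      ⟨hin, hp, hk, by simpa [Data.finals] using hw⟩).mono le_rfl ?_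
    · rintro i τ ⟨h, -, hk, -⟩
      simp [rowTest, BExpr.eval, IExpr.eval, reg, hk, h.m]
    · rintro i him τ ⟨h, hp, hk, hw⟩
      refine Stmt.LoopFree.runs (by simp [finalRow, tick, Stmt.LoopFree, emit_loopFree]) ?_
      obtain ⟨h1, h2, h3, h4⟩ := run_finalRow hw hp hk him
      refine ⟨h.congr h3 fun a ha x => h4 a (by omega) x, by rw [h4 6 (by omega), hp], h2, ?_⟩
      rwa [Data.finals_succ, ← List.append_assoc]
    · rintro τ ⟨h, -, -, hw⟩
      exact ⟨h, hlf ▸ hw⟩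
  rintro σ ⟨hin, hw⟩
  clear hp hk
  refine Runs.seq (Q := fun τ => HoldsInput τ d c ε ∧ HoldsSystem τ d.m lf ∧
    τ.int 3 1 = (2 * nb : ℕ) ∧ τ.int 8 10 = 0) ?_ ?_
  · refine Stmt.LoopFree.runs (by simp [reset, Stmt.LoopFree]) ⟨?_, ?_, ?_, ?_⟩
    · refine hin.congr (fun a ha x => ?_) fun a ha x => rfl
      have h8 : a ≠ 8 := by omega
      have h3 : a ≠ 3 := by omega
      simp [reset, Stmt.run, State.setInt_int, h8, h3]
    · refine ⟨?_, ⟨?_, ?_⟩, ?_, ?_⟩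
      · simpa [reset, Stmt.run, State.setInt_int, IExpr.eval] using hw.sys.len
      · simpa [reset, Stmt.run, State.setInt_int, IExpr.eval] using hw.sys.ents.len
      · simpa [reset, Stmt.run, State.setInt_int, State.setInt_real, IExpr.eval] using
          hw.sys.ents.get
      · simpa [reset, Stmt.run, State.setInt_int, IExpr.eval] using hw.sys.tag
      · simpa [reset, Stmt.run, State.setInt_int, IExpr.eval] using hw.sys.cnt
    · simp [reset, Stmt.run, State.setInt_int, IExpr.eval, reg, hw.nb]
    · simp [reset, Stmt.run, State.setInt_int, IExpr.eval]
  rintro σ ⟨hin, hs, h31, hk⟩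
  clear hw
  have hcnt : ∀ (r : ℕ) (h : r < lf.length), σ.int 7 (σ.int 6 r) = tagCount lf lf[r].tag := by
    intro r h
    rw [hs.tag r h, hs.cnt _ (htag _ (List.getElem_mem h)), tagCount]
  -- weights
  refine Runs.seq (Q := fun τ => HoldsInput τ d c ε ∧
    (∀ a, 3 ≤ a → a ≤ 7 → ∀ x, τ.int a x = σ.int a x) ∧
    (∀ (t : ℕ) (h : t < (entries lf).length) (h' : (entries lf)[t].1 < lf.length),
      τ.real 3 t = (entries lf)[t].2.2 * √(tagCount lf lf[(entries lf)[t].1].tag))) ?_ ?_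
  -- Weighting is done in place, so the invariant also records that the entries not yet reached are
  -- unchanged.
  · refine (Runs.for (fun k τ => HoldsInput τ d c ε ∧ τ.int 8 10 = k ∧
      (∀ a, 3 ≤ a → a ≤ 7 → ∀ x, τ.int a x = σ.int a x) ∧
      (∀ t : ℕ, k ≤ t → τ.real 3 t = σ.real 3 t) ∧
      (∀ (t : ℕ) (h : t < (entries lf).length) (h' : (entries lf)[t].1 < lf.length), t < k →
      τ.real 3 t = (entries lf)[t].2.2 * √(tagCount lf lf[(entries lf)[t].1].tag)))
      (entries lf).length weightEntry.maxCost ?_ ?_ (σ := σ)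
      ⟨hin, hk, fun _ _ _ _ => rfl, fun _ _ => rfl, by simp⟩).mono le_rfl ?_
    · rintro k τ ⟨-, hk, h, -⟩
      simp [BExpr.eval, IExpr.eval, reg, hk, h 3, hs.ents.len]
    · rintro k hks τ ⟨hin, hk, hint, h1, h2⟩
      refine Stmt.LoopFree.runs (by simp [weightEntry, tick, Stmt.LoopFree]) ⟨?_, ?_, ?_, ?_, ?_⟩
      · refine hin.congr (fun a ha x => ?_) fun a ha x => ?_
        · have h8 : a ≠ 8 := by omega
          simp [weightEntry, tick, Stmt.run, State.setInt_int, State.setReal_int, h8]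
        · have h3 : a ≠ 3 := by omega
          simp [weightEntry, tick, Stmt.run, State.setInt_real, State.setReal_real, h3]
      · simp [weightEntry, tick, Stmt.run, State.setInt_int, State.setReal_int, IExpr.eval, reg, hk]
      · intro a h3 h7 x
        have h8 : a ≠ 8 := by omega
        simp [weightEntry, tick, Stmt.run, State.setInt_int, State.setReal_int, h8, hint a h3 h7]
      · intro t ht
        have hne : (t : ℤ) ≠ k := by omega
        simp [weightEntry, tick, Stmt.run, State.setInt_real, State.setReal_real, IExpr.eval, reg,
          hk, hne, h1 t (by omega)]
      · intro t ht h' htk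
        by_cases htk' : t = k
        · subst htk'
          obtain ⟨g1, g2, g3⟩ := hs.ents.get t ht
          simp only [weightEntry, tick, Stmt.run, State.setInt_real, State.setReal_real, IExpr.eval,
            RExpr.eval, reg, hk, h1 t le_rfl, hint 4 (by omega) (by omega),
            hint 6 (by omega) (by omega), hint 7 (by omega) (by omega), g1, g3, hcnt _ h']
          simp
        · have hne : (t : ℤ) ≠ k := by omega
          simp [weightEntry, tick, Stmt.run, State.setInt_real, State.setReal_real, IExpr.eval, reg,
            hk, hne, h2 t ht h' (by omega)]
    · rintro τ ⟨hin, -, hint, -, h2⟩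
      exact ⟨hin, hint, fun t h h' => h2 t h h' h⟩
  rintro σ₁ ⟨hin₁, hint₁, hval₁⟩
  refine Runs.seq (Q := fun τ => HoldsInput τ d c ε ∧
    (∀ a, 3 ≤ a → a ≤ 7 → ∀ x, τ.int a x = σ.int a x) ∧ (∀ x, τ.real 3 x = σ₁.real 3 x) ∧
    τ.int 8 10 = 0) ?_ ?_
  · refine Stmt.LoopFree.runs (by simp [reset, Stmt.LoopFree]) ⟨?_, ?_, fun x => rfl, ?_⟩
    · refine hin₁.congr (fun a ha x => ?_) fun a ha x => rfl
      have h8 : a ≠ 8 := by omega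
      simp [reset, Stmt.run, State.setInt_int, h8]
    · intro a h3 h7 x
      have h8 : a ≠ 8 := by omega
      simp [reset, Stmt.run, State.setInt_int, h8, hint₁ a h3 h7]
    · simp [reset, Stmt.run, State.setInt_int, IExpr.eval]
  rintro σ₂ ⟨hin₂, hint₂, hreal₂, hk₂⟩
  -- right-hand side
  refine Runs.seq (Q := fun τ => HoldsInput τ d c ε ∧
    (∀ a, 3 ≤ a → a ≤ 7 → ∀ x, τ.int a x = σ.int a x) ∧ (∀ x, τ.real 3 x = σ₁.real 3 x) ∧
    ∀ (r : ℕ) (h : r < lf.length), τ.real 4 r = c lf[r].tag / √(tagCount lf lf[r].tag)) ?_ ?_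
  · refine (Runs.for (fun k τ => HoldsInput τ d c ε ∧ τ.int 8 10 = k ∧
      (∀ a, 3 ≤ a → a ≤ 7 → ∀ x, τ.int a x = σ.int a x) ∧ (∀ x, τ.real 3 x = σ₁.real 3 x) ∧
      ∀ (r : ℕ) (h : r < lf.length), r < k →
        τ.real 4 r = c lf[r].tag / √(tagCount lf lf[r].tag)) lf.length writeRhs.maxCost ?_ ?_
      (σ := σ₂) ⟨hin₂, hk₂, hint₂, hreal₂, by simp⟩).mono le_rfl ?_
    · rintro k τ ⟨-, hk, h, -⟩
      simp [BExpr.eval, IExpr.eval, reg, hk, h 3, hs.len]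
    · rintro k hks τ ⟨hin, hk, hint, h1, h2⟩
      refine Stmt.LoopFree.runs (by simp [writeRhs, tick, Stmt.LoopFree]) ⟨?_, ?_, ?_, ?_, ?_⟩
      · refine hin.congr (fun a ha x => ?_) fun a ha x => ?_
        · have h8 : a ≠ 8 := by omega
          simp [writeRhs, tick, Stmt.run, State.setInt_int, State.setReal_int, h8]
        · have h3 : a ≠ 4 := by omega
          simp [writeRhs, tick, Stmt.run, State.setInt_real, State.setReal_real, h3]
      · simp [writeRhs, tick, Stmt.run, State.setInt_int, State.setReal_int, IExpr.eval, reg, hk]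
      · intro a h3 h7 x
        have h8 : a ≠ 8 := by omega
        simp [writeRhs, tick, Stmt.run, State.setInt_int, State.setReal_int, h8, hint a h3 h7]
      · intro x
        simp [writeRhs, tick, Stmt.run, State.setInt_real, State.setReal_real, h1]
      · intro r hr hrk
        by_cases hrk' : r = k
        · subst hrk'
          have ht := htag _ (List.getElem_mem hr)
          simp only [writeRhs, tick, Stmt.run, State.setInt_real, State.setReal_real, IExpr.eval,
            RExpr.eval, reg, hk, hint 6 (by omega) (by omega), hint 7 (by omega) (by omega),
            hcnt r hr]
          rw [hs.tag r hr, hin.rhs _ ht]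
          simp
        · have hne : (r : ℤ) ≠ k := by omega
          simp [writeRhs, tick, Stmt.run, State.setInt_real, State.setReal_real, IExpr.eval, reg,
            hk, hne, h2 r hr (by omega)]
    · rintro τ ⟨hin, -, hint, h1, h2⟩
      exact ⟨hin, hint, h1, fun r h => h2 r h h⟩
  rintro τ ⟨hin₃, hint₃, hreal₃, hrhs⟩
  refine Stmt.LoopFree.runs (by simp [Stmt.LoopFree]) ⟨?_, ?_, ?_, ?_, ?_, ?_⟩
  · simp [Stmt.run, State.setReal_int, hint₃ 3, hs.len]
  · simp [Stmt.run, State.setReal_int, hint₃ 3, h31]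
  · simp [Stmt.run, State.setReal_int, hint₃ 3, hs.ents.len]
  · intro t h h'
    obtain ⟨g1, g2, -⟩ := hs.ents.get t h
    refine ⟨?_, ?_, ?_⟩
    · simp [Stmt.run, State.setReal_int, hint₃ 4, g1]
    · simp [Stmt.run, State.setReal_int, hint₃ 5, g2]
    · simp [Stmt.run, State.setReal_real, hreal₃, hval₁ t h h']
  · intro r h
    simp [Stmt.run, State.setReal_real, hrhs r h]
  · simp [Stmt.run, State.setReal_real, IExpr.eval, RExpr.eval, hin₃.eps]

end LinSys

namespace LinSys

open RealRAM

/-! ### The total number of steps -/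

theorem length_cols (e : Eqn) : 2 ≤ e.cols.length ∧ e.cols.length ≤ 4 := by
  rcases e with ⟨k, i, j, mu, t⟩
  cases k <;> simp [Eqn.cols, Kind.cols]

theorem length_entries (l : List Eqn) :
    2 * l.length ≤ (entries l).length ∧ (entries l).length ≤ 4 * l.length := by
  induction l using List.reverseRecOn with
  | nil => simp [entries]
  | append_singleton l e ih =>
    have := length_cols e
    rw [entries_concat]
    simp only [List.length_append, List.length_map, List.length_singleton]
    omega

/-- The program halts after `O(s log Z)` steps with the weighted system in the output. -/
theorem runs_forward : ∃ K : ℕ, ∀ (d : Data) (c : ℕ → ℝ) (ε : ℝ) (σ : State) (Z : ℕ),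
    HoldsInput σ d c ε → d.m ≤ d.s → (∀ k < d.s, (d.ent k).natAbs ≤ Z) →
    (∃ k < d.s, d.ent k ≠ 0) →
    Runs forward σ (K * (d.s * (Nat.log 2 Z + 1))) fun τ => ∃ (l : List Eqn) (q : ℕ),
      Finished c ε τ l (d.n + 4 * q) ∧ Data.Complete (d := d) Z l (d.n + 4 * q) ∧
      l.length = 7 * q + d.m ∧ d.s ≤ q ∧ q ≤ 2 * (d.s * (Nat.log 2 Z + 1)) := by
  obtain ⟨a₀, ha₀⟩ : ∃ a, a = initRegs.maxCost := ⟨_, rfl⟩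
  obtain ⟨a₁, ha₁⟩ : ∃ a, a = initRow.maxCost + rowTest.cost := ⟨_, rfl⟩
  obtain ⟨a₂, ha₂⟩ : ∃ a, a = rowTest.cost := ⟨_, rfl⟩
  obtain ⟨a₃, ha₃⟩ : ∃ a, a = reset.maxCost := ⟨_, rfl⟩
  obtain ⟨a₄, ha₄⟩ : ∃ a, a = copyEntry.maxCost + entTest.cost := ⟨_, rfl⟩
  obtain ⟨a₅, ha₅⟩ : ∃ a, a = entTest.cost := ⟨_, rfl⟩
  obtain ⟨a₆, ha₆⟩ : ∃ a, a = scaleStep.maxCost + entTest.cost := ⟨_, rfl⟩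
  obtain ⟨b₀, hb₀⟩ : ∃ a, a = (BExpr.ilt (.const 0) (reg 9)).cost := ⟨_, rfl⟩
  obtain ⟨b₁, hb₁⟩ : ∃ a, a = nextLevel.maxCost := ⟨_, rfl⟩
  obtain ⟨b₂, hb₂⟩ : ∃ a, a = doubleRow.maxCost + rowTest.cost := ⟨_, rfl⟩
  obtain ⟨b₃, hb₃⟩ : ∃ a, a = addEntry.maxCost + entTest.cost := ⟨_, rfl⟩
  obtain ⟨c₀, hc₀⟩ : ∃ a, a = finalRow.maxCost + rowTest.cost := ⟨_, rfl⟩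
  obtain ⟨c₁, hc₁⟩ : ∃ a, a = (Stmt.setInt 3 (.const 1) (.mul (.const 2) (reg 8)) ;;
    reset).maxCost := ⟨_, rfl⟩
  obtain ⟨c₂, hc₂⟩ : ∃ a, a = weightEntry.maxCost +
    (BExpr.ilt (reg 10) (.get 3 (.const 2))).cost := ⟨_, rfl⟩
  obtain ⟨c₃, hc₃⟩ : ∃ a, a = (BExpr.ilt (reg 10) (.get 3 (.const 2))).cost := ⟨_, rfl⟩
  obtain ⟨c₄, hc₄⟩ : ∃ a, a = writeRhs.maxCost +
    (BExpr.ilt (reg 10) (.get 3 (.const 0))).cost := ⟨_, rfl⟩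
  obtain ⟨c₅, hc₅⟩ : ∃ a, a = (BExpr.ilt (reg 10) (.get 3 (.const 0))).cost := ⟨_, rfl⟩
  obtain ⟨c₆, hc₆⟩ : ∃ a, a = (Stmt.setReal 5 (.const 0) (.get 2 (.const 0))).maxCost := ⟨_, rfl⟩
  -- Costs relative to `S = d.s * (log₂ Z + 1)`: the scaling loop has at most `2 * S` rounds, there
  -- are `7 * q + d.m ≤ 15 * S` equations because `q ≤ 2 * S`, and each has at most four
  -- coefficients, whence 60.
  refine ⟨(a₀ + (a₁ + a₂ + (a₃ + (a₄ + a₅ + (a₃ + (2 * a₆ + a₅)))))) +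
    (((b₁ + (b₂ + a₂ + (a₃ + (b₃ + a₅)))) + b₀ + b₀) +
    (a₃ + (c₀ + a₂ + (c₁ + (60 * c₂ + c₃ + (a₃ + (15 * c₄ + c₅ + c₆))))))), ?_⟩
  intro d c ε σ Z hin hms hZ hne
  set S := d.s * (Nat.log 2 Z + 1) with hS
  have hs : 0 < d.s := by obtain ⟨k, hk, -⟩ := hne; omega
  have hsS : d.s ≤ S := Nat.le_mul_of_pos_right _ (by omega)
  have hlS : Nat.log 2 Z + 1 ≤ S := Nat.le_mul_of_pos_left _ hs
  have hmS : d.m ≤ S := hms.trans hsS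
  have h1S : 1 ≤ S := by omega
  have hZ0 : Z ≠ 0 := by
    obtain ⟨k, hk, h⟩ := hne
    have := hZ k hk
    omega
  have one : ∀ a, a ≤ S * a := fun a => Nat.le_mul_of_pos_left _ h1S
  rw [add_mul (a₀ + _) _ S, add_mul (b₁ + _ + _ + _) _ S]
  refine Runs.seq ((runs_prepare hin hZ).mono ?_ fun _ h => h) ?_
  · rw [← ha₀, ← ha₁, ← ha₂, ← ha₃, ← ha₄, ← ha₆, ← ha₅]
    have h1 : d.m * a₁ ≤ S * a₁ := Nat.mul_le_mul_right _ hmS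
    have h2 : d.s * a₄ ≤ S * a₄ := Nat.mul_le_mul_right _ hsS
    have h3 : (d.s + (Nat.log 2 Z + 1)) * a₆ ≤ (2 * S) * a₆ :=
      Nat.mul_le_mul_right _ (by omega)
    linarith [one a₀, one a₂, one a₃, one a₅]
  rintro σ ⟨L, hL, hP, hlt⟩
  -- With `L = 0` every entry would be an integer below 1 in absolute value, contradicting the
  -- existence of a non-zero entry.
  have hL0 : 0 < L := by
    obtain ⟨k, hk, h⟩ := hne
    by_contra hc
    obtain rfl : L = 0 := by omega
    have := hlt k hk
    rw [pow_zero, Int.abs_lt_one_iff] at this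
    exact h this
  have hLS : L * d.s ≤ S := by rw [hS, mul_comm]; exact Nat.mul_le_mul_left _ hL
  have hLm : L * d.m ≤ S := (Nat.mul_le_mul_left _ hms).trans hLS
  have hM : (2 : ℝ) ^ (L - 1) ≤ Z := by
    have h1 : 2 ^ (L - 1) ≤ 2 ^ Nat.log 2 Z := Nat.pow_le_pow_right (by norm_num) (by omega)
    exact_mod_cast h1.trans (Nat.pow_log_le_self 2 hZ0)
  refine Runs.seq ((runs_levels hL0 hP hM hlt).mono ?_ fun _ h => h) ?_
  · rw [← hb₀, levelCost, ← hb₁, ← hb₂, ← ha₂, ← ha₃, ← hb₃, ← ha₅]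
    have hL1 : L ≤ S := hL.trans hlS
    have h1 : L * d.m * b₂ ≤ S * b₂ := Nat.mul_le_mul_right _ hLm
    have h2 : L * d.s * b₃ ≤ S * b₃ := Nat.mul_le_mul_right _ hLS
    have h3 := fun a => Nat.mul_le_mul_right a hL1
    have e : L * (b₁ + (d.m * b₂ + a₂ + (a₃ + (d.s * b₃ + a₅))) + b₀) + b₀ =
      L * b₁ + L * d.m * b₂ + L * a₂ + L * a₃ + L * d.s * b₃ + L * a₅ + L * b₀ + b₀ := by ring
    rw [e]
    linarith [h3 b₁, h3 a₂, h3 a₃, h3 a₅, h3 b₀, one b₀]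
  rintro σ ⟨l, acc, hin, hw, hp, hl, hC⟩
  set q := L * (d.m + d.s) with hq
  have hq' : q = L * d.m + L * d.s := by rw [hq, mul_add]
  have hlen : (l ++ Data.finals acc d.m).length = 7 * q + d.m := by
    rw [List.length_append, hl, Data.length_finals]
  refine (runs_finish hin hw hp rfl fun e he => (hC.wf e he).2.2.2.2.2).mono ?_ ?_
  · rw [finishCost, ← ha₃, ← hc₀, ← ha₂, ← hc₁, ← hc₂, ← hc₃, ← hc₄, ← hc₅, ← hc₆]
    have hE := (length_entries (l ++ Data.finals acc d.m)).2
    have h1 : d.m * c₀ ≤ S * c₀ := Nat.mul_le_mul_right _ hmS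
    have h2 : (entries (l ++ Data.finals acc d.m)).length * c₂ ≤ 60 * S * c₂ :=
      Nat.mul_le_mul_right _ (by omega)
    have h3 : (l ++ Data.finals acc d.m).length * c₄ ≤ 15 * S * c₄ :=
      Nat.mul_le_mul_right _ (by omega)
    linarith [one a₃, one a₂, one c₁, one c₃, one c₅, one c₆]
  · intro τ hτ
    have h1 : d.s ≤ L * d.s := Nat.le_mul_of_pos_left _ hL0
    exact ⟨_, q, hτ, hC, hlen, by omega, by omega⟩

end LinSys

namespace LinSys

open RealRAM

/-! ### The matrix of a system -/

/-- The coefficient of the variable `q` in an equation, without the multiplier. -/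
noncomputable def Eqn.coef (e : Eqn) (q : ℕ) : ℝ :=
  (if q / 2 = e.i then (if q % 2 = 0 then e.kind.c₀ else e.kind.c₁) else 0) -
    (if q / 2 = e.j then (if q % 2 = 0 then e.kind.c₀ else e.kind.c₁) else 0)

/-- The matrix of a system, in which every equation has a weight that depends on its tag. -/
noncomputable def sysMatrix (l : List Eqn) (nb : ℕ) : Matrix (Fin l.length) (Fin (2 * nb)) ℝ :=
  fun r q => √(tagCount l l[r].tag) * l[r].mu * l[r].coef q

theorem sysMatrix_mem_twoCommodity (l : List Eqn) (nb : ℕ)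
    (h : ∀ e ∈ l, e.i ≠ e.j ∧ e.i < nb ∧ e.j < nb) :
    sysMatrix l nb ∈ twoCommodity l.length (2 * nb) := by
  refine ⟨nb, rfl, fun r => ?_⟩
  obtain ⟨h1, h2, h3⟩ := h _ (List.getElem_mem r.2)
  have key : ∀ q : ℕ, ∀ a b : ℝ, (![a, b] : Fin 2 → ℝ) (Fin.ofNat 2 q) =
      if q % 2 = 0 then a else b := by
    intro q a b
    rcases Nat.mod_two_eq_zero_or_one q with hq | hq
    · have : Fin.ofNat 2 q = 0 := Fin.ext (by simpa using hq)
      rw [this]; simp [hq]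
    · have : Fin.ofNat 2 q = 1 := Fin.ext (by simpa using hq)
      rw [this]; simp [hq]
  refine ⟨l[r].i, l[r].j, √(tagCount l l[r].tag) * l[r].mu,
    (√(tagCount l l[r].tag) * l[r].mu) • ![l[r].kind.c₀, l[r].kind.c₁], h2, h3, h1, ?_, ?_⟩
  · cases l[r].kind
    · exact Or.inl rfl
    · exact Or.inr (Or.inl rfl)
    · exact Or.inr (Or.inr rfl)
  · intro q
    simp only [sysMatrix, Eqn.coef, Pi.smul_apply, smul_eq_mul, key, mul_sub, mul_ite, mul_zero]

theorem sum_range_two_mul (f : ℕ → ℝ) (n : ℕ) :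
    ∑ q ∈ Finset.range (2 * n), f q = ∑ b ∈ Finset.range n, (f (2 * b) + f (2 * b + 1)) := by
  induction n with
  | zero => simp
  | succ n ih =>
    rw [mul_add, mul_one, Finset.sum_range_succ, Finset.sum_range_succ, ih, Finset.sum_range_succ]
    ring

theorem sum_coef_mul {e : Eqn} {nb : ℕ} (hi : e.i < nb) (hj : e.j < nb) (z : ℕ → ℝ) :
    ∑ q : Fin (2 * nb), e.coef q * z q = e.resid z := by
  rw [Fin.sum_univ_eq_sum_range (fun q => e.coef q * z q), sum_range_two_mul]
  have h1 : ∀ b : ℕ, 2 * b / 2 = b := fun b => by omega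
  have h2 : ∀ b : ℕ, (2 * b + 1) / 2 = b := fun b => by omega
  have h3 : ∀ b : ℕ, 2 * b % 2 = 0 := fun b => by omega
  have h4 : ∀ b : ℕ, (2 * b + 1) % 2 = 1 := fun b => by omega
  have key : ∀ b, e.coef (2 * b) * z (2 * b) + e.coef (2 * b + 1) * z (2 * b + 1) =
      (if b = e.i then e.kind.c₀ * z (2 * b) + e.kind.c₁ * z (2 * b + 1) else 0) -
      (if b = e.j then e.kind.c₀ * z (2 * b) + e.kind.c₁ * z (2 * b + 1) else 0) := by
    intro b
    simp only [Eqn.coef, h1, h2, h3, h4, if_true, one_ne_zero, if_false]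
    split_ifs <;> ring
  simp only [key, Finset.sum_sub_distrib, Finset.sum_ite_eq', Finset.mem_range, hi, hj, if_true]
  unfold Eqn.resid
  ring

theorem mem_entries_iff {l : List Eqn} {r q : ℕ} {w : ℝ} :
    (r, q, w) ∈ entries l ↔ ∃ h : r < l.length, (q, w) ∈ l[r].cols := by
  simp only [entries, List.mem_flatMap, List.mem_map, Prod.exists, Prod.mk.injEq,
    List.mk_mem_zipIdx_iff_getElem?]
  constructor
  · rintro ⟨e, r', he, q', w', hc, rfl, rfl, rfl⟩
    obtain ⟨h, rfl⟩ := List.getElem?_eq_some_iff.1 he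
    exact ⟨h, hc⟩
  · rintro ⟨h, hc⟩
    exact ⟨l[r], r, List.getElem?_eq_getElem h, q, w, hc, rfl, rfl, rfl⟩

/-- The list treats the two blocks separately while `coef` subtracts one from the other; they agree
because distinct blocks have no column in common. -/
theorem Eqn.eq_of_mem_cols {e : Eqn} (hij : e.i ≠ e.j) {q : ℕ} {w : ℝ} (h : (q, w) ∈ e.cols) :
    w = e.mu * e.coef q ∧ |w| = |e.mu| ∧ (q / 2 = e.i ∨ q / 2 = e.j) := by
  rcases e with ⟨k, i, j, mu, t⟩
  have h1 : ∀ b : ℕ, 2 * b / 2 = b := fun b => by omega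
  have h2 : ∀ b : ℕ, (2 * b + 1) / 2 = b := fun b => by omega
  have h4 : ∀ b : ℕ, (2 * b + 1) % 2 = 1 := fun b => by omega
  simp only at hij
  cases k <;> simp only [Eqn.cols, Kind.cols, List.cons_append, List.nil_append, List.mem_cons,
    Prod.mk.injEq, List.not_mem_nil, or_false] at h
  · rcases h with ⟨rfl, rfl⟩ | ⟨rfl, rfl⟩ <;>
      simp [Eqn.coef, Kind.c₀, h1, hij, hij.symm]
  · rcases h with ⟨rfl, rfl⟩ | ⟨rfl, rfl⟩ <;>
      simp [Eqn.coef, Kind.c₁, h2, h4, hij, hij.symm]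
  · rcases h with ⟨rfl, rfl⟩ | ⟨rfl, rfl⟩ | ⟨rfl, rfl⟩ | ⟨rfl, rfl⟩ <;>
      simp [Eqn.coef, Kind.c₀, Kind.c₁, h1, h2, h4, hij, hij.symm]

theorem Eqn.exists_mem_cols {e : Eqn} {q : ℕ} (h : e.coef q ≠ 0) : ∃ w, (q, w) ∈ e.cols := by
  rcases e with ⟨k, i, j, mu, t⟩
  have hq : q = 2 * (q / 2) + q % 2 := by omega
  have hb : q / 2 = i ∨ q / 2 = j := by
    by_contra! hc
    simp [Eqn.coef, hc] at h
  simp only [Eqn.coef] at h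
  have hmod : q % 2 = 0 ∨ q % 2 = 1 := by omega
  generalize q / 2 = b at hq hb h
  generalize q % 2 = s at hq hmod h
  subst hq
  cases k <;> simp only [Eqn.cols, Kind.cols, List.cons_append, List.nil_append, List.mem_cons,
    Prod.mk.injEq, List.not_mem_nil, or_false] <;>
    rcases hb with rfl | rfl <;> rcases hmod with rfl | rfl <;>
    simp [Kind.c₀, Kind.c₁] at h ⊢
  · exact ⟨-mu, Or.inr (Or.inr rfl)⟩
  · exact ⟨mu, Or.inr (Or.inr rfl)⟩

theorem Eqn.nodup_cols {e : Eqn} (hij : e.i ≠ e.j) : (e.cols.map Prod.fst).Nodup := by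
  rcases e with ⟨k, i, j, mu, t⟩
  simp only at hij
  cases k <;> simp [Eqn.cols, Kind.cols] <;> omega

theorem nodup_entries {l : List Eqn} (h : ∀ e ∈ l, e.i ≠ e.j) :
    ((entries l).map fun x => (x.1, x.2.1)).Nodup := by
  induction l using List.reverseRecOn with
  | nil => simp [entries]
  | append_singleton l e ih =>
    rw [entries_concat, List.map_append, List.nodup_append']
    refine ⟨ih fun e he => h e (by simp [he]), ?_, ?_⟩
    · rw [List.map_map]
      have := (Eqn.nodup_cols (h e (by simp))).map (f := fun q : ℕ => (l.length, q))
        fun a b hab => (Prod.mk.inj hab).2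
      rwa [List.map_map] at this
    · intro p hp hp'
      simp only [List.mem_map] at hp hp'
      obtain ⟨x, hx, rfl⟩ := hp
      obtain ⟨y, ⟨c, -, rfl⟩, hy⟩ := hp'
      have := fst_lt_of_mem_entries hx
      simp only [Prod.mk.injEq] at hy
      omega

theorem pairwise_entries (l : List Eqn) : (entries l).Pairwise fun x y => x.1 ≤ y.1 := by
  induction l using List.reverseRecOn with
  | nil => simp [entries]
  | append_singleton l e ih =>
    rw [entries_concat, List.pairwise_append]
    refine ⟨ih, ?_, ?_⟩
    · rw [List.pairwise_map]
      exact List.pairwise_of_forall fun _ _ => le_rfl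
    · intro x hx y hy
      obtain ⟨c, -, rfl⟩ := List.mem_map.1 hy
      exact (fst_lt_of_mem_entries hx).le

/-- Enumeration of the non-zero entries of a matrix by a list. -/
theorem exists_equiv_of_list {m n : ℕ} (A : Matrix (Fin m) (Fin n) ℝ) (E : List (ℕ × ℕ × ℝ))
    (hE : (E.map fun x => (x.1, x.2.1)).Nodup)
    (h1 : ∀ x ∈ E, ∃ (i : Fin m) (j : Fin n), x.1 = i ∧ x.2.1 = j ∧ A i j ≠ 0)
    (h2 : ∀ (i : Fin m) (j : Fin n), A i j ≠ 0 → ∃ x ∈ E, x.1 = i ∧ x.2.1 = j) :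
    nnz A = E.length ∧ ∃ e : Fin (nnz A) ≃ {p : Fin m × Fin n // A p.1 p.2 ≠ 0},
      ∀ k : Fin (nnz A), ∃ h : (k : ℕ) < E.length, E[(k : ℕ)].1 = (e k).1.1 ∧
        E[(k : ℕ)].2.1 = (e k).1.2 := by
  have hmem : ∀ k : Fin E.length, E[k] ∈ E := fun k => List.getElem_mem k.2
  obtain ⟨F, hF⟩ : ∃ F : Fin E.length → {p : Fin m × Fin n // A p.1 p.2 ≠ 0},
      ∀ k, E[k].1 = (F k).1.1 ∧ E[k].2.1 = (F k).1.2 := by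
    have : ∀ k : Fin E.length, ∃ p : {p : Fin m × Fin n // A p.1 p.2 ≠ 0},
        E[k].1 = p.1.1 ∧ E[k].2.1 = p.1.2 := fun k => by
      obtain ⟨i, j, hi, hj, hij⟩ := h1 _ (hmem k)
      exact ⟨⟨(i, j), hij⟩, hi, hj⟩
    exact ⟨fun k => (this k).choose, fun k => (this k).choose_spec⟩
  have hbij : Function.Bijective F := by
    constructor
    · intro a b hab
      have h3 : ((E[a].1, E[a].2.1) : ℕ × ℕ) = (E[b].1, E[b].2.1) := by
        rw [(hF a).1, (hF a).2, (hF b).1, (hF b).2, hab]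
      have h4 := List.nodup_iff_injective_get.1 hE
      have h5 := @h4 ⟨a, by simp⟩ ⟨b, by simp⟩ (by simpa using h3)
      exact Fin.ext (by simpa using h5)
    · rintro ⟨⟨i, j⟩, hij⟩
      obtain ⟨x, hx, hx1, hx2⟩ := h2 i j hij
      obtain ⟨k, hk, rfl⟩ := List.getElem_of_mem hx
      refine ⟨⟨k, hk⟩, Subtype.ext (Prod.ext (Fin.ext ?_) (Fin.ext ?_))⟩
      · rw [← (hF ⟨k, hk⟩).1]; exact hx1
      · rw [← (hF ⟨k, hk⟩).2]; exact hx2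
  have hcard : nnz A = E.length := by
    rw [nnz, ← Nat.card_congr (Equiv.ofBijective F hbij), Nat.card_fin]
  refine ⟨hcard, (finCongr hcard).trans (Equiv.ofBijective F hbij), fun k => ⟨hcard ▸ k.2, ?_⟩⟩
  exact hF (finCongr hcard k)

theorem tagCount_pos {l : List Eqn} {e : Eqn} (he : e ∈ l) : 0 < tagCount l e.tag := by
  rw [tagCount, List.countP_pos_iff]
  exact ⟨e, he, by simp⟩

/-- The written list contains exactly the non-zero entries: weights and multipliers are positive, so
no listed coefficient vanishes, and distinct blocks prevent repetitions. -/
theorem nnz_sysMatrix {l : List Eqn} {nb : ℕ}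
    (h : ∀ e ∈ l, e.i ≠ e.j ∧ e.i < nb ∧ e.j < nb ∧ 1 ≤ e.mu) :
    nnz (sysMatrix l nb) = (entries l).length ∧
    ∃ e : Fin (nnz (sysMatrix l nb)) ≃
        {p : Fin l.length × Fin (2 * nb) // sysMatrix l nb p.1 p.2 ≠ 0},
      ∀ k : Fin (nnz (sysMatrix l nb)), ∃ h : (k : ℕ) < (entries l).length,
        (entries l)[(k : ℕ)].1 = (e k).1.1 ∧ (entries l)[(k : ℕ)].2.1 = (e k).1.2 := by
  refine exists_equiv_of_list _ _ (nodup_entries fun e he => (h e he).1) ?_ ?_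
  · rintro ⟨r, q, w⟩ hx
    obtain ⟨hr, hc⟩ := mem_entries_iff.1 hx
    obtain ⟨h1, h2, h3, h4⟩ := h _ (List.getElem_mem hr)
    obtain ⟨g1, g2, g3⟩ := Eqn.eq_of_mem_cols h1 hc
    refine ⟨⟨r, hr⟩, ⟨q, by omega⟩, rfl, rfl, ?_⟩
    have hN := tagCount_pos (List.getElem_mem hr)
    have hw : w ≠ 0 := by
      rw [← abs_pos, g2, abs_pos]; linarith
    simp only [sysMatrix, Fin.getElem_fin]
    rw [mul_assoc, ← g1]
    have : 0 < √(tagCount l l[r].tag : ℝ) := Real.sqrt_pos.2 (by exact_mod_cast hN)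
    positivity
  · intro r q hrq
    have : l[r].coef q ≠ 0 := right_ne_zero_of_mul hrq
    obtain ⟨w, hw⟩ := Eqn.exists_mem_cols this
    exact ⟨(r, q, w), mem_entries_iff.2 ⟨r.2, hw⟩, rfl, rfl⟩

theorem Finished.encodesMatrix {c : ℕ → ℝ} {ε : ℝ} {σ : State} {l : List Eqn} {nb : ℕ}
    (hf : Finished c ε σ l nb) (h : ∀ e ∈ l, e.i ≠ e.j ∧ e.i < nb ∧ e.j < nb ∧ 1 ≤ e.mu) :
    EncodesMatrix σ 3 (sysMatrix l nb) := by
  obtain ⟨hcard, e, he⟩ := nnz_sysMatrix h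
  refine ⟨hf.rows, hf.cols, by rw [hcard, hf.nz], e, ?_, ?_⟩
  · intro a b hab
    obtain ⟨ha, ha1, -⟩ := he a
    obtain ⟨hb, hb1, -⟩ := he b
    simp only
    rw [← Fin.val_fin_le, ← ha1, ← hb1]
    rcases hab.eq_or_lt with rfl | hlt
    · exact le_rfl
    · exact List.pairwise_iff_getElem.1 (pairwise_entries l) _ _ ha hb hlt
  · intro k
    obtain ⟨hk, h1, h2⟩ := he k
    have hr : (entries l)[(k : ℕ)].1 < l.length := by rw [h1]; exact (e k).1.1.2
    obtain ⟨g1, g2, g3⟩ := hf.ents k hk hr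
    refine ⟨by rw [g1, h1], by rw [g2, h2], ?_⟩
    have hx : ((entries l)[(k : ℕ)].1, (entries l)[(k : ℕ)].2.1, (entries l)[(k : ℕ)].2.2) ∈
        entries l := List.getElem_mem hk
    obtain ⟨_, hc⟩ := mem_entries_iff.1 hx
    obtain ⟨g4, -⟩ := Eqn.eq_of_mem_cols (h _ (List.getElem_mem hr)).1 hc
    rw [g3, g4]
    simp only [sysMatrix, Fin.getElem_fin, h1, h2]
    ring

end LinSys

namespace LinSys

open RealRAM

/-! ### The given system and the new system -/

theorem tagSum_eq_sum (l : List Eqn) (i : ℕ) (ρ : Eqn × ℕ → ℝ) :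
    tagSum l.zipIdx i ρ =
      ∑ r : Fin l.length, if l[r].tag = i then l[r].mu * ρ (l[r], r) else 0 := by
  have : l.zipIdx = List.ofFn fun r : Fin l.length => (l[r], (r : ℕ)) := by
    apply List.ext_getElem
    · simp
    · intro k h1 h2
      simp
  rw [tagSum, this, List.map_ofFn, List.sum_ofFn]
  rfl

theorem tagCount_eq_sum (l : List Eqn) (i : ℕ) :
    (tagCount l i : ℝ) = ∑ r : Fin l.length, if l[r].tag = i then 1 else 0 := by
  refine Eq.trans ?_ (Fin.sum_univ_fun_getElem l fun e => if e.tag = i then (1 : ℝ) else 0).symm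
  unfold tagCount
  induction l with
  | nil => simp
  | cons e l ih =>
    rw [List.countP_cons, List.map_cons, List.sum_cons, Nat.cast_add, ih, add_comm]
    simp

/-- A vector, extended by zero to a sequence. -/
noncomputable def extend {n : ℕ} (x : EuclideanSpace ℝ (Fin n)) (q : ℕ) : ℝ :=
  if h : q < n then x ⟨q, h⟩ else 0

theorem extend_apply {n : ℕ} (x : EuclideanSpace ℝ (Fin n)) (q : Fin n) : extend x q = x q := by
  simp [extend]

theorem norm_le_of_abs_le {n : ℕ} {x : EuclideanSpace ℝ (Fin n)} {G : ℝ} (hG : 0 ≤ G)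
    (h : ∀ i, |x i| ≤ G) : ‖x‖ ≤ √n * G := by
  rw [EuclideanSpace.norm_eq]
  refine Real.sqrt_le_iff.2 ⟨by positivity, ?_⟩
  calc ∑ i, ‖x i‖ ^ 2 ≤ ∑ _i : Fin n, G ^ 2 := by
        refine Finset.sum_le_sum fun i _ => ?_
        rw [Real.norm_eq_abs]
        exact pow_le_pow_left₀ (abs_nonneg _) (h i) 2
    _ = (√n * G) ^ 2 := by
        rw [mul_pow, Real.sq_sqrt (by positivity)]
        simp

/-- The variables of the given system among those of the new one. -/
noncomputable def restrictVars {N : ℕ} (n : ℕ) (z : EuclideanSpace ℝ (Fin N)) :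
    EuclideanSpace ℝ (Fin n) :=
  WithLp.toLp 2 fun j => extend z (2 * j)

/-- The right-hand side of the new system. -/
noncomputable def liftRhs {m : ℕ} (l : List Eqn) (c : EuclideanSpace ℝ (Fin m)) :
    EuclideanSpace ℝ (Fin l.length) :=
  WithLp.toLp 2 fun r => extend c l[r].tag / √(tagCount l l[r].tag)

/-- The adjoint of `liftRhs`. -/
noncomputable def lowerRhs (m : ℕ) (l : List Eqn) (b : EuclideanSpace ℝ (Fin l.length)) :
    EuclideanSpace ℝ (Fin m) :=
  WithLp.toLp 2 fun i => ∑ r : Fin l.length, if l[r].tag = (i : ℕ) then b r / √(tagCount l i) else 0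

variable {d : Data}

theorem sysMatrix_apply {M : ℝ} {l : List Eqn} {nb : ℕ} (h : Data.Complete (d := d) M l nb)
    (z : EuclideanSpace ℝ (Fin (2 * nb))) (r : Fin l.length) :
    Matrix.toEuclideanLin (sysMatrix l nb) z r =
      √(tagCount l l[r].tag) * l[r].mu * l[r].resid (extend z) := by
  obtain ⟨-, h2, h3, -⟩ := h.wf _ (List.getElem_mem r.2)
  rw [toEuclideanLin_coord, Fin.getElem_fin, ← sum_coef_mul h2 h3 (extend z), Finset.mul_sum]
  refine Finset.sum_congr rfl fun q _ => ?_
  rw [extend_apply]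
  simp only [sysMatrix, Fin.getElem_fin]
  ring

/-- The `N` equations with tag `i` share the right-hand side `c_i` as `N` copies of `c_i / √N`,
which makes `liftRhs` isometric; the weight `√N` on the left cancels in `lowerRhs`, leaving the sum
that `ident` equates with row `i` of `A`. For preimages, `solv` provides a bound in the maximum
norm, and `√(2 * nb)` passes to the Euclidean norm. -/
theorem lift_sysMatrix {M : ℝ} {l : List Eqn} {nb : ℕ} (h : Data.Complete (d := d) M l nb)
    {A : Matrix (Fin d.m) (Fin d.n) ℝ}
    (hA : ∀ (z : ℕ → ℝ) (i : Fin d.m), d.rowSum d.ent i z = ∑ j, A i j * z (2 * j)) :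
    Lift A (sysMatrix l nb) (liftRhs l) (lowerRhs d.m l) (restrictVars d.n)
      (√(2 * nb : ℕ) * (10 * (1 + 2 * d.total))) (√(2 * nb : ℕ) * 10) := by
  have hN : ∀ i < d.m, 0 < (tagCount l i : ℝ) := fun i hi => by
    obtain ⟨e, he, rfl⟩ := h.exists_tag i hi
    exact_mod_cast tagCount_pos he
  have hsq : ∀ i < d.m, 0 < √(tagCount l i : ℝ) := fun i hi => Real.sqrt_pos.2 (hN i hi)
  have htag : ∀ r : Fin l.length, l[r].tag < d.m :=
    fun r => (h.wf _ (List.getElem_mem r.2)).2.2.2.2.2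
  have hmu : ∀ r : Fin l.length, 1 ≤ l[r].mu :=
    fun r => (h.wf _ (List.getElem_mem r.2)).2.2.2.1
  refine ⟨?_, ?_, ?_, ?_, ?_, ?_⟩
  · intro b c
    ext i
    simp only [lowerRhs, PiLp.sub_apply]
    rw [← Finset.sum_sub_distrib]
    refine Finset.sum_congr rfl fun r _ => ?_
    split_ifs
    · ring
    · ring
  · intro b c
    ext r
    simp only [liftRhs, PiLp.sub_apply, extend, htag, dif_pos]
    ring
  · intro c b
    simp only [PiLp.inner_apply, liftRhs, lowerRhs, RCLike.inner_apply, conj_trivial,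
      Finset.sum_mul]
    rw [Finset.sum_comm]
    refine Finset.sum_congr rfl fun r _ => ?_
    rw [Finset.sum_eq_single (⟨l[r].tag, htag r⟩ : Fin d.m)]
    · rw [if_pos rfl, extend, dif_pos (htag r)]
      ring
    · intro i _ hi
      rw [if_neg (fun hc => hi (Fin.ext hc.symm)), zero_mul]
    · simp
  · intro c
    ext i
    have h1 : ∀ r : Fin l.length,
        (if l[r].tag = i then liftRhs l c r / √(tagCount l i) else 0) =
          (c i / tagCount l i) * (if l[r].tag = i then 1 else 0) := by
      intro r
      split_ifs with hr
      · simp only [liftRhs, hr, extend_apply]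
        rw [div_div, Real.mul_self_sqrt (hN i i.2).le, mul_one]
      · simp
    simp only [lowerRhs]
    rw [Finset.sum_congr rfl fun r _ => h1 r, ← Finset.mul_sum, ← tagCount_eq_sum,
      div_mul_cancel₀ _ (hN i i.2).ne']
  · intro z
    ext i
    have h1 := h.ident (extend z) i i.2
    rw [tagSum_eq_sum, hA] at h1
    rw [toEuclideanLin_coord]
    simp only [lowerRhs, restrictVars]
    rw [← h1]
    refine Finset.sum_congr rfl fun r _ => ?_
    split_ifs with hr
    · rw [sysMatrix_apply h, hr]
      have := hsq i i.2
      field_simp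
    · rfl
  · intro x b hxb
    -- The residuals that an exact solution of `B z = b` must have.
    set ρ : ℕ → ℝ := fun k => if hk : k < l.length then
      b ⟨k, hk⟩ / (√(tagCount l l[k].tag) * l[k].mu) else 0 with hρ
    have hρr : ∀ r : Fin l.length, ρ r = b r / (√(tagCount l l[r].tag) * l[r].mu) := by
      intro r
      simp [hρ]
    have hmur : ∀ r : Fin l.length, l[r].mu * ρ r = b r / √(tagCount l l[r].tag) := by
      intro r
      have h1 := hsq _ (htag r)
      have h2 := hmu r
      rw [hρr]
      field_simp
    have hξ : ∀ j < d.n, |extend x j| ≤ ‖x‖ := by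
      intro j hj
      rw [extend, dif_pos hj]
      exact PiLp.norm_apply_le x _
    -- Multiplied by `mu`, the residuals with tag `i` become `b r / √N`. As there are `N` of them,
    -- Cauchy–Schwarz bounds the sum of absolute values by `‖b‖`, with no loss in `N`.
    have hβ : ∀ i < d.m, tagSum l.zipIdx i (fun p => |ρ p.2|) ≤ ‖b‖ := by
      intro i hi
      rw [tagSum_eq_sum]
      have h1 : ∀ r : Fin l.length, (if l[r].tag = i then l[r].mu * |ρ r| else 0) =
          (if l[r].tag = i then 1 / √(tagCount l i) else 0) * |b r| := by
        intro r
        split_ifs with hr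
        · have h2 := congrArg abs (hmur r)
          rw [abs_mul, abs_of_pos (by linarith [hmu r] : 0 < l[r].mu), hr, abs_div,
            abs_of_pos (hsq i hi)] at h2
          rw [h2]
          ring
        · simp
      rw [Finset.sum_congr rfl fun r _ => h1 r]
      refine abs_le_of_sq_le_sq' ?_ (norm_nonneg _) |>.2
      refine (Finset.sum_mul_sq_le_sq_mul_sq _ _ _).trans ?_
      have h2 : ∑ r : Fin l.length, (if l[r].tag = i then 1 / √(tagCount l i : ℝ) else 0) ^ 2 =
          1 := by
        have h3 : ∀ r : Fin l.length, (if l[r].tag = i then 1 / √(tagCount l i : ℝ) else 0) ^ 2 =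
            (1 / tagCount l i) * (if l[r].tag = i then 1 else 0) := by
          intro r
          split_ifs
          · rw [div_pow, Real.sq_sqrt (hN i hi).le]; simp
          · simp
        rw [Finset.sum_congr rfl fun r _ => h3 r, ← Finset.mul_sum, ← tagCount_eq_sum,
          one_div_mul_cancel (hN i hi).ne']
      rw [h2, one_mul, EuclideanSpace.norm_sq_eq]
      simp
    -- The hypothesis `Λt b = A x`, read in coordinate `i`, is the compatibility condition of
    -- `solv`.
    have hs : ∀ i < d.m, tagSum l.zipIdx i (fun p => ρ p.2) =
        d.rowSum d.ent i fun q => extend x (q / 2) := by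
      intro i hi
      rw [tagSum_eq_sum, show i = ((⟨i, hi⟩ : Fin d.m) : ℕ) from rfl, hA]
      have h1 := congrArg (fun v : EuclideanSpace ℝ (Fin d.m) => v ⟨i, hi⟩) hxb
      simp only [toEuclideanLin_coord, lowerRhs] at h1
      have h2 : ∀ j : Fin d.n, extend x (2 * (j : ℕ) / 2) = x j := fun j => by
        rw [show 2 * (j : ℕ) / 2 = j by omega, extend_apply]
      simp only [h2]
      rw [← h1]
      refine Finset.sum_congr rfl fun r _ => ?_
      split_ifs with hr
      · rw [hmur r, hr]
      · rfl
    obtain ⟨z, hz1, hz2, hz3⟩ := h.solv (extend x) ρ ‖x‖ ‖b‖ hξ (norm_nonneg _) hβ hs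
    have hbd : 0 ≤ d.bd ‖x‖ ‖b‖ := by
      have := d.total_nonneg
      unfold Data.bd
      positivity
    set z' : EuclideanSpace ℝ (Fin (2 * nb)) := WithLp.toLp 2 fun q => z q with hz'
    have hext : ∀ q < 2 * nb, extend z' q = z q := fun q hq => by
      simp [extend, hq, hz']
    refine ⟨z', ?_, ?_⟩
    · ext r
      have hw := h.wf _ (List.getElem_mem r.2)
      have hres := hz2 (l[r], r) (by simp [List.mk_mem_zipIdx_iff_getElem?])
      rw [sysMatrix_apply h, Fin.getElem_fin, Data.Eqn.resid_congr hw.2.1 hw.2.2.1 hext]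
      simp only [Fin.getElem_fin] at hres
      rw [hres, mul_assoc]
      have h3 := hmur r
      simp only [Fin.getElem_fin] at h3
      rw [h3]
      have h1 := hsq _ (htag r)
      simp only [Fin.getElem_fin] at h1
      field_simp
    · refine (norm_le_of_abs_le (G := 10 * d.bd ‖x‖ ‖b‖) (by positivity)
        fun q => hz3 q q.2).trans (le_of_eq ?_)
      unfold Data.bd
      ring

end LinSys

namespace LinSys

open RealRAM

/-! ### The given matrix as data of the construction -/

/-- The construction works with `x_j - x_0` instead of `x_j`; zero row sums make this harmless. -/
theorem exists_data {m n : ℕ} {A : Matrix (Fin m) (Fin n) ℝ} {c : EuclideanSpace ℝ (Fin m)}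
    {ε : ℝ} (hA : A ∈ zeroSumPowerTwo m n) (hA0 : A ≠ 0) {σ : State}
    (hσ : EncodesInstance σ 0 A c ε) :
    ∃ d : Data, d.m = m ∧ d.n = n ∧ d.s = nnz A ∧ HoldsInput σ d (extend c) ε ∧
      (∀ (z : ℕ → ℝ) (i : Fin m), d.rowSum d.ent i z = ∑ j, A i j * z (2 * j)) ∧
      ∀ k < d.s, ∃ i j, (d.ent k : ℝ) = A i j ∧ A i j ≠ 0 := by
  obtain ⟨Z, hZ, -, -, hsum, -⟩ := hA
  obtain ⟨⟨h1, h2, h3, e, -, he⟩, hc, hε⟩ := hσ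
  have hn : 0 < n := by
    rcases Nat.eq_zero_or_pos n with rfl | h
    · exact absurd (Matrix.ext fun i j => j.elim0) hA0
    · exact h
  have hAZ : ∀ i j, A i j = Z i j := fun i j => by rw [hZ]; rfl
  refine ⟨⟨m, n, nnz A, fun k => if h : k < nnz A then (e ⟨k, h⟩).1.1 else 0,
    fun k => if h : k < nnz A then (e ⟨k, h⟩).1.2 else 0,
    fun k => if h : k < nnz A then Z (e ⟨k, h⟩).1.1 (e ⟨k, h⟩).1.2 else 0, hn,
    fun k hk => by simp [hk], fun k hk => by simp [hk]⟩, rfl, rfl, rfl,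
    ⟨h1, h2, h3, fun k hk => ?_, fun k hk => ?_, fun k hk => ?_, fun i hi => ?_, hε⟩, ?_, ?_⟩
  · simpa [show k < nnz A from hk] using (he ⟨k, hk⟩).1
  · simpa [show k < nnz A from hk] using (he ⟨k, hk⟩).2.1
  · simpa [show k < nnz A from hk, hAZ] using (he ⟨k, hk⟩).2.2
  · have := hc ⟨i, hi⟩
    rw [extend, dif_pos hi]
    exact this
  · intro z i
    unfold Data.rowSum
    simp only
    rw [← Fin.sum_univ_eq_sum_range (fun k => if (if h : k < nnz A then ((e ⟨k, h⟩).1.1 : ℕ) else 0)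
      = i then (((if h : k < nnz A then Z (e ⟨k, h⟩).1.1 (e ⟨k, h⟩).1.2 else 0) : ℤ) : ℝ) *
      (z (2 * if h : k < nnz A then ((e ⟨k, h⟩).1.2 : ℕ) else 0) - z 0) else 0) (nnz A)]
    simp only [Fin.is_lt, dif_pos, Fin.eta, ← hAZ]
    rw [Equiv.sum_comp e (fun p => if (p.1.1 : ℕ) = i then
      A p.1.1 p.1.2 * (z (2 * p.1.2) - z 0) else 0)]
    have hs : (∑ p : {p : Fin m × Fin n // A p.1 p.2 ≠ 0}, if (p.1.1 : ℕ) = i then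
        A p.1.1 p.1.2 * (z (2 * p.1.2) - z 0) else 0) =
        ∑ p : Fin m × Fin n, if p.1 = i then A p.1 p.2 * (z (2 * p.2) - z 0) else 0 := by
      classical
      rw [← Finset.sum_filter_of_ne (p := fun p : Fin m × Fin n => A p.1 p.2 ≠ 0)]
      · rw [← Finset.sum_subtype_eq_sum_filter, Finset.subtype_univ]
        simp [Fin.val_inj]
      · intro p _ hp hp0
        simp [hp0] at hp
    rw [hs, Fintype.sum_prod_type, Finset.sum_eq_single i]
    -- The terms with `z 0` carry the factor `∑ j, A i j`, which vanishes.
    · simp only [if_true, mul_sub, Finset.sum_sub_distrib, ← Finset.sum_mul]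
      have : ∑ j, A i j = 0 := by
        simp only [hAZ]
        exact_mod_cast hsum i
      rw [this]
      ring
    · intro i' _ hi'
      simp [hi']
    · simp
  · intro k hk
    have hk' : k < nnz A := hk
    refine ⟨(e ⟨k, hk'⟩).1.1, (e ⟨k, hk'⟩).1.2, ?_, (e ⟨k, hk'⟩).2⟩
    simp [hk', hAZ]

/-- A non-zero entry in a row with sum zero has a second one in its row, and non-zero integers are
at least 1 in absolute value. These give `2 ≤ s` and `1 ≤ U`, which keep `log (s * U)` away from
zero. -/
theorem two_le_nnz {m n : ℕ} {A : Matrix (Fin m) (Fin n) ℝ} (hA : A ∈ zeroSumPowerTwo m n)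
    (hA0 : A ≠ 0) : 2 ≤ nnz A ∧ ∃ i j, 1 ≤ |A i j| := by
  obtain ⟨Z, hZ, -, -, hsum, -⟩ := hA
  have hAZ : ∀ i j, A i j = Z i j := fun i j => by rw [hZ]; rfl
  obtain ⟨i, j, hij⟩ : ∃ i j, A i j ≠ 0 := by
    by_contra! h
    exact hA0 (Matrix.ext h)
  have hij' : Z i j ≠ 0 := fun h => hij (by rw [hAZ, h]; simp)
  constructor
  · obtain ⟨j', hj', hne⟩ : ∃ j', j' ≠ j ∧ Z i j' ≠ 0 := by
      by_contra! h
      have := hsum i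
      rw [Finset.sum_eq_single j (fun j' _ h' => h j' h') (by simp)] at this
      exact hij' this
    have h1 : A i j' ≠ 0 := by rw [hAZ]; exact_mod_cast hne
    have : Nontrivial {p : Fin m × Fin n // A p.1 p.2 ≠ 0} :=
      ⟨⟨(i, j'), h1⟩, ⟨(i, j), hij⟩, fun h => hj' (Prod.mk.inj (Subtype.mk.inj h)).2⟩
    exact Finite.one_lt_card
  · refine ⟨i, j, ?_⟩
    rw [hAZ]
    exact_mod_cast Int.one_le_abs hij'

/-! ### Parameters -/

theorem abs_le_maxAbs {ι : Type} [Finite ι] (a : ι → ℝ) (i : ι) : |a i| ≤ maxAbs a :=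
  le_ciSup (f := fun i => |a i|) (Set.finite_range _).bddAbove i

/-- Finiteness makes the infimum a value `|a j|` with `a j ≠ 0`. It is therefore positive, and
taking reciprocals is legitimate. -/
theorem inv_abs_le {ι : Type} [Finite ι] (a : ι → ℝ) {i : ι} (hi : a i ≠ 0) :
    1 / |a i| ≤ 1 / minNonzero a := by
  have hfin : {r | ∃ i, a i ≠ 0 ∧ r = |a i|}.Finite :=
    (Set.finite_range fun i => |a i|).subset (by rintro r ⟨i, -, rfl⟩; exact ⟨i, rfl⟩)
  have hne : {r | ∃ i, a i ≠ 0 ∧ r = |a i|}.Nonempty := ⟨|a i|, i, hi, rfl⟩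
  obtain ⟨j, hj, hj'⟩ := hne.csInf_mem hfin
  refine one_div_le_one_div_of_le ?_ (csInf_le hfin.bddBelow ⟨i, hi, rfl⟩)
  rw [minNonzero, hj']
  exact abs_pos.2 hj

theorem one_div_minNonzero_le {ι : Type} (a : ι → ℝ) {W : ℝ} (hW : 0 < W)
    (h : ∀ i, a i ≠ 0 → 1 / W ≤ |a i|) : 1 / minNonzero a ≤ W := by
  rcases Set.eq_empty_or_nonempty {r | ∃ i, a i ≠ 0 ∧ r = |a i|} with he | hne
  · rw [minNonzero, he, Real.sInf_empty, div_zero]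
    exact hW.le
  · have : 1 / W ≤ minNonzero a := le_csInf hne (by rintro r ⟨i, hi, rfl⟩; exact h i hi)
    rw [one_div_le (lt_of_lt_of_le (by positivity) this) hW]
    exact this

/-- The logarithmic factor. -/
noncomputable def logFactor (p : Params) : ℝ := Real.log (max (p.1 * p.2.1) 2)

theorem logFactor_pos (p : Params) : 0 < logFactor p :=
  Real.log_pos (lt_of_lt_of_le one_lt_two (le_max_right _ _))

/-- The growth of the parameters. -/
noncomputable def growth (p : Params) : Params :=
  (20000 * (p.1 * logFactor p),
    20000 * (p.1 ^ (3 / 2 : ℝ) * p.2.1 * logFactor p ^ (1 / 2 : ℝ)),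
    20000 * (p.2.2.1 * p.1 ^ 4 * p.2.1 ^ 2 * logFactor p ^ 2),
    p.2.2.2)

theorem growth_mapsTo : Set.MapsTo growth posParams posParams := by
  rintro ⟨s, U, K, E⟩ ⟨h1, h2, h3, h4⟩
  have := logFactor_pos (s, U, K, E)
  simp only at h1 h2 h3 h4
  exact ⟨by simp only [growth]; positivity, by simp only [growth]; positivity,
    by simp only [growth]; positivity, h4⟩

theorem growth_monotoneOn : MonotoneOn growth posParams := by
  rintro ⟨s, U, K, E⟩ ⟨h1, h2, h3, h4⟩ ⟨s', U', K', E'⟩ ⟨h1', h2', h3', h4'⟩ ⟨g1, g2, g3, g4⟩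
  simp only at h1 h2 h3 h4 h1' h2' h3' h4' g1 g2 g3 g4
  have hl := logFactor_pos (s, U, K, E)
  have hll : logFactor (s, U, K, E) ≤ logFactor (s', U', K', E') := by
    refine Real.log_le_log (lt_of_lt_of_le two_pos (le_max_right _ _)) (max_le_max ?_ le_rfl)
    exact mul_le_mul g1 g2 h2.le h1'.le
  refine ⟨?_, ?_, ?_, g4⟩ <;> simp only [growth] <;> gcongr

/-- The maximum with 2 in `logFactor` keeps `growth` positive and monotone for all positive
parameters; it has no effect once `2 ≤ s` and `1 ≤ U`. The precision coordinate of `growth` is the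
identity, and `s * U ^ 2 * E` is merely an upper bound for it. -/
theorem growth_le {s U K E : ℝ} (hs : 2 ≤ s) (hU : 1 ≤ U) (hE : 1 ≤ E) :
    growth (s, U, K, E) ≤
      (20000 * (s * Real.log (s * U)),
        20000 * (s ^ (3 / 2 : ℝ) * U * Real.log (s * U) ^ (1 / 2 : ℝ)),
        20000 * (K * s ^ 4 * U ^ 2 * Real.log (s * U) ^ 2),
        20000 * (s * U ^ 2 * E)) := by
  have h : logFactor (s, U, K, E) = Real.log (s * U) := by
    rw [logFactor, max_eq_left (by nlinarith)]
  refine ⟨?_, ?_, ?_, ?_⟩ <;> simp only [growth, h, le_refl]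
  have : 1 ≤ s * U ^ 2 := by nlinarith
  nlinarith

/-! ### The way back -/

/-- Copy a variable of the given system. -/
def copyVar : Stmt := .setReal 7 (reg 10) (.get 6 (.mul (.const 2) (reg 10))) ;; tick

/-- The loop counter is a column of the given matrix. -/
def colTest : BExpr := .ilt (reg 10) (.get 0 (.const 1))

/-- The program that maps a solution of the new instance to one of the given instance. -/
def backward : Stmt := reset ;; .loop colTest copyVar

/-- The old variable `j` is the first variable of block `j`, stored in cell `2 * j`. -/
theorem runs_backward {n N : ℕ} (hnN : 2 * n ≤ N) {z : EuclideanSpace ℝ (Fin N)} {τ : State}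
    (hn : τ.int 0 1 = n) (hz : EncodesVector τ 6 z) :
    Runs backward τ (reset.maxCost + (n * (copyVar.maxCost + colTest.cost) + colTest.cost))
      fun τ' => EncodesVector τ' 7 (restrictVars n z) := by
  refine Runs.seq (Q := fun τ => τ.int 0 1 = n ∧ EncodesVector τ 6 z ∧ τ.int 8 10 = 0) ?_ ?_
  · refine Stmt.LoopFree.runs (by simp [reset, Stmt.LoopFree]) ⟨?_, ?_, ?_⟩
    · simp [reset, Stmt.run, State.setInt_int, hn]
    · exact hz
    · simp [reset, Stmt.run, State.setInt_int, IExpr.eval]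
  rintro τ ⟨hn, hz, hk⟩
  refine (Runs.for (fun k τ => τ.int 0 1 = n ∧ EncodesVector τ 6 z ∧ τ.int 8 10 = k ∧
    ∀ j < k, τ.real 7 (j : ℕ) = extend z (2 * j)) n copyVar.maxCost ?_ ?_ (σ := τ)
    ⟨hn, hz, hk, by simp⟩).mono le_rfl ?_
  · rintro k τ ⟨hn, -, hk, -⟩
    simp [colTest, BExpr.eval, IExpr.eval, reg, hk, hn]
  · rintro k hkn τ ⟨hn, hz, hk, hj⟩
    refine Stmt.LoopFree.runs (by simp [copyVar, tick, Stmt.LoopFree]) ⟨?_, ?_, ?_, ?_⟩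
    · simp [copyVar, tick, Stmt.run, State.setInt_int, State.setReal_int, hn]
    · intro i
      simpa [copyVar, tick, Stmt.run, State.setInt_real, State.setReal_real] using hz i
    · simp [copyVar, tick, Stmt.run, State.setInt_int, State.setReal_int, IExpr.eval, reg, hk]
    · intro j hjk
      simp only [copyVar, tick, Stmt.run, State.setInt_real, State.setReal_real, IExpr.eval,
        RExpr.eval, reg, hk]
      by_cases hjk' : j = k
      · subst hjk'
        have h1 := hz ⟨2 * j, by omega⟩
        simp only [Nat.cast_mul, Nat.cast_ofNat] at h1
        rw [extend, dif_pos (by omega : 2 * j < N)]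
        simpa using h1
      · have hne : (j : ℤ) ≠ k := by omega
        simpa [hne] using hj j (by omega)
  · rintro τ ⟨-, -, -, hj⟩ i
    exact hj i i.2

end LinSys

namespace LinSys

open RealRAM

/-! ### Parameters of the new instance -/

/-- The squared Frobenius norm has `nnz A` non-zero terms, each at most `W ^ 2`. -/
theorem sigmaMax_le_sqrt_nnz_mul {m n : ℕ} (A : Matrix (Fin m) (Fin n) ℝ) {W : ℝ} (hW : 0 ≤ W)
    (h : ∀ i j, |A i j| ≤ W) : sigmaMax A ≤ √(nnz A) * W := by
  classical
  refine sigmaMax_le_of_sum_sq_le A (by positivity) ?_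
  rw [mul_pow, Real.sq_sqrt (by positivity), ← Fintype.sum_prod_type']
  calc ∑ p : Fin m × Fin n, A p.1 p.2 ^ 2
      ≤ ∑ p : Fin m × Fin n, if A p.1 p.2 ≠ 0 then W ^ 2 else 0 := by
        refine Finset.sum_le_sum fun p _ => ?_
        split_ifs with hp
        · exact sq_le_sq' (neg_le_of_abs_le (h _ _)) (le_of_abs_le (h _ _))
        · simp [not_not.1 hp]
    _ = nnz A * W ^ 2 := by
        rw [← Finset.sum_filter, Finset.sum_const, nsmul_eq_mul, nnz, Nat.card_eq_fintype_card,
          Fintype.card_subtype]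

theorem one_le_sqrt_tagCount (l : List Eqn) (r : Fin l.length) :
    1 ≤ √(tagCount l l[r].tag) ∧ √(tagCount l l[r].tag) ≤ √l.length := by
  constructor
  · rw [Real.one_le_sqrt]
    exact_mod_cast tagCount_pos (List.getElem_mem r.2)
  · exact Real.sqrt_le_sqrt (by exact_mod_cast List.countP_le_length)

theorem abs_sysMatrix_mem {l : List Eqn} {nb : ℕ} {M : ℝ}
    (h : ∀ e ∈ l, e.i ≠ e.j ∧ 1 ≤ e.mu ∧ e.mu ≤ M) {r : Fin l.length} {q : Fin (2 * nb)}
    (hrq : sysMatrix l nb r q ≠ 0) :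
    1 ≤ |sysMatrix l nb r q| ∧ |sysMatrix l nb r q| ≤ √l.length * M := by
  obtain ⟨hij, h1, hM⟩ := h _ (List.getElem_mem r.2)
  obtain ⟨g1, g2⟩ := one_le_sqrt_tagCount l r
  have hc : l[r].coef q ≠ 0 := fun hc => hrq (by simp only [sysMatrix, hc, mul_zero])
  obtain ⟨w, hw⟩ := Eqn.exists_mem_cols hc
  obtain ⟨hw1, hw2, -⟩ := Eqn.eq_of_mem_cols hij hw
  have h2 : |l[r].mu * l[r].coef q| = l[r].mu := by
    rw [Fin.getElem_fin, ← hw1, hw2, abs_of_nonneg (by linarith)]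
  simp only [sysMatrix, mul_assoc, abs_mul (√_), h2, abs_of_nonneg (Real.sqrt_nonneg _)]
  exact ⟨one_le_mul_of_one_le_of_one_le g1 h1,
    mul_le_mul g2 hM (by linarith [show 1 ≤ l[r].mu from h1]) (Real.sqrt_nonneg _)⟩

theorem liftRhs_apply {m : ℕ} {l : List Eqn} (htag : ∀ e ∈ l, e.tag < m)
    (c : EuclideanSpace ℝ (Fin m)) (r : Fin l.length) :
    ∃ i, liftRhs l c r = c i / √(tagCount l l[r].tag) :=
  ⟨⟨l[r].tag, htag _ (List.getElem_mem r.2)⟩, by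
    simp [liftRhs, extend, htag _ (List.getElem_mem r.2)]⟩

theorem abs_liftRhs_le {m : ℕ} {l : List Eqn} (htag : ∀ e ∈ l, e.tag < m)
    {c : EuclideanSpace ℝ (Fin m)} {U : ℝ} (hc : ∀ i, |c i| ≤ U) (r : Fin l.length) :
    |liftRhs l c r| ≤ U := by
  obtain ⟨i, hi⟩ := liftRhs_apply htag c r
  rw [hi, abs_div, abs_of_nonneg (Real.sqrt_nonneg _)]
  exact (div_le_self (abs_nonneg _) (one_le_sqrt_tagCount l r).1).trans (hc i)

theorem le_abs_liftRhs {m : ℕ} {l : List Eqn} (htag : ∀ e ∈ l, e.tag < m)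
    {c : EuclideanSpace ℝ (Fin m)} {U : ℝ} (hU : 0 < U) (hc : ∀ i, c i ≠ 0 → 1 / |c i| ≤ U)
    {r : Fin l.length} (hr : liftRhs l c r ≠ 0) : 1 / (√l.length * U) ≤ |liftRhs l c r| := by
  obtain ⟨i, hi⟩ := liftRhs_apply htag c r
  obtain ⟨g1, g2⟩ := one_le_sqrt_tagCount l r
  have hc0 : c i ≠ 0 := fun h0 => hr (by rw [hi, h0, zero_div])
  have hcp := abs_pos.2 hc0
  rw [hi, abs_div, abs_of_nonneg (Real.sqrt_nonneg _), mul_comm, ← div_div]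
  have h2 : 1 / U ≤ |c i| := (one_div_le hcp hU).1 (hc i hc0)
  gcongr

/-- Both parts rest on `log 2 > 1/2`: it gives `log₂ U ≤ 2 log U` and `1 ≤ 2 log s`. -/
theorem log_bounds {s : ℕ} {U : ℝ} (hs : 2 ≤ s) (hU : 1 ≤ U) :
    1 ≤ s * Real.log (s * U) ∧ (Nat.log 2 ⌊U⌋₊ + 1 : ℝ) ≤ 2 * Real.log (s * U) := by
  have h2 := Real.log_two_gt_d9
  have hs' : (2 : ℝ) ≤ s := by exact_mod_cast hs
  have h3 : Real.log 2 ≤ Real.log s := Real.log_le_log two_pos hs'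
  have h4 : 0 ≤ Real.log U := Real.log_nonneg hU
  have h5 : Real.log (s * U) = Real.log s + Real.log U :=
    Real.log_mul (by positivity) (by positivity)
  refine ⟨by rw [h5]; nlinarith, ?_⟩
  have h6 : (Nat.log 2 ⌊U⌋₊ : ℝ) ≤ Real.log U / Real.log 2 := by
    refine (Real.natLog_le_logb _ _).trans ?_
    rw [Real.logb, Nat.cast_ofNat]
    gcongr
    · exact_mod_cast Nat.floor_pos.2 hU
    · exact Nat.floor_le (by linarith)
  have h7 : Real.log U / Real.log 2 ≤ 2 * Real.log U := by
    rw [div_le_iff₀ (by linarith)]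
    nlinarith
  rw [h5]
  linarith

/-- Each equation has at least two coefficients, so there are at least `14 * q + 2 * m` of them,
while the columns number `2 * n + 8 * q` with `n ≤ q`. -/
theorem max_le_nnz_sysMatrix {d : Data} {M : ℝ} {l : List Eqn} {q : ℕ}
    (h : Data.Complete (d := d) M l (d.n + 4 * q)) (hl : l.length = 7 * q + d.m) (hq : d.n ≤ q) :
    max l.length (2 * (d.n + 4 * q)) ≤ nnz (sysMatrix l (d.n + 4 * q)) := by
  rw [(nnz_sysMatrix fun e he => ⟨(h.wf e he).1, (h.wf e he).2.1, (h.wf e he).2.2.1,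
    (h.wf e he).2.2.2.1⟩).1]
  have := (length_entries l).1
  exact max_le (by omega) (by omega)

set_option maxHeartbeats 800000 in
-- All sizes are measured by `y = √(s log (s U))`: the dimensions and the number of coefficients are
-- `O(y²)`, the entries `O(y U)`, `sigmaMax B` is `O(y² U)` and `(sigmaMin B)⁻¹` is `O(y s U κ(A))`.
-- The product `y³ s U² κ(A)` is at most `y⁴ s² U² κ(A)`, which is the claimed bound.
theorem sparseComplexity_le {d : Data} {A : Matrix (Fin d.m) (Fin d.n) ℝ}
    {c : EuclideanSpace ℝ (Fin d.m)} {ε U : ℝ} {l : List Eqn} {q : ℕ} (hA0 : A ≠ 0)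
    (hs : 2 ≤ d.s) (hds : d.s = nnz A) (hms : d.m ≤ d.s) (hns : d.n ≤ d.s)
    (hU : (sparseComplexity A c ε).2.1 = U) (h1 : ∃ i j, 1 ≤ |A i j|)
    (hA : ∀ (z : ℕ → ℝ) (i : Fin d.m), d.rowSum d.ent i z = ∑ j, A i j * z (2 * j))
    (hent : ∀ k < d.s, ∃ i j, (d.ent k : ℝ) = A i j ∧ A i j ≠ 0)
    (h : Data.Complete (d := d) ⌊U⌋₊ l (d.n + 4 * q)) (hl : l.length = 7 * q + d.m)
    (hq : d.s ≤ q) (hq' : q ≤ 2 * (d.s * (Nat.log 2 ⌊U⌋₊ + 1))) :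
    sparseComplexity (sysMatrix l (d.n + 4 * q)) (liftRhs l c) ε ≤
      growth (sparseComplexity A c ε) := by
  set B := sysMatrix l (d.n + 4 * q) with hB
  set L := Real.log (d.s * U) with hL
  have hAU : ∀ i j, |A i j| ≤ U := fun i j => by
    rw [← hU]
    exact (abs_le_maxAbs (fun p : Fin d.m × Fin d.n => A p.1 p.2) (i, j)).trans
      ((le_max_left _ _).trans (le_max_left _ _))
  have hcU : ∀ i, |c i| ≤ U := fun i => by
    rw [← hU]
    exact (abs_le_maxAbs (fun i => c i) i).trans ((le_max_right _ _).trans (le_max_left _ _))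
  have hcU' : ∀ i, c i ≠ 0 → 1 / |c i| ≤ U := fun i hi => by
    rw [← hU]
    exact (inv_abs_le (fun i => c i) hi).trans ((le_max_right _ _).trans (le_max_right _ _))
  obtain ⟨i₀, j₀, hij⟩ := h1
  have hU1 : 1 ≤ U := hij.trans (hAU _ _)
  have hs' : (2 : ℝ) ≤ d.s := by exact_mod_cast hs
  obtain ⟨hX, hlog⟩ := log_bounds hs hU1
  rw [← hL] at hX hlog
  have hL0 : 0 < L := by
    by_contra! hn
    nlinarith
  set y := √(d.s * L) with hy
  have hy2 : y ^ 2 = d.s * L := Real.sq_sqrt (by positivity)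
  have hy1 : 1 ≤ y := Real.one_le_sqrt.2 hX
  have hqX : (q : ℝ) ≤ 4 * y ^ 2 := by
    calc (q : ℝ) ≤ 2 * (d.s * (Nat.log 2 ⌊U⌋₊ + 1)) := by exact_mod_cast hq'
      _ ≤ 2 * (d.s * (2 * L)) := by gcongr
      _ = 4 * y ^ 2 := by rw [hy2]; ring
  have hqs : (d.s : ℝ) ≤ q := by exact_mod_cast hq
  have hms' : (d.m : ℝ) ≤ d.s := by exact_mod_cast hms
  have hns' : (d.n : ℝ) ≤ d.s := by exact_mod_cast hns
  have hlen : (l.length : ℝ) ≤ 32 * y ^ 2 := by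
    rw [hl]
    push_cast
    linarith
  -- The roots of 32, 40 and 128 are rounded up to 6, 7 and 12 in the next estimates; 40 comes from
  -- `2 * (n + 4 * q) ≤ 10 * q`.
  have hsqrt : √(l.length : ℝ) ≤ 6 * y :=
    Real.sqrt_le_iff.2 ⟨by positivity, by nlinarith⟩
  have hnb : √((2 * (d.n + 4 * q) : ℕ) : ℝ) ≤ 7 * y := by
    refine Real.sqrt_le_iff.2 ⟨by positivity, ?_⟩
    push_cast
    nlinarith
  have hnnz : (nnz B : ℝ) ≤ 128 * y ^ 2 := by
    rw [hB, (nnz_sysMatrix fun e he => ⟨(h.wf e he).1, (h.wf e he).2.1, (h.wf e he).2.2.1,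
      (h.wf e he).2.2.2.1⟩).1]
    have : ((entries l).length : ℝ) ≤ 4 * l.length := by exact_mod_cast (length_entries l).2
    linarith
  have hnnz' : √(nnz B : ℝ) ≤ 12 * y := Real.sqrt_le_iff.2 ⟨by positivity, by nlinarith⟩
  have hZU : ((⌊U⌋₊ : ℕ) : ℝ) ≤ U := Nat.floor_le (by linarith)
  have hBne : ∀ r p, B r p ≠ 0 → 1 ≤ |B r p| ∧ |B r p| ≤ 6 * y * U := fun r p hrp => by
    obtain ⟨g1, g2⟩ := abs_sysMatrix_mem (fun e he => ⟨(h.wf e he).1, (h.wf e he).2.2.2.1,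
      (h.wf e he).2.2.2.2.1⟩) hrp
    exact ⟨g1, g2.trans (by gcongr)⟩
  have hBle : ∀ r p, |B r p| ≤ 6 * y * U := fun r p => by
    by_cases hrp : B r p = 0
    · rw [hrp, abs_zero]
      positivity
    · exact (hBne r p hrp).2
  have htag : ∀ e ∈ l, e.tag < d.m := fun e he => (h.wf e he).2.2.2.2.2
  have hW1 : 1 ≤ 6 * y * U := by nlinarith
  have hB0 : B ≠ 0 := by
    intro h0
    have h2 := (le_max_left _ _).trans (max_le_nnz_sysMatrix h hl (hns.trans hq))
    rw [← hB, h0] at h2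
    simp only [nnz, Matrix.zero_apply, ne_eq, not_true_eq_false, Nat.card_of_isEmpty] at h2
    omega
  have hlf : logFactor (sparseComplexity A c ε) = L := by
    have : (sparseComplexity A c ε).1 = d.s := by rw [hds]; rfl
    rw [logFactor, hU, this, max_eq_left (by nlinarith)]
  have hK1 : 1 ≤ condNumber A := (one_le_div (sigmaMin_pos hA0)).2 (sigmaMin_le_sigmaMax hA0)
  -- An integer entry of absolute value at least 1 forces `1 ≤ sigmaMax A`.
  have hKA : (sigmaMin A)⁻¹ ≤ condNumber A := by
    rw [condNumber, inv_eq_one_div]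
    have := sigmaMin_pos hA0
    gcongr
    exact hij.trans (abs_apply_le_sigmaMax A _ _)
  refine ⟨?_, ?_, ?_, le_rfl⟩
  · simp only [growth, hlf]
    rw [show (sparseComplexity A c ε).1 = d.s by rw [hds]; rfl, ← hy2]
    exact hnnz.trans (by nlinarith)
  · simp only [growth, hlf]
    rw [show (sparseComplexity A c ε).1 = d.s by rw [hds]; rfl, hU]
    have hyW : 6 * y * U ≤ 20000 * ((d.s : ℝ) ^ (3 / 2 : ℝ) * U * L ^ (1 / 2 : ℝ)) := by
      have : y ≤ (d.s : ℝ) ^ (3 / 2 : ℝ) * L ^ (1 / 2 : ℝ) := by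
        rw [hy, Real.sqrt_eq_rpow, Real.mul_rpow (by positivity) hL0.le]
        gcongr
        · linarith
        · norm_num
      nlinarith
    refine le_trans (max_le (max_le ?_ ?_) (max_le ?_ ?_)) hyW
    · exact Real.iSup_le (fun p => hBle p.1 p.2) (by positivity)
    · refine Real.iSup_le (fun r => ?_) (by positivity)
      exact (abs_liftRhs_le htag hcU r).trans (by nlinarith)
    · refine one_div_minNonzero_le _ (by positivity) fun p hp => ?_
      exact (div_le_one (by positivity)).2 hW1 |>.trans (hBne _ _ hp).1
    · refine one_div_minNonzero_le _ (by positivity) fun r hr => ?_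
      refine le_trans ?_ (le_abs_liftRhs htag (by positivity) hcU' hr)
      have hl0 : 0 < √(l.length : ℝ) := Real.sqrt_pos.2 (by exact_mod_cast r.pos)
      exact one_div_le_one_div_of_le (mul_pos hl0 (by linarith))
        (mul_le_mul_of_nonneg_right hsqrt (by linarith))
  · simp only [growth, hlf]
    rw [show (sparseComplexity A c ε).1 = d.s by rw [hds]; rfl, hU,
      show (sparseComplexity A c ε).2.2.1 = condNumber A from rfl,
      show (sparseComplexity B (liftRhs l c) ε).2.2.1 = sigmaMax B * (sigmaMin B)⁻¹ from
        div_eq_mul_inv _ _]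
    set K := condNumber A with hK
    have htot : d.total ≤ d.s * U := by
      have : d.total ≤ ∑ _k ∈ Finset.range d.s, U := by
        refine Finset.sum_le_sum fun k hk => ?_
        obtain ⟨i, j, hk1, -⟩ := hent k (Finset.mem_range.1 hk)
        rw [hk1]
        exact hAU _ _
      simpa using this
    have hsU : 2 ≤ d.s * U := by nlinarith
    have hmax : sigmaMax B ≤ 72 * y ^ 2 * U :=
      calc sigmaMax B ≤ √(nnz B) * (6 * y * U) := sigmaMax_le_sqrt_nnz_mul B (by positivity) hBle
        _ ≤ 12 * y * (6 * y * U) := by gcongr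
        _ = 72 * y ^ 2 * U := by ring
    have htot0 := d.total_nonneg
    have hmin : (sigmaMin B)⁻¹ ≤ 210 * y * (d.s * U) * K :=
      calc (sigmaMin B)⁻¹ ≤ √((2 * (d.n + 4 * q) : ℕ) : ℝ) * (10 * (1 + 2 * d.total)) *
            (sigmaMin A)⁻¹ + √((2 * (d.n + 4 * q) : ℕ) : ℝ) * 10 :=
          (lift_sysMatrix h hA).inv_sigmaMin_le hA0 hB0 (by positivity)
        _ ≤ 7 * y * (10 * (1 + 2 * (d.s * U))) * K + 7 * y * 10 := by
          gcongr
          exact inv_nonneg.2 (sigmaMin_pos hA0).le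
        _ ≤ 7 * y * (10 * (1 + 2 * (d.s * U))) * K + 7 * y * 10 * K :=
          add_le_add_right (le_mul_of_one_le_right (by positivity) hK1) _
        _ = 70 * y * (2 + 2 * (d.s * U)) * K := by ring
        _ ≤ 70 * y * (3 * (d.s * U)) * K := by
          gcongr
          linarith
        _ = 210 * y * (d.s * U) * K := by ring
    -- `15120 = 72 * 210`. Enlarging `y ^ 3` to `y ^ 4 * s`, by `1 ≤ y` and `1 ≤ s`, replaces the
    -- root by the integral power `y ^ 4 = (s * log (s * U)) ^ 2`.
    calc sigmaMax B * (sigmaMin B)⁻¹ ≤ 72 * y ^ 2 * U * (210 * y * (d.s * U) * K) :=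
          mul_le_mul hmax hmin (inv_nonneg.2 (sigmaMin_pos hB0).le) (by positivity)
      _ = 15120 * (K * (d.s * U ^ 2)) * (y ^ 3 * 1) := by ring
      _ ≤ 20000 * (K * (d.s * U ^ 2)) * (y ^ 4 * d.s) := by
          gcongr
          · norm_num
          · norm_num
          · linarith
      _ = 20000 * (K * d.s ^ 4 * U ^ 2 * L ^ 2) := by
          rw [show y ^ 4 = (y ^ 2) ^ 2 by ring, hy2]
          ring

end LinSys

/-! ### The reduction -/

open LinSys in
theorem mainTheorem3 :
    ∃ f : Params → Params,
      (∃ C : ℝ, ∀ s U K E : ℝ, 2 ≤ s → 1 ≤ U → 1 ≤ K → 1 ≤ E →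
        f (s, U, K, E) ≤
          (C * (s * Real.log (s * U)),
            C * (s ^ (3 / 2 : ℝ) * U * Real.log (s * U) ^ (1 / 2 : ℝ)),
            C * (K * s ^ 4 * U ^ 2 * Real.log (s * U) ^ 2),
            C * (s * U ^ 2 * E))) ∧
      EfficientlyReducible zeroSumPowerTwo twoCommodity f
        (fun p => p.1 * Real.log (p.1 * p.2.1)) := by
  refine ⟨growth, ⟨20000, fun s U K E hs hU _ hE => growth_le hs hU hE⟩, growth_mapsTo,
    growth_monotoneOn, ?_⟩
  obtain ⟨K, hK⟩ := runs_forward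
  set K' : ℕ := reset.maxCost + (copyVar.maxCost + colTest.cost + colTest.cost) with hK'
  refine ⟨forward, backward, 2 * K + K', ?_⟩
  rintro m n A c ε hA ⟨hA0, hmn, hε, hε1⟩ σ hσ
  obtain ⟨hs, i₀, j₀, hij⟩ := two_le_nnz hA hA0
  obtain ⟨d, rfl, rfl, hds, hin, hrow, hent⟩ := exists_data hA hA0 hσ
  rw [← hds] at hs hmn
  obtain ⟨hms, hns⟩ := max_le_iff.1 hmn
  obtain ⟨U, hU⟩ : ∃ U, (sparseComplexity A c ε).2.1 = U := ⟨_, rfl⟩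
  have hAU : ∀ i j, |A i j| ≤ U := fun i j => by
    rw [← hU]
    exact (abs_le_maxAbs (fun p : Fin d.m × Fin d.n => A p.1 p.2) (i, j)).trans
      ((le_max_left _ _).trans (le_max_left _ _))
  have hU1 : 1 ≤ U := hij.trans (hAU _ _)
  -- The entries are integers, so the bound `U` may be rounded down to `⌊U⌋`, the integer bound
  -- required for counting digits.
  have hZ : ∀ k < d.s, (d.ent k).natAbs ≤ ⌊U⌋₊ := fun k hk => by
    obtain ⟨i, j, hk1, -⟩ := hent k hk
    refine Nat.le_floor ?_
    rw [Nat.cast_natAbs, Int.cast_abs, hk1]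
    exact hAU _ _
  have hne : ∃ k < d.s, d.ent k ≠ 0 := by
    obtain ⟨i, j, hk1, hk2⟩ := hent 0 (by omega)
    exact ⟨0, by omega, fun h0 => hk2 (by rw [← hk1, h0, Int.cast_zero])⟩
  obtain ⟨σ', t, hex, ht, l, q, hfin, hcomp, hl, hq, hq'⟩ :=
    hK d (extend c) ε σ ⌊U⌋₊ hin hms hZ hne
  obtain ⟨hlog, hlog'⟩ := log_bounds hs hU1
  have hwf : ∀ e ∈ l, e.i ≠ e.j ∧ e.i < d.n + 4 * q ∧ e.j < d.n + 4 * q ∧ 1 ≤ e.mu :=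
    fun e he => ⟨(hcomp.wf e he).1, (hcomp.wf e he).2.1, (hcomp.wf e he).2.2.1,
      (hcomp.wf e he).2.2.2.1⟩
  have hmax := max_le_nnz_sysMatrix hcomp hl (hns.trans hq)
  refine ⟨σ', t, hex, ?_, l.length, 2 * (d.n + 4 * q), sysMatrix l (d.n + 4 * q), liftRhs l c, ε,
    ⟨hfin.encodesMatrix hwf, fun r => hfin.rhs r r.2, hfin.eps⟩,
    sysMatrix_mem_twoCommodity _ _ fun e he => ⟨(hwf e he).1, (hwf e he).2.1, (hwf e he).2.2.1⟩,
    ⟨?_, hmax, hε, hε1⟩,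
    sparseComplexity_le hA0 hs hds hms hns hU ⟨i₀, j₀, hij⟩ hrow hent hcomp hl hq hq', ?_⟩
  · simp only
    rw [hU, show (sparseComplexity A c ε).1 = d.s by rw [hds]; rfl]
    calc (t : ℝ) ≤ K * (d.s * (Nat.log 2 ⌊U⌋₊ + 1)) := by exact_mod_cast ht
      _ ≤ K * (d.s * (2 * Real.log (d.s * U))) := by gcongr
      _ ≤ K * (d.s * (2 * Real.log (d.s * U))) + K' * (d.s * Real.log (d.s * U)) :=
        le_add_of_nonneg_right (by positivity)
      _ = (2 * K + K') * (d.s * Real.log (d.s * U)) := by ring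
  · intro h0
    have : nnz (sysMatrix l (d.n + 4 * q)) = 0 := by
      rw [h0, nnz]
      simp
    rw [this] at hmax
    have := (le_max_left _ _).trans hmax
    omega
  · intro x hx τ hτ _ hτx
    obtain ⟨τ', u, hex', hu, hτ'⟩ := runs_backward (by omega) hτ.2.1 hτx
    refine ⟨τ', u, _, hex', ?_, hτ', (lift_sysMatrix hcomp hrow).isLSASolution hx⟩
    -- The loop runs over `d.n ≤ d.s` columns, and the fixed costs are absorbed by `1 ≤ d.s`.
    have hu' : u ≤ K' * d.s := by
      refine hu.trans ?_
      rw [hK']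
      nlinarith [Nat.zero_le reset.maxCost, Nat.zero_le copyVar.maxCost, Nat.zero_le colTest.cost]
    rw [← hds]
    calc (u : ℝ) ≤ K' * d.s := by exact_mod_cast hu'
      _ ≤ (2 * K + K') * d.s := by
        gcongr
        exact le_add_of_nonneg_left (by positivity)
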